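/- Let $F$ be a non-archimedean local field with normalized absolute value $|\cdot|$, let $\operatorname{Irr}_c$ be the set of equivalence classes of irreducible smooth complex supercuspidal representations of the groups $\mathrm{GL}_n(F)$, $n\ge 1$, and write $\overrightarrow{\rho}=\rho\otimes|\det|$, $\overleftarrow{\rho}=\rho\otimes|\det|^{-1}$. A segment is a nonempty finite set $\Delta=\{\rho_1,\dots,\rho_k\}\subset\operatorname{Irr}_c$ with $\rho_{i+1}=\overrightarrow{\rho_i}$ for $1\le i<k$. A multisegment is a finite formal sum $\mathfrak m=\sum_{i\in I}\Delta_i$ of segments, and $\operatorname{supp}\mathfrak m=\sum_{i\in I}\sum_{\rho\in\Delta_i}\rho$. For a finite-dimensional $\operatorname{Irr}_c$-graded complex vector space $V=\bigoplus_\rho V_\rho$ let $\mathbb G(V)$ be the group of grading preserving linear automorphisms of $V$, and let $\mathfrak X(V)$ be the variety of pairs $(A,B)$ of commuting linear endomorphisms of $V$ with $A(V_\rho)\subset V_{\overrightarrow{\rho}}$ and $B(V_\rho)\subset V_{\overleftarrow{\rho}}$ for all $\rho$; $\mathbb G(V)$ acts on it by simultaneous conjugation. For a multisegment $\mathfrak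 m=\sum_{i\in I}\Delta_i$ with $\operatorname{supp}\mathfrak m=\sum_\rho(\dim V_\rho)\rho$ let $\mathcal O_{\mathfrak m}$ be the $\mathbb G(V)$-orbit of those $A$ (with $A(V_\rho)\subset V_{\overrightarrow{\rho}}$ for all $\rho$) for which $V$ has a basis $x_{\rho,i}\in V_\rho$ ($i\in I$, $\rho\in\Delta_i$) with $Ax_{\rho,i}=x_{\overrightarrow{\rho},i}$, where $x_{\overrightarrow{\rho},i}=0$ if $\overrightarrow{\rho}\notin\Delta_i$. Let $\mathfrak C^\circ_{\mathfrak m}=\{(A,B)\in\mathfrak X(V):A\in\mathcal O_{\mathfrak m}\}$ and let $\mathfrak C_{\mathfrak m}$ be its Zariski closure, an irreducible component of $\mathfrak X(V)$. Let $V,V'$ be finite-dimensional $\operatorname{Irr}_c$-graded complex vector spaces and $\mathfrak m,\mathfrak m'$ multisegments with $\operatorname{supp}\mathfrak m=\sum_\rho(\dim V_\rho)\rho$ and $\operatorname{supp}\mathfrak m'=\sum_\rho(\dim V'_\rho)\rho$. Let $\tilde V=V\oplus V'$, with inclusions $\iota:V\to\tilde V$, $\iota':V'\to\tilde V$ and projection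 $\jmath:\tilde V\to V'$. Let $\mathfrak X^{\iota}(\tilde V)$ be the set of $(A,B)\in\mathfrak X(\tilde V)$ with $A(V),B(V)\subset V$, and let $p_\iota:\mathfrak X^\iota(\tilde V)\to\mathfrak X(V)\times\mathfrak X(V')$ take a pair to the pairs it induces on $V$ and on $\tilde V/V\simeq V'$; define $p_{\iota'}:\mathfrak X^{\iota'}(\tilde V)\to\mathfrak X(V')\times\mathfrak X(V)$ in the same way, with the roles of $V$ and $V'$ interchanged. Let $\mathbb P^\iota$ be the stabilizer of $\iota(V)$ in $\mathbb G(\tilde V)$ and $\mathbb U^\iota=\{g\in\mathbb G(\tilde V):g\circ\iota=\iota,\ \jmath\circ g=\jmath\}$ its unipotent radical. With bars denoting Zariski closures, put $$\mathfrak Y^{\iota}_{\mathfrak m,\mathfrak m'}=\overline{\mathfrak C_{\mathfrak m+\mathfrak m'}\cap p_\iota^{-1}(\mathfrak C^\circ_{\mathfrak m}\times\mathfrak C^\circ_{\mathfrak m'})},\qquad \mathfrak Y^{\iota'}_{\mathfrak m',\mathfrak m}=\overline{\mathfrak C_{\mathfrak m+\mathfrak m'}\cap p_{\iota'}^{-1}(\mathfrak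 C^\circ_{\mathfrak m'}\times\mathfrak C^\circ_{\mathfrak m})},\qquad \mathfrak Z_{\mathfrak m,\mathfrak m'}=\mathfrak Y^{\iota}_{\mathfrak m,\mathfrak m'}\cap\mathfrak Y^{\iota'}_{\mathfrak m',\mathfrak m}.$$ **Proposition.** The following conditions are equivalent (dense means: a Zariski dense subset). 1. $\mathbb G(\tilde V)\cdot\mathfrak Y^{\iota'}_{\mathfrak m',\mathfrak m}$ is dense in $\mathfrak C_{\mathfrak m+\mathfrak m'}$. 2. $\mathbb U^{\iota}\cdot\mathfrak Y^{\iota'}_{\mathfrak m',\mathfrak m}$ is dense in $\mathfrak C_{\mathfrak m+\mathfrak m'}$. 3. $\mathbb P^{\iota}\cdot\mathfrak Z_{\mathfrak m,\mathfrak m'}$ is dense in $\mathfrak Y^{\iota}_{\mathfrak m,\mathfrak m'}$. 4. $\mathbb U^{\iota}\cdot\mathfrak Z_{\mathfrak m,\mathfrak m'}$ is dense in $\mathfrak Y^{\iota}_{\mathfrak m,\mathfrak m'}$. -/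

import Mathlib

open scoped NNReal MatrixGroups WithZero

/-! ### Smooth representations of `GL_n` and supercuspidal representations -/

section LocalField

variable (F : Type*) [Field F] [ValuativeRel F] [TopologicalSpace F]
  [IsNonarchimedeanLocalField F]

/-- The cardinality of the residue field of `F`. -/
noncomputable def residueCard : ℕ :=
  Nat.card (IsLocalRing.ResidueField (ValuativeRel.valuation F).integer)

theorem one_lt_residueCard : 1 < residueCard F :=
  Finite.one_lt_card (α := IsLocalRing.ResidueField (ValuativeRel.valuation F).integer)

theorem residueCard_ne_zero : (residueCard F : ℝ≥0) ≠ 0 := by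
  have := one_lt_residueCard F
  exact_mod_cast (by omega : residueCard F ≠ 0)

/-- The normalized absolute value `|·|` of `F`: a generator of the maximal ideal of the ring of
integers has absolute value `q⁻¹`, where `q` is the cardinality of the residue field. -/
noncomputable def normalizedAbs : F →*₀ ℝ≥0 :=
  (WithZeroMulInt.toNNReal (residueCard_ne_zero F)).comp
    ((MonoidWithZeroHom.ofClass (IsNonarchimedeanLocalField.valueGroupWithZeroIsoInt F)).comp
      (MonoidWithZeroHom.ofClass (ValuativeRel.valuation F)))

/-- The normalized absolute value as a character `Fˣ → ℂˣ`. -/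
noncomputable def absChar : Fˣ →* ℂˣ :=
  Units.map ((Complex.ofRealHom : ℝ →* ℂ).comp
    ((NNReal.toRealHom : ℝ≥0 →* ℝ).comp (normalizedAbs F : F →* ℝ≥0)))

theorem normalizedAbs_eq_one_iff (x : F) :
    normalizedAbs F x = 1 ↔ ValuativeRel.valuation F x = 1 := by
  have h1 : (residueCard F : ℝ≥0) ≠ 1 := by
    exact_mod_cast (one_lt_residueCard F).ne'
  constructor
  · intro h
    have hx : ValuativeRel.valuation F x ≠ 0 := by
      intro h0
      rw [(ValuativeRel.valuation F).zero_iff] at h0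
      simp [h0] at h
    have := (WithZeroMulInt.toNNReal_eq_one_iff
      (IsNonarchimedeanLocalField.valueGroupWithZeroIsoInt F (ValuativeRel.valuation F x))
      (residueCard_ne_zero F) h1).1 h
    exact (map_eq_one_iff _ (IsNonarchimedeanLocalField.valueGroupWithZeroIsoInt F).injective).1
      this
  · intro h
    change WithZeroMulInt.toNNReal (residueCard_ne_zero F) (IsNonarchimedeanLocalField.valueGroupWithZeroIsoInt F
      (ValuativeRel.valuation F x)) = 1
    rw [h, map_one, map_one]

theorem isOpen_ker_absChar : IsOpen ((absChar F).ker : Set Fˣ) := by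
  have h : ((absChar F).ker : Set Fˣ) =
      Units.val ⁻¹' {x : F | ValuativeRel.valuation F x = 1} := by
    ext x
    rw [Set.mem_preimage, Set.mem_ofPred_eq, ← normalizedAbs_eq_one_iff, SetLike.mem_coe,
      MonoidHom.mem_ker, Units.ext_iff]
    simp [absChar]
  rw [h]
  refine IsOpen.preimage Units.continuous_val ?_
  have := Valuation.isOpen_sphere (v := ValuativeRel.valuation F) one_ne_zero
  simpa using this

end LocalField

section Smooth

variable {F : Type*} [Field F]

/-- A representation is smooth if every vector is fixed by an open subgroup. -/
def IsSmoothRep [TopologicalSpace F] {n : ℕ} {V : Type*} [AddCommGroup V] [Module ℂ V]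
    (π : Representation ℂ (GL (Fin n) F) V) : Prop :=
  ∀ v : V, ∃ K : Subgroup (GL (Fin n) F), IsOpen (K : Set (GL (Fin n) F)) ∧ ∀ g ∈ K, π g v = v

/-- The unipotent radical of the standard (block upper triangular) maximal parabolic subgroup of
`GL_n(F)` of type `(k, n - k)`. -/
def unipotentRadical (F : Type*) [Field F] (n k : ℕ) : Set (GL (Fin n) F) :=
  {u | ∀ i j : Fin n, ¬ (i.val < k ∧ k ≤ j.val) →
    (u : Matrix (Fin n) (Fin n) F) i j = (1 : Matrix (Fin n) (Fin n) F) i j}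

/-- A smooth representation is cuspidal if its Jacquet modules `V / ⟨π(u)v - v⟩` with respect to
all proper standard parabolic subgroups vanish. By transitivity of Jacquet modules, it is enough
to consider the maximal ones. -/
def IsCuspidalRep {n : ℕ} {V : Type*} [AddCommGroup V] [Module ℂ V]
    (π : Representation ℂ (GL (Fin n) F) V) : Prop :=
  ∀ k : ℕ, 0 < k → k < n →
    Submodule.span ℂ {w : V | ∃ u ∈ unipotentRadical F n k, ∃ v : V, w = π u v - v} = ⊤

/-- The twist `π ⊗ (χ ∘ det)`. -/
noncomputable def twistRep {n : ℕ} {V : Type*} [AddCommGroup V] [Module ℂ V] (χ : Fˣ →* ℂˣ)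
    (π : Representation ℂ (GL (Fin n) F) V) : Representation ℂ (GL (Fin n) F) V where
  toFun g := (χ (Matrix.GeneralLinearGroup.det g) : ℂ) • π g
  map_one' := by simp
  map_mul' g h := by
    rw [map_mul, map_mul, map_mul, Units.val_mul, smul_mul_smul_comm]

theorem det_of_mem_unipotentRadical {n k : ℕ} {u : GL (Fin n) F}
    (hu : u ∈ unipotentRadical F n k) : Matrix.GeneralLinearGroup.det u = 1 := by
  ext
  have h : (u : Matrix (Fin n) (Fin n) F).IsUpperTriangular := by
    intro i j hij
    rw [hu i j (fun h => by simp at hij; omega), Matrix.one_apply_ne]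
    exact (ne_of_lt hij).symm
  simp only [Matrix.GeneralLinearGroup.val_det_apply, Units.val_one]
  rw [Matrix.det_of_isUpperTriangular h]
  refine Finset.prod_eq_one fun i _ => ?_
  rw [hu i i (by omega), Matrix.one_apply_eq]

variable (F) in
/-- An irreducible smooth supercuspidal representation of `GL_n(F)`. (For complex coefficients,
an irreducible smooth representation is supercuspidal, i.e. not a subquotient of a properly
parabolically induced representation, if and only if it is cuspidal.) An irreducible smooth
representation has countable dimension, so its space may be taken in `Type`. -/
structure SupercuspidalRep [TopologicalSpace F] (n : ℕ) where
  V : Type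
  [addCommGroup : AddCommGroup V]
  [module : Module ℂ V]
  π : Representation ℂ (GL (Fin n) F) V
  smooth : IsSmoothRep π
  irreducible : π.IsIrreducible
  cuspidal : IsCuspidalRep π

attribute [instance] SupercuspidalRep.addCommGroup SupercuspidalRep.module

/-- Equivalence of representations. -/
instance SupercuspidalRep.setoid [TopologicalSpace F] (n : ℕ) : Setoid (SupercuspidalRep F n) where
  r σ τ := Nonempty (σ.π.Equiv τ.π)
  iseqv := ⟨fun σ => ⟨.refl σ.π⟩, fun ⟨e⟩ => ⟨e.symm⟩, fun ⟨e⟩ ⟨e'⟩ => ⟨e.trans e'⟩⟩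

theorem isSmoothRep_twistRep [TopologicalSpace F] [IsTopologicalRing F] {n : ℕ} {V : Type*} [AddCommGroup V]
    [Module ℂ V] {χ : Fˣ →* ℂˣ} (hχ : IsOpen (χ.ker : Set Fˣ))
    {π : Representation ℂ (GL (Fin n) F) V} (h : IsSmoothRep π) :
    IsSmoothRep (twistRep χ π) := by
  intro v
  obtain ⟨K, hK, hv⟩ := h v
  refine ⟨K ⊓ χ.ker.comap Matrix.GeneralLinearGroup.det,
    hK.inter (hχ.preimage Matrix.GeneralLinearGroup.continuous_det), ?_⟩
  rintro g ⟨hg, hg'⟩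
  have : χ (Matrix.GeneralLinearGroup.det g) = 1 := hg'
  simp [twistRep, this, hv g hg]

theorem isCuspidalRep_twistRep {n : ℕ} {V : Type*} [AddCommGroup V]
    [Module ℂ V] (χ : Fˣ →* ℂˣ) {π : Representation ℂ (GL (Fin n) F) V}
    (h : IsCuspidalRep π) : IsCuspidalRep (twistRep χ π) := by
  intro k hk hkn
  rw [← h k hk hkn]
  congr 1
  ext w
  refine exists_congr fun u => and_congr_right fun hu => ?_
  simp [twistRep, det_of_mem_unipotentRadical hu]

theorem isIrreducible_twistRep {n : ℕ} {V : Type*} [AddCommGroup V]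
    [Module ℂ V] (χ : Fˣ →* ℂˣ) {π : Representation ℂ (GL (Fin n) F) V}
    (h : π.IsIrreducible) : (twistRep χ π).IsIrreducible := by
  have e : Subrepresentation (twistRep χ π) ≃o Subrepresentation π :=
    { toFun := fun W => ⟨W.toSubmodule, fun g v hv => by
        have := W.toSubmodule.smul_mem ((χ (Matrix.GeneralLinearGroup.det g))⁻¹ : ℂˣ).val
          (W.apply_mem_toSubmodule g hv)
        simpa [twistRep, smul_smul] using this⟩
      invFun := fun W => ⟨W.toSubmodule, fun g v hv =>
        W.toSubmodule.smul_mem _ (W.apply_mem_toSubmodule g hv)⟩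
      left_inv := fun _ => rfl
      right_inv := fun _ => rfl
      map_rel_iff' := Iff.rfl }
  exact (OrderIso.isSimpleOrder_iff e).2 h

/-- The twist of a supercuspidal representation by a smooth character. -/
noncomputable def SupercuspidalRep.twist [TopologicalSpace F] [IsTopologicalRing F] {n : ℕ} (χ : Fˣ →* ℂˣ)
    (hχ : IsOpen (χ.ker : Set Fˣ)) (σ : SupercuspidalRep F n) : SupercuspidalRep F n where
  V := σ.V
  π := twistRep χ σ.π
  smooth := isSmoothRep_twistRep hχ σ.smooth
  irreducible := isIrreducible_twistRep χ σ.irreducible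
  cuspidal := isCuspidalRep_twistRep χ σ.cuspidal

theorem SupercuspidalRep.twist_congr [TopologicalSpace F] [IsTopologicalRing F] {n : ℕ} (χ : Fˣ →* ℂˣ)
    (hχ : IsOpen (χ.ker : Set Fˣ)) {σ τ : SupercuspidalRep F n} (h : σ ≈ τ) :
    σ.twist χ hχ ≈ τ.twist χ hχ := by
  obtain ⟨e⟩ := h
  refine ⟨.mk e.toLinearEquiv fun g => ?_⟩
  ext v
  have := e.toIntertwiningMap.isIntertwining σ.π τ.π g v
  change e.toLinearEquiv ((χ (Matrix.GeneralLinearGroup.det g) : ℂ) • σ.π g v) =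
    (χ (Matrix.GeneralLinearGroup.det g) : ℂ) • τ.π g (e.toLinearEquiv v)
  rw [map_smul]
  exact congrArg _ this

theorem SupercuspidalRep.twist_twist [TopologicalSpace F] [IsTopologicalRing F] {n : ℕ} (χ ψ : Fˣ →* ℂˣ)
    (hχ : IsOpen (χ.ker : Set Fˣ)) (hψ : IsOpen (ψ.ker : Set Fˣ)) (h : χ * ψ = 1)
    (σ : SupercuspidalRep F n) : (σ.twist ψ hψ).twist χ hχ ≈ σ := by
  refine ⟨.mk (LinearEquiv.refl ℂ σ.V) fun g => ?_⟩
  ext v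
  have h' := congrArg Units.val (DFunLike.congr_fun h (Matrix.GeneralLinearGroup.det g))
  simp only [MonoidHom.mul_apply, Units.val_mul, MonoidHom.one_apply, Units.val_one] at h'
  change (χ (Matrix.GeneralLinearGroup.det g) : ℂ) •
    ((ψ (Matrix.GeneralLinearGroup.det g) : ℂ) • σ.π g v) = σ.π g v
  rw [smul_smul, h', one_smul]

end Smooth

section Irrc

variable (F : Type*) [Field F] [ValuativeRel F] [TopologicalSpace F]
  [IsNonarchimedeanLocalField F]

/-- The set of equivalence classes of irreducible supercuspidal representations of the groups
`GL_n(F)`, `n > 0`. -/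
abbrev Irrc : Type _ := Σ n : ℕ+, Quotient (SupercuspidalRep.setoid (F := F) n)

/-- The bijection `ρ ↦ ρ ⊗ |det|` of the set of supercuspidal representations. -/
noncomputable def Irrc.shift : Equiv.Perm (Irrc F) :=
  have hinv : IsOpen ((absChar F)⁻¹.ker : Set Fˣ) := by
    have : (absChar F)⁻¹.ker = (absChar F).ker := by
      ext
      simp [MonoidHom.mem_ker]
    rw [this]
    exact isOpen_ker_absChar F
  Equiv.sigmaCongrRight fun n =>
    { toFun := Quotient.map (SupercuspidalRep.twist (absChar F) (isOpen_ker_absChar F))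
        fun _ _ h => SupercuspidalRep.twist_congr _ _ h
      invFun := Quotient.map (SupercuspidalRep.twist (absChar F)⁻¹ hinv)
        fun _ _ h => SupercuspidalRep.twist_congr _ _ h
      left_inv := fun x => Quotient.inductionOn x fun σ =>
        Quotient.sound (SupercuspidalRep.twist_twist _ _ _ _ (by ext x; simp) σ)
      right_inv := fun x => Quotient.inductionOn x fun σ =>
        Quotient.sound (SupercuspidalRep.twist_twist _ _ _ _ (by ext x; simp) σ) }

end Irrc

/-! ### The shift has no finite orbits

The set `Irrc F` is therefore a disjoint union of lines, each isomorphic to `ℤ` with the shift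
`k ↦ k + 1`. The proof uses Schur's lemma for representations of countable dimension. -/

theorem sigmaCompactSpace_localField (F : Type*) [Field F] [ValuativeRel F] [TopologicalSpace F]
    [IsNonarchimedeanLocalField F] : SigmaCompactSpace F := by
  have : Countable (ValuativeRel.ValueGroupWithZero F) :=
    have : Countable (WithZero (Multiplicative ℤ)) :=
      inferInstanceAs (Countable (Option ℤ))
    (IsNonarchimedeanLocalField.valueGroupWithZeroIsoInt F).injective.countable
  have h := isSigmaCompact_iUnion_of_isCompact
    (fun γ : ValuativeRel.ValueGroupWithZero F => {x : F | ValuativeRel.valuation F x ≤ γ})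
    (fun γ => IsNonarchimedeanLocalField.isCompact_closedBall F γ)
  refine ⟨?_⟩
  convert h
  symm
  exact Set.eq_univ_of_forall fun x => Set.mem_iUnion.2 ⟨ValuativeRel.valuation F x, le_refl (ValuativeRel.valuation F x)⟩

theorem countable_quotient_of_isOpen (F : Type*) [Field F] [ValuativeRel F] [TopologicalSpace F]
    [IsNonarchimedeanLocalField F] {n : ℕ} {K : Subgroup (GL (Fin n) F)}
    (hK : IsOpen (K : Set (GL (Fin n) F))) : Countable (GL (Fin n) F ⧸ K) := by
  have := sigmaCompactSpace_localField F
  have h1 : SigmaCompactSpace (Matrix (Fin n) (Fin n) F) :=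
    inferInstanceAs (SigmaCompactSpace (Fin n → Fin n → F))
  have h2 : SigmaCompactSpace (Matrix (Fin n) (Fin n) F)ᵐᵒᵖ :=
    (MulOpposite.opHomeomorph (M := Matrix (Fin n) (Fin n) F)).symm.isClosedEmbedding.sigmaCompactSpace
  have : IsTopologicalRing F := inferInstance
  have : T1Space F := by
    let := IsTopologicalAddGroup.rightUniformSpace F
    have := isUniformAddGroup_of_addCommGroup (G := F)
    have : T2Space F := inferInstance
    infer_instance
  have h3 : SigmaCompactSpace (GL (Fin n) F) := Units.isClosedEmbedding_embedProduct.sigmaCompactSpace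
  have := QuotientGroup.discreteTopology hK
  have h4 : SigmaCompactSpace (GL (Fin n) F ⧸ K) := by
    have := isSigmaCompact_range (f := (QuotientGroup.mk : GL (Fin n) F → GL (Fin n) F ⧸ K)) QuotientGroup.continuous_mk
    rw [Set.range_eq_univ.2 QuotientGroup.mk_surjective] at this
    exact ⟨this⟩
  exact countable_of_Lindelof_of_discrete

theorem exists_scalar_of_commute {G V : Type*} [Group G] [AddCommGroup V] [Module ℂ V]
    {π : Representation ℂ G V} (hπ : π.IsIrreducible) (hV : Module.rank ℂ V ≤ Cardinal.aleph0)
    (T : Module.End ℂ V) (hT : ∀ g, T ∘ₗ π g = π g ∘ₗ T) : ∃ c : ℂ, T = c • 1 := by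
  by_contra! hne
  have hbij : ∀ c : ℂ, Function.Bijective (T - c • 1 : Module.End ℂ V) := by
    intro c
    let f : Representation.IntertwiningMap π π := ⟨T - c • 1, fun g => by
      ext v
      have := LinearMap.congr_fun (hT g) v
      simp only [LinearMap.comp_apply] at this
      simp [this]⟩
    rcases Representation.IsIrreducible.bijective_or_eq_zero f with h | h
    · exact h
    · refine (hne c (sub_eq_zero.1 ?_)).elim
      exact congrArg Representation.IntertwiningMap.toLinearMap h
  have hpoly : ∀ q : Polynomial ℂ, q ≠ 0 → Function.Injective (Polynomial.aeval T q) := by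
    intro q hq
    induction hd : q.natDegree generalizing q with
    | zero =>
      rw [Polynomial.eq_C_of_natDegree_eq_zero hd] at hq ⊢
      have h0 : q.coeff 0 ≠ 0 := by simpa using hq
      rw [Polynomial.aeval_C]
      intro x y hxy
      simpa [Algebra.algebraMap_eq_smul_one, h0] using hxy
    | succ d ih =>
      obtain ⟨c, hc⟩ := IsAlgClosed.exists_root q (by
        intro h
        have := Polynomial.natDegree_eq_of_degree_eq_some h
        rw [hd] at this
        exact Nat.succ_ne_zero d this)
      obtain ⟨p, rfl⟩ := Polynomial.dvd_iff_isRoot.2 hc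
      have hp : p ≠ 0 := right_ne_zero_of_mul hq
      have hdp : p.natDegree = d := by
        rw [Polynomial.natDegree_mul (left_ne_zero_of_mul hq) hp,
          Polynomial.natDegree_X_sub_C] at hd
        omega
      have h1 : Polynomial.aeval T (Polynomial.X - Polynomial.C c) = T - c • 1 := by
        simp [Algebra.algebraMap_eq_smul_one]
      rw [map_mul, h1]
      exact (hbij c).1.comp (ih p hp hdp)
  have hnt : Nontrivial V := by
    by_contra h
    rw [not_nontrivial_iff_subsingleton] at h
    exact hne 0 (Subsingleton.elim _ _)
  obtain ⟨v, hv⟩ := exists_ne (0 : V)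
  choose w hw using fun c => (hbij c).2 v
  have hli : LinearIndependent ℂ w := by
    rw [linearIndependent_iff']
    intro S a ha c hc
    by_contra hac
    let q : Polynomial ℂ :=
      ∑ c ∈ S, Polynomial.C (a c) * ∏ d ∈ S.erase c, (Polynomial.X - Polynomial.C d)
    have hq : q.eval c ≠ 0 := by
      simp only [q, Polynomial.eval_finsetSum, Polynomial.eval_mul, Polynomial.eval_C,
        Polynomial.eval_prod, Polynomial.eval_sub, Polynomial.eval_X]
      rw [Finset.sum_eq_single_of_mem c hc]
      · refine mul_ne_zero hac (Finset.prod_ne_zero_iff.2 fun d hd => ?_)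
        exact sub_ne_zero.2 (Finset.ne_of_mem_erase hd).symm
      · intro b _ hbc
        rw [Finset.prod_eq_zero (Finset.mem_erase.2 ⟨hbc.symm, hc⟩) (sub_self c), mul_zero]
    have hq' : Polynomial.aeval T q v = 0 := by
      have h1 : ∀ b ∈ S, Polynomial.aeval T
          (Polynomial.C (a b) * ∏ d ∈ S.erase b, (Polynomial.X - Polynomial.C d)) v =
          Polynomial.aeval T (∏ d ∈ S, (Polynomial.X - Polynomial.C d)) (a b • w b) := by
        intro b hb
        have h2 : (T - b • 1 : Module.End ℂ V) =
            Polynomial.aeval T (Polynomial.X - Polynomial.C b) := by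
          simp [Algebra.algebraMap_eq_smul_one]
        rw [← hw b, h2, ← Module.End.mul_apply, ← map_mul, mul_assoc,
          Finset.prod_erase_mul _ _ hb, map_mul, Polynomial.aeval_C, map_smul]
        simp [Algebra.algebraMap_eq_smul_one]
      simp only [q, map_sum, LinearMap.sum_apply]
      rw [Finset.sum_congr rfl h1, ← map_sum, ha, map_zero]
    have hq0 : q ≠ 0 := by
      rintro h
      simp [h] at hq
    exact hv (hpoly q hq0 (by rw [hq', map_zero]))
  have h1 := hli.cardinal_lift_le_rank
  have h2 := h1.trans (Cardinal.lift_le.2 hV)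
  rw [Cardinal.lift_aleph0, Cardinal.mk_complex, Cardinal.lift_continuum] at h2
  exact absurd h2 (not_le.2 Cardinal.aleph0_lt_continuum)

theorem rank_le_aleph0_of_isSmoothRep {F : Type*} [Field F] [ValuativeRel F] [TopologicalSpace F]
    [IsNonarchimedeanLocalField F] {n : ℕ} {V : Type*} [AddCommGroup V] [Module ℂ V]
    {π : Representation ℂ (GL (Fin n) F) V} (hπ : π.IsIrreducible) (h : IsSmoothRep π) :
    Module.rank ℂ V ≤ Cardinal.aleph0 := by
  rcases subsingleton_or_nontrivial V with hs | hs
  · rw [rank_subsingleton']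
    exact zero_le
  obtain ⟨v, hv⟩ := exists_ne (0 : V)
  obtain ⟨K, hK, hKv⟩ := h v
  have := countable_quotient_of_isOpen F hK
  let f : GL (Fin n) F ⧸ K → V := Quotient.lift (fun g => π g v) (by
    intro g g' hgg
    have := hKv _ (QuotientGroup.leftRel_apply.1 hgg)
    change π g v = π g' v
    rw [map_mul, Module.End.mul_apply] at this
    conv_lhs => rw [← this]
    rw [← Module.End.mul_apply, ← map_mul, mul_inv_cancel, map_one, Module.End.one_apply])
  let W : Subrepresentation π := ⟨Submodule.span ℂ (Set.range f), fun g w hw => by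
    have h1 : Submodule.span ℂ (Set.range f) ≤ (Submodule.span ℂ (Set.range f)).comap (π g) := by
      refine Submodule.span_le.2 ?_
      rintro _ ⟨x, rfl⟩
      induction x using QuotientGroup.induction_on with
      | H y =>
        refine Submodule.subset_span ⟨(QuotientGroup.mk (g * y) : GL (Fin n) F ⧸ K), ?_⟩
        change π (g * y) v = π g (π y v)
        rw [map_mul, Module.End.mul_apply]
    exact h1 hw⟩
  have hvW : v ∈ W.toSubmodule :=
    Submodule.subset_span ⟨(QuotientGroup.mk 1 : GL (Fin n) F ⧸ K), by
      change π 1 v = v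
      simp⟩
  rcases hπ.eq_bot_or_eq_top W with hW | hW
  · rw [hW] at hvW
    exact absurd ((Submodule.mem_bot ℂ).1 hvW) hv
  · have h2 : Submodule.span ℂ (Set.range f) = ⊤ := congrArg Subrepresentation.toSubmodule hW
    have h3 := rank_span_le (R := ℂ) (Set.range f)
    rw [h2, rank_top] at h3
    exact h3.trans (Set.countable_range f).le_aleph0

theorem exists_normalizedAbs_lt_one (F : Type*) [Field F] [ValuativeRel F] [TopologicalSpace F]
    [IsNonarchimedeanLocalField F] : ∃ z : Fˣ, normalizedAbs F z < 1 := by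
  obtain ⟨x, hx0, hx⟩ := Valuation.IsNontrivial.exists_lt_one (v := ValuativeRel.valuation F)
  refine ⟨Units.mk0 x (by simpa using hx0), ?_⟩
  have h1 : (1 : ℝ≥0) < residueCard F := by exact_mod_cast one_lt_residueCard F
  refine (WithZeroMulInt.toNNReal_lt_one_iff h1).2 ?_
  have := (IsNonarchimedeanLocalField.valueGroupWithZeroIsoInt F).strictMono hx
  rwa [map_one] at this

theorem Irrc.exists_shift_pow (F : Type*) [Field F] [ValuativeRel F] [TopologicalSpace F]
    [IsNonarchimedeanLocalField F] (n : ℕ+) (σ : SupercuspidalRep F n) (k : ℕ) :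
    ∃ τ : SupercuspidalRep F n, (Irrc.shift F ^ k) ⟨n, Quotient.mk _ σ⟩ = ⟨n, Quotient.mk _ τ⟩ ∧
      ∃ e : τ.V ≃ₗ[ℂ] σ.V, ∀ g v, e (τ.π g v) =
        ((absChar F (Matrix.GeneralLinearGroup.det g) : ℂ) ^ k) • σ.π g (e v) := by
  induction k with
  | zero => exact ⟨σ, rfl, LinearEquiv.refl ℂ _, fun g v => by simp⟩
  | succ k ih =>
    obtain ⟨τ, h, e, he⟩ := ih
    refine ⟨τ.twist (absChar F) (isOpen_ker_absChar F), ?_, e, fun g v => ?_⟩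
    · rw [pow_succ']
      exact congrArg (Irrc.shift F) h
    · have h1 : ∀ v : τ.V, e ((absChar F (Matrix.GeneralLinearGroup.det g) : ℂ) • τ.π g v) =
          ((absChar F (Matrix.GeneralLinearGroup.det g) : ℂ) ^ (k + 1)) • σ.π g (e v) := by
        intro v
        rw [map_smul, he, smul_smul, pow_succ']
      exact h1 v

/-- The twists of a supercuspidal representation by the powers of `|det|` are inequivalent. -/
theorem Irrc.shift_pow_ne (F : Type*) [Field F] [ValuativeRel F] [TopologicalSpace F]
    [IsNonarchimedeanLocalField F] (ρ : Irrc F) {k : ℕ} (hk : 0 < k) :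
    (Irrc.shift F ^ k) ρ ≠ ρ := by
  obtain ⟨n, q⟩ := ρ
  induction q using Quotient.inductionOn with
  | h σ =>
  intro h
  obtain ⟨τ, hτ, e, he⟩ := Irrc.exists_shift_pow F n σ k
  rw [h] at hτ
  obtain ⟨φ⟩ : Nonempty (σ.π.Equiv τ.π) := Quotient.exact (eq_of_heq (Sigma.mk.inj hτ).2)
  obtain ⟨z, hz⟩ := exists_normalizedAbs_lt_one F
  obtain ⟨c, hc⟩ := exists_scalar_of_commute σ.irreducible
    (rank_le_aleph0_of_isSmoothRep σ.irreducible σ.smooth)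
    (σ.π (Matrix.GeneralLinearGroup.scalar (Fin n) z)) (fun g => by
      rw [← Module.End.mul_eq_comp, ← Module.End.mul_eq_comp, ← map_mul, ← map_mul, Matrix.GeneralLinearGroup.scalar_commute])
  have hnt : Nontrivial σ.V := by
    by_contra hs
    rw [not_nontrivial_iff_subsingleton] at hs
    have := σ.irreducible.toNontrivial
    obtain ⟨W, W', hW⟩ := exists_pair_ne (Subrepresentation σ.π)
    exact hW (Subrepresentation.toSubmodule_injective (Subsingleton.elim _ _))
  obtain ⟨v, hv⟩ := exists_ne (0 : σ.V)
  have h1 := φ.toIntertwiningMap.isIntertwining σ.π τ.π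
    (Matrix.GeneralLinearGroup.scalar (Fin n) z) v
  have hv' : φ.toIntertwiningMap v ≠ 0 := by
    change φ.toLinearEquiv v ≠ 0
    simpa using hv
  have h2 := congrArg e h1
  rw [he, hc] at h2
  simp only [LinearMap.smul_apply, Module.End.one_apply, map_smul] at h2
  have hev : e (φ.toIntertwiningMap v) ≠ 0 := by simpa using hv'
  have hc0 : c ≠ 0 := by
    rintro rfl
    have h3 : σ.π (Matrix.GeneralLinearGroup.scalar (Fin n) z)⁻¹
        (σ.π (Matrix.GeneralLinearGroup.scalar (Fin n) z) v) = v := by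
      rw [← Module.End.mul_apply, ← map_mul, inv_mul_cancel, map_one, Module.End.one_apply]
    rw [hc] at h3
    simp at h3
    exact hv h3.symm
  rw [smul_smul] at h2
  have h4 := smul_left_injective ℂ hev h2
  have h5 : (absChar F (Matrix.GeneralLinearGroup.det
      (Matrix.GeneralLinearGroup.scalar (Fin n) z)) : ℂ) ^ k = 1 :=
    mul_right_cancel₀ hc0 (h4.symm.trans (one_mul c).symm)
  have h6 : Matrix.GeneralLinearGroup.det (Matrix.GeneralLinearGroup.scalar (Fin n) z) =
      z ^ (n : ℕ) := by
    ext
    simp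
  rw [h6, map_pow, Units.val_pow_eq_pow_val, ← pow_mul] at h5
  have h7 : ((absChar F z : ℂˣ) : ℂ) = ((normalizedAbs F z : ℝ) : ℂ) := rfl
  rw [h7] at h5
  have h8 : (normalizedAbs F z) ^ ((n : ℕ) * k) = 1 := by exact_mod_cast h5
  exact (pow_lt_one₀ zero_le hz (Nat.mul_pos n.pos hk).ne').ne h8

/-! ### The Zariski topology on a complex vector space -/

section Zariski

variable {W : Type*} [AddCommGroup W] [Module ℂ W]

/-- The algebra of polynomial functions on a (finite-dimensional) complex vector space: the
algebra of functions generated by the linear forms. -/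
def polyFun (W : Type*) [AddCommGroup W] [Module ℂ W] : Subalgebra ℂ (W → ℂ) :=
  Algebra.adjoin ℂ (Set.range fun φ : Module.Dual ℂ W => (φ : W → ℂ))

/-- The Zariski closure of a subset of a (finite-dimensional) complex vector space. -/
def zariskiClosure (S : Set W) : Set W :=
  {w | ∀ f ∈ polyFun W, (∀ x ∈ S, f x = 0) → f w = 0}

/-- `S` is a Zariski dense subset of `T`. -/
def IsZariskiDenseIn (S T : Set W) : Prop :=
  S ⊆ T ∧ T ⊆ zariskiClosure S

end Zariski

/-! ### Segments and multisegments

Here `R` is a set with a bijection `s`, written `ρ ↦ ρ→`. -/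

section Multisegment

variable {R : Type*} (s : Equiv.Perm R)

/-- A segment: a nonempty finite set of the form `{b, s b, …, s ^ (k - 1) b}`. -/
def Segment : Type _ :=
  {Δ : Finset R // ∃ (b : R) (k : ℕ), 0 < k ∧ ∀ ρ, ρ ∈ Δ ↔ ∃ i < k, (s ^ i) b = ρ}

/-- The set of multisegments, i.e. of finite formal sums of segments. -/
abbrev Multisegment : Type _ := Multiset (Segment s)

/-- The support of a multisegment, a finite formal sum of elements of `R`. -/
def Multisegment.supp {s : Equiv.Perm R} (m : Multisegment s) : Multiset R :=
  m.bind fun Δ => Δ.val.val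

end Multisegment

/-! ### Graded vector spaces, commuting varieties and their irreducible components -/

section Graded

variable {R : Type*} (s : Equiv.Perm R) {V : Type*} [AddCommGroup V] [Module ℂ V]
  (𝒱 : R → Submodule ℂ V)

open Classical in
/-- `𝒱` is a grading of `V` by `R`, with graded dimension `d`. -/
def IsGradingOfDim (d : Multiset R) : Prop :=
  DirectSum.IsInternal 𝒱 ∧ ∀ ρ, Module.finrank ℂ (𝒱 ρ) = d.count ρ

/-- The linear transformations of degree `1`. -/
def endRight : Set (Module.End ℂ V) :=
  {A | ∀ ρ, ∀ v ∈ 𝒱 ρ, A v ∈ 𝒱 (s ρ)}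

/-- The linear transformations of degree `-1`. -/
def endLeft : Set (Module.End ℂ V) :=
  {B | ∀ ρ, ∀ v ∈ 𝒱 ρ, B v ∈ 𝒱 (s.symm ρ)}

/-- The group `𝔾(V)` of grading preserving linear automorphisms. -/
def gradedAut : Subgroup (V ≃ₗ[ℂ] V) where
  carrier := {g | ∀ ρ, ∀ v, g v ∈ 𝒱 ρ ↔ v ∈ 𝒱 ρ}
  one_mem' := fun _ _ => Iff.rfl
  mul_mem' := fun {g h} hg hh ρ v => (hg ρ (h v)).trans (hh ρ v)
  inv_mem' := fun {g} hg ρ v => by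
    have := hg ρ (g⁻¹ v)
    rwa [← LinearEquiv.mul_apply, mul_inv_cancel, LinearEquiv.coe_one, id, iff_comm] at this

/-- The graded commuting variety `𝔛(V)`. -/
def commutingVariety : Set (Module.End ℂ V × Module.End ℂ V) :=
  {x | x.1 ∈ endRight s 𝒱 ∧ x.2 ∈ endLeft s 𝒱 ∧ x.1 * x.2 = x.2 * x.1}

variable {s} in
open Classical in
/-- The orbit `𝒪_m` of the multisegment `m = ∑ i, Δ i` in the space of transformations of degree
`1`: it consists of those `A` for which there is a graded basis `x ⟨i, ρ⟩`, `ρ ∈ Δ i`, such that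
`A x ⟨i, ρ⟩ = x ⟨i, s ρ⟩`, where the right-hand side is read as `0` if `s ρ ∉ Δ i`. -/
def gradedOrbit (m : Multisegment s) : Set (Module.End ℂ V) :=
  {A | A ∈ endRight s 𝒱 ∧ ∃ (I : Type) (_ : Fintype I) (Δ : I → Segment s)
      (x : Module.Basis (Σ i, {ρ // ρ ∈ (Δ i).val}) ℂ V),
    Finset.univ.val.map Δ = m ∧ (∀ i (ρ : {ρ // ρ ∈ (Δ i).val}), x ⟨i, ρ⟩ ∈ 𝒱 ρ.val) ∧
    ∀ i (ρ : {ρ // ρ ∈ (Δ i).val}), A (x ⟨i, ρ⟩) =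
      if h : s ρ.val ∈ (Δ i).val then x ⟨i, s ρ.val, h⟩ else 0}

variable {s}

/-- The set `ℭ°_m` of pairs in the commuting variety whose first component is in `𝒪_m`. -/
def openComponent (m : Multisegment s) : Set (Module.End ℂ V × Module.End ℂ V) :=
  {x ∈ commutingVariety s 𝒱 | x.1 ∈ gradedOrbit 𝒱 m}

/-- The irreducible component `ℭ_m` of the commuting variety: the closure of `ℭ°_m`. -/
def irredComponent (m : Multisegment s) : Set (Module.End ℂ V × Module.End ℂ V) :=
  zariskiClosure (openComponent 𝒱 m)

/-- `H · S` for a set `H` of automorphisms acting by simultaneous conjugation. -/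
def conjTranslates (H : Set (V ≃ₗ[ℂ] V)) (S : Set (Module.End ℂ V × Module.End ℂ V)) :
    Set (Module.End ℂ V × Module.End ℂ V) :=
  {y | ∃ g ∈ H, ∃ x ∈ S, y = (g.conj x.1, g.conj x.2)}

end Graded

/-! ### Short exact sequences `0 → V → U → V' → 0` of graded vector spaces -/

section Exact

variable {R : Type*} {s : Equiv.Perm R}
  {V V' U : Type*} [AddCommGroup V] [Module ℂ V] [AddCommGroup V'] [Module ℂ V']
  [AddCommGroup U] [Module ℂ U]
  (𝒱 : R → Submodule ℂ V) (𝒱' : R → Submodule ℂ V') (𝒰 : R → Submodule ℂ U)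
  (i : V →ₗ[ℂ] U) (j : U →ₗ[ℂ] V')

/-- The parabolic subgroup `ℙ^i`, the stabilizer of `i(V)` in `𝔾(U)`. -/
def parabolic : Set (U ≃ₗ[ℂ] U) :=
  {g | g ∈ gradedAut 𝒰 ∧ (LinearMap.range i).map (g : U →ₗ[ℂ] U) = LinearMap.range i}

/-- The unipotent radical `𝕌^i` of `ℙ^i`. -/
def unipotent : Set (U ≃ₗ[ℂ] U) :=
  {g | g ∈ gradedAut 𝒰 ∧ (g : U →ₗ[ℂ] U) ∘ₗ i = i ∧ j ∘ₗ (g : U →ₗ[ℂ] U) = j}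

variable (s) in
/-- The subvariety `𝔛^i(U)` of pairs in `𝔛(U)` which preserve `i(V)`. -/
def stableVariety : Set (Module.End ℂ U × Module.End ℂ U) :=
  {x ∈ commutingVariety s 𝒰 | j ∘ₗ x.1 ∘ₗ i = 0 ∧ j ∘ₗ x.2 ∘ₗ i = 0}

/-- `A` restricts to `A₁` on `V` and induces `A₂` on `V'`. -/
def RestrictsTo (i : V →ₗ[ℂ] U) (j : U →ₗ[ℂ] V') (A : Module.End ℂ U) (A₁ : Module.End ℂ V)
    (A₂ : Module.End ℂ V') : Prop :=
  A ∘ₗ i = i ∘ₗ A₁ ∧ j ∘ₗ A = A₂ ∘ₗ j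

variable (s) in
/-- The preimage of `S × S'` under the map `p_i : 𝔛^i(U) → 𝔛(V) × 𝔛(V')` which takes a pair to
the pairs that it induces on `V` and on `V'`. -/
def pPreimage (S : Set (Module.End ℂ V × Module.End ℂ V))
    (S' : Set (Module.End ℂ V' × Module.End ℂ V')) : Set (Module.End ℂ U × Module.End ℂ U) :=
  {x ∈ stableVariety s 𝒰 i j | ∃ y ∈ S, ∃ y' ∈ S',
    RestrictsTo i j x.1 y.1 y'.1 ∧ RestrictsTo i j x.2 y.2 y'.2}

/-- The variety `𝔜^i_{m, m'}`, the closure of `ℭ_{m + m'} ∩ p_i⁻¹(ℭ°_m × ℭ°_{m'})`. -/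
def varY (m m' : Multisegment s) : Set (Module.End ℂ U × Module.End ℂ U) :=
  zariskiClosure (irredComponent 𝒰 (m + m') ∩
    pPreimage s 𝒰 i j (openComponent 𝒱 m) (openComponent 𝒱' m'))

end Exact

/-! ### The direct sum `Ṽ = V ⊕ V'` -/

section DirectSum

variable {R : Type*} {s : Equiv.Perm R}
  {V V' : Type*} [AddCommGroup V] [Module ℂ V] [AddCommGroup V'] [Module ℂ V']
  (𝒱 : R → Submodule ℂ V) (𝒱' : R → Submodule ℂ V')

/-- The grading of `V ⊕ V'`. -/
def sumGrading : R → Submodule ℂ (V × V') := fun ρ => (𝒱 ρ).prod (𝒱' ρ)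

/-- `𝔜^ι_{m, m'}`, for the inclusion `ι : V → V ⊕ V'`. -/
def varYι (m m' : Multisegment s) : Set (Module.End ℂ (V × V') × Module.End ℂ (V × V')) :=
  varY 𝒱 𝒱' (sumGrading 𝒱 𝒱') (LinearMap.inl ℂ V V') (LinearMap.snd ℂ V V') m m'

/-- `𝔜^ι'_{m', m}`, for the inclusion `ι' : V' → V ⊕ V'`. -/
def varYι' (m' m : Multisegment s) : Set (Module.End ℂ (V × V') × Module.End ℂ (V × V')) :=
  varY 𝒱' 𝒱 (sumGrading 𝒱 𝒱') (LinearMap.inr ℂ V V') (LinearMap.fst ℂ V V') m' m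

/-- `ℨ_{m, m'} = 𝔜^ι_{m, m'} ∩ 𝔜^ι'_{m', m}`. -/
def varZ (m m' : Multisegment s) : Set (Module.End ℂ (V × V') × Module.End ℂ (V × V')) :=
  varYι 𝒱 𝒱' m m' ∩ varYι' 𝒱 𝒱' m' m

/-- The stabilizer `ℙ^ι` of `V` in `𝔾(V ⊕ V')`. -/
def parabolicι : Set ((V × V') ≃ₗ[ℂ] (V × V')) :=
  parabolic (sumGrading 𝒱 𝒱') (LinearMap.inl ℂ V V')

/-- The unipotent radical `𝕌^ι` of `ℙ^ι`. -/
def unipotentι : Set ((V × V') ≃ₗ[ℂ] (V × V')) :=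
  unipotent (sumGrading 𝒱 𝒱') (LinearMap.inl ℂ V V') (LinearMap.snd ℂ V V')

end DirectSum

/-!
All four conditions turn out to be equivalent to a statement of linear algebra. Fix `A₁ ∈ 𝒪_m`,
`A₂ ∈ 𝒪_{m'}` and put `A = A₁ ⊕ A₂ ∈ 𝒪_{m + m'}`. The statement, `CommutatorSurjective`, says that
for some `b₁`, `b₂` of degree `-1` commuting with `A₁`, `A₂`, the map `X ↦ X b₂ - b₁ X` takes the
intertwining maps `X : V' → V` of degree `0` onto those of degree `-1`.

*Slices.* Let `E` be the space of all `B` of degree `-1` that commute with `A`. As `𝒪_{m + m'}` is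
a single orbit, `ℭ_{m + m'}` is the closure of `𝔾 · (A, E)`. Similarly `𝔜^ι` is the closure of
`ℙ^ι · (A, E_up)`, where `E_up` consists of those `B ∈ E` that preserve `V`
(`IsGradedSplitting.irredComponent_inter_pPreimage`). This needs that an extension of `A₂` by `A₁`
which is a degeneration of `A` splits; it is proved by comparing the dimensions of the spaces of
maps from `A₂`, which can only grow in the limit (`IsGradedSplitting.exists_splitting`).
Exchanging the roles of `V` and `V'` gives `E_low` and `𝔜^ι'`. Finally the elements of `ℨ` are
block diagonal, and `ℨ` lies between the orbit of `(A, E_up ∩ E_low)` under the Levi subgroup and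
the closure of this orbit.

*Density of slices.* The first condition says that the `𝔾`-translates of `(A, E_low)` are dense in
those of `(A, E)`, and the third that the `ℙ^ι`-translates of `(A, E_up ∩ E_low)` are dense in
those of `(A, E_up)`. For a group `K` of units of an algebra `𝔨`, and spaces `F ≤ E` such that `E`
is preserved by the centralizer of `A` in `K`, the density of `K · (A, F)` in `K · (A, E)` amounts
to the existence of `b ∈ F` with `[𝔨^A, b] + F = E` (`slice_dense_iff`). In one direction, the
inverse function theorem shows that the image of a submersion is Zariski dense. In the other, a
dominant rational map in characteristic zero is a submersion at some point
(`exists_surjective_jacobian`); this rests on the smoothness of field extensions in characteristic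
zero. In both cases at hand, `[X, b]` modulo `F` is the block from `V'` to `V`, so that the
condition is `CommutatorSurjective` (`IsGradedSplitting.slice_iff_commutatorSurjective`).

*Unipotent translates.* The last two conditions are equivalent because `ℙ^ι` is the product of
`𝕌^ι` and the Levi subgroup, which preserves `ℨ`. The first two are equivalent because `𝔜^ι'` is
stable under the opposite parabolic subgroup `ℙ^ι'` and `𝕌^ι ℙ^ι'` is dense in `𝔾`: for `g ∈ 𝔾`,
it contains `g + t` for all but finitely many scalars `t`.
-/

/-! ### Algebraically independent functions have independent differentials -/

/-- Infinitesimal lifting along a square-zero extension `T → K`, in terms of ring homomorphisms. -/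
theorem exists_ringHom_section {B K T : Type*} [CommRing B] [CommRing K] [CommRing T]
    (g : B →+* K) (hg : @Algebra.FormallySmooth B K _ _ g.toAlgebra) (p : T →+* K)
    (hp : Function.Surjective p) (hker : RingHom.ker p ^ 2 = ⊥) (h : B →+* T)
    (hh : p.comp h = g) :
    ∃ σ : K →+* T, p.comp σ = RingHom.id K ∧ σ.comp g = h := by
  let := g.toAlgebra
  let := h.toAlgebra
  let p' : T →ₐ[B] K := { p with commutes' := fun b => congrArg (fun f : B →+* K => f b) hh }
  have hk : IsNilpotent (RingHom.ker (p' : T →+* K)) := ⟨2, hker⟩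
  let σ := Algebra.FormallySmooth.liftOfSurjective (AlgHom.id B K) p' hp hk
  have h1 := Algebra.FormallySmooth.comp_liftOfSurjective (AlgHom.id B K) p' hp hk
  refine ⟨σ, ?_, ?_⟩
  · ext x
    exact congrArg (fun f : K →ₐ[B] K => f x) h1
  · ext x
    exact σ.commutes x

/-- In characteristic zero, a finitely generated field extension is smooth over any polynomial ring
that it contains. -/
theorem formallySmooth_mvPolynomial_of_injective {k K ι : Type*} [Field k] [CharZero k] [Field K]
    [Algebra k K] [Algebra.EssFiniteType k K] {φ : ι → K} (hφ : AlgebraicIndependent k φ) :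
    @Algebra.FormallySmooth (MvPolynomial ι k) K _ _
      (MvPolynomial.aeval φ).toRingHom.toAlgebra := by
  let : Algebra (MvPolynomial ι k) K := (MvPolynomial.aeval φ).toRingHom.toAlgebra
  have hinj : Function.Injective (algebraMap (MvPolynomial ι k) K) := hφ
  let Q := FractionRing (MvPolynomial ι k)
  let : Algebra Q K := (IsFractionRing.lift (K := Q) hinj).toAlgebra
  have : IsScalarTower (MvPolynomial ι k) Q K := IsScalarTower.of_algebraMap_eq fun x => by
    change _ = IsFractionRing.lift (K := Q) hinj _
    rw [IsFractionRing.lift_algebraMap]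
  have : IsScalarTower k Q K := IsScalarTower.of_algebraMap_eq fun x => by
    rw [IsScalarTower.algebraMap_apply k (MvPolynomial ι k) Q, ← IsScalarTower.algebraMap_apply]
    change _ = MvPolynomial.aeval φ (MvPolynomial.C x)
    simp
  have : Algebra.EssFiniteType Q K := .of_comp k Q K
  have : CharZero Q := charZero_of_injective_algebraMap (algebraMap k Q).injective
  have : Algebra.FormallySmooth Q K := inferInstance
  have : Algebra.FormallySmooth (MvPolynomial ι k) Q :=
    .of_isLocalization (nonZeroDivisors (MvPolynomial ι k))
  exact .comp _ Q _

/-- In characteristic zero, algebraically independent elements of a finitely generated extension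
have dual derivations. -/
theorem exists_derivation_eq_single {k K ι : Type*} [Field k] [CharZero k] [Field K] [DecidableEq ι]
    [Algebra k K] [Algebra.EssFiniteType k K] {φ : ι → K} (hφ : AlgebraicIndependent k φ)
    (i : ι) : ∃ D : Derivation k K K, ∀ l, D (φ l) = Pi.single (M := fun _ => K) i 1 l := by
  let p : (TrivSqZeroExt K K) →ₐ[k] K := TrivSqZeroExt.fstHom k K K
  let h : MvPolynomial ι k →ₐ[k] (TrivSqZeroExt K K) := MvPolynomial.aeval fun l =>
    TrivSqZeroExt.inl (φ l) + TrivSqZeroExt.inr (Pi.single (M := fun _ => K) i 1 l)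
  have hker : RingHom.ker (p : (TrivSqZeroExt K K) →+* K) ^ 2 = ⊥ := by
    rw [pow_two, eq_bot_iff, Ideal.mul_le]
    intro x hx y hy
    have hx' : TrivSqZeroExt.fst x = 0 := hx
    have hy' : TrivSqZeroExt.fst y = 0 := hy
    rw [Ideal.mem_bot]
    ext <;> simp [hx', hy']
  obtain ⟨σ, h1, h2⟩ := exists_ringHom_section (MvPolynomial.aeval φ).toRingHom
    (formallySmooth_mvPolynomial_of_injective hφ) (p : (TrivSqZeroExt K K) →+* K)
    (fun x => ⟨TrivSqZeroExt.inl x, rfl⟩) hker h.toRingHom (by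
      have : p.comp h = MvPolynomial.aeval φ := by
        ext l
        simp [p, h, TrivSqZeroExt.fstHom_apply, -DualNumber.inr_eq_smul_eps]
      exact congrArg AlgHom.toRingHom this)
  have h1' : ∀ x, TrivSqZeroExt.fst (σ x) = x := fun x => congrArg (fun f : K →+* K => f x) h1
  have h2' : ∀ x, σ (MvPolynomial.aeval φ x) = h x := fun x =>
    congrArg (fun f : MvPolynomial ι k →+* (TrivSqZeroExt K K) => f x) h2
  have h3 : ∀ c : k, σ (algebraMap k K c) = algebraMap k (TrivSqZeroExt K K) c := fun c => by
    have := h2' (MvPolynomial.C c)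
    rwa [← MvPolynomial.algebraMap_eq, AlgHom.commutes, AlgHom.commutes] at this
  refine ⟨Derivation.mk' { toFun := fun x => (σ x).snd, map_add' := ?_, map_smul' := ?_ } ?_, ?_⟩
  · intro x y
    simp
  · intro c x
    rw [Algebra.smul_def, map_mul, h3, ← Algebra.smul_def]
    simp
  · intro x y
    simp [h1', mul_comm]
  · intro l
    have := h2' (MvPolynomial.X l)
    simp only [h, MvPolynomial.aeval_X] at this
    change (σ (φ l)).snd = _
    rw [this, TrivSqZeroExt.snd_add, TrivSqZeroExt.snd_inl, TrivSqZeroExt.snd_inr, zero_add]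

/-- The chain rule for a derivation of an extension of the polynomial ring. -/
theorem derivation_algebraMap_mvPolynomial {k K σ : Type*} [Field k] [Field K] [Algebra k K]
    [Fintype σ] [Algebra (MvPolynomial σ k) K] [IsScalarTower k (MvPolynomial σ k) K]
    (D : Derivation k K K) (p : MvPolynomial σ k) :
    D (algebraMap _ K p) = ∑ j, algebraMap (MvPolynomial σ k) K (MvPolynomial.pderiv j p) *
      D (algebraMap (MvPolynomial σ k) K (MvPolynomial.X j)) := by
  classical
  induction p using MvPolynomial.induction_on with
  | C a =>
    rw [← MvPolynomial.algebraMap_eq, ← IsScalarTower.algebraMap_apply, Derivation.map_algebraMap]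
    simp
  | add p q hp hq => simp [hp, hq, add_mul, Finset.sum_add_distrib]
  | mul_X p i hp =>
    rw [map_mul, Derivation.leibniz, hp]
    simp only [Derivation.leibniz, smul_eq_mul, map_add, map_mul, add_mul,
      Finset.sum_add_distrib, MvPolynomial.pderiv_X, Pi.single_apply]
    congr 1
    · simp [mul_ite]
    · rw [Finset.mul_sum]
      exact Finset.sum_congr rfl fun j _ => by ring

/-- Clearing the denominators of a polynomial expression in the fractions `P i / q`. -/
theorem exists_clear_denominators {σ ι : Type*} (P : ι → MvPolynomial σ ℂ) (q : MvPolynomial σ ℂ)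
    (hq : q ≠ 0) (F : MvPolynomial ι ℂ) : ∃ (n : ℕ) (G : MvPolynomial σ ℂ),
      algebraMap _ (FractionRing (MvPolynomial σ ℂ)) G =
        algebraMap _ (FractionRing (MvPolynomial σ ℂ)) q ^ n * MvPolynomial.aeval (fun i =>
          algebraMap _ (FractionRing (MvPolynomial σ ℂ)) (P i) /
            algebraMap _ (FractionRing (MvPolynomial σ ℂ)) q) F ∧
      ∀ x, MvPolynomial.eval x q ≠ 0 → MvPolynomial.eval x G = MvPolynomial.eval x q ^ n *
        MvPolynomial.eval (fun i => MvPolynomial.eval x (P i) / MvPolynomial.eval x q) F := by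
  have hq' : algebraMap _ (FractionRing (MvPolynomial σ ℂ)) q ≠ 0 := by
    rwa [ne_eq, map_eq_zero_iff _ (IsFractionRing.injective _ _)]
  induction F using MvPolynomial.induction_on with
  | C a =>
    refine ⟨0, MvPolynomial.C a, ?_, fun x _ => by simp⟩
    rw [← MvPolynomial.algebraMap_eq, ← MvPolynomial.algebraMap_eq, AlgHom.commutes,
      ← IsScalarTower.algebraMap_apply, pow_zero, one_mul]
  | add F₁ F₂ h₁ h₂ =>
    obtain ⟨n, G, h, h'⟩ := h₁
    obtain ⟨m, H, k, k'⟩ := h₂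
    refine ⟨n + m, G * q ^ m + H * q ^ n, ?_, fun x hx => ?_⟩
    · simp only [map_add, map_mul, map_pow, h, k]
      ring
    · simp only [map_add, map_mul, map_pow, h' x hx, k' x hx]
      ring
  | mul_X F i h₁ =>
    obtain ⟨n, G, h, h'⟩ := h₁
    refine ⟨n + 1, G * P i, ?_, fun x hx => ?_⟩
    · simp only [map_mul, h, MvPolynomial.aeval_X]
      field_simp
      ring
    · simp only [map_mul, h' x hx, MvPolynomial.eval_X]
      field_simp
      ring

/-- If the image of the rational map `x ↦ (P i x / q x)` is Zariski dense, then its differential is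
surjective at some point. This uses characteristic zero. -/
theorem exists_surjective_jacobian {σ ι : Type*} [Fintype σ] [Fintype ι]
    (P : ι → MvPolynomial σ ℂ) (q : MvPolynomial σ ℂ)
    (hd : ∀ F : MvPolynomial ι ℂ, (∀ x, MvPolynomial.eval x q ≠ 0 →
      MvPolynomial.eval (fun i => MvPolynomial.eval x (P i) / MvPolynomial.eval x q) F = 0) →
      F = 0) :
    ∃ x, MvPolynomial.eval x q ≠ 0 ∧ ∀ w : ι → ℂ, ∃ v : σ → ℂ, ∀ i,
      ∑ j, v j * MvPolynomial.eval x
        (q * MvPolynomial.pderiv j (P i) - P i * MvPolynomial.pderiv j q) =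
        w i * MvPolynomial.eval x q ^ 2 := by
  classical
  have hq : q ≠ 0 := by
    rintro rfl
    exact one_ne_zero (hd 1 fun x hx => absurd (map_zero _) hx)
  let a := algebraMap (MvPolynomial σ ℂ) (FractionRing (MvPolynomial σ ℂ))
  have ha : Function.Injective a := IsFractionRing.injective _ _
  have hq' : a q ≠ 0 := by rwa [ne_eq, map_eq_zero_iff _ ha]
  have hindep : AlgebraicIndependent ℂ fun i => a (P i) / a q := by
    rw [AlgebraicIndependent, injective_iff_map_eq_zero]
    intro F hF
    refine hd F fun x hx => ?_
    obtain ⟨n, G, h, h'⟩ := exists_clear_denominators P q hq F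
    rw [hF, mul_zero, map_eq_zero_iff _ ha] at h
    have := h' x hx
    rw [h, map_zero, eq_comm] at this
    exact (mul_eq_zero.1 this).resolve_left (pow_ne_zero _ hx)
  choose D hD using fun i => exists_derivation_eq_single hindep i
  obtain ⟨⟨d, hd0⟩, hdc⟩ := IsLocalization.exist_integer_multiples_of_finite
    (nonZeroDivisors (MvPolynomial σ ℂ)) (fun z : ι × σ => D z.1 (a (MvPolynomial.X z.2)))
  choose c hc using hdc
  have hd' : d ≠ 0 := nonZeroDivisors.ne_zero hd0
  -- The derivations dual to the functions `P i / q`, multiplied by the common denominator `d`, give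
  -- a right inverse of the Jacobian matrix over the polynomial ring, up to the factor `d`.
  have key : ∀ i l, ∑ j, c (l, j) *
      (q * MvPolynomial.pderiv j (P i) - P i * MvPolynomial.pderiv j q) =
      d * q ^ 2 * Pi.single (M := fun _ => MvPolynomial σ ℂ) l 1 i := by
    intro i l
    apply ha
    have h1 : a (P i) / a q * a q = a (P i) := div_mul_cancel₀ _ hq'
    have h2 := congrArg (D l) h1
    rw [Derivation.leibniz, hD, smul_eq_mul, smul_eq_mul, derivation_algebraMap_mvPolynomial,
      derivation_algebraMap_mvPolynomial] at h2
    have h3 : a (Pi.single (M := fun _ => MvPolynomial σ ℂ) l 1 i) =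
        Pi.single (M := fun _ => FractionRing (MvPolynomial σ ℂ)) l 1 i := by
      by_cases h : i = l
      · subst h; simp
      · simp [h]
    have h4 : ∀ j, a (c (l, j)) = a d * D l (a (MvPolynomial.X j)) := fun j => by
      rw [← Algebra.smul_def]
      exact hc (l, j)
    simp only [map_sum, map_mul, map_sub, map_pow, h3, h4]
    have h5 : ∑ j, a d * D l (a (MvPolynomial.X j)) *
        (a q * a (MvPolynomial.pderiv j (P i)) - a (P i) * a (MvPolynomial.pderiv j q)) =
        a d * (a q * (∑ j, a (MvPolynomial.pderiv j (P i)) * D l (a (MvPolynomial.X j))) -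
          a (P i) * ∑ j, a (MvPolynomial.pderiv j q) * D l (a (MvPolynomial.X j))) := by
      simp only [Finset.mul_sum, ← Finset.sum_sub_distrib]
      exact Finset.sum_congr rfl fun j _ => by ring
    rw [h5, ← h2, ← h1]
    field_simp
    ring
  obtain ⟨x, hx⟩ : ∃ x, MvPolynomial.eval x (d * q) ≠ 0 := by
    by_contra! h
    exact mul_ne_zero hd' hq (MvPolynomial.funext fun x => by rw [h x, map_zero])
  rw [map_mul] at hx
  refine ⟨x, right_ne_zero_of_mul hx, fun w => ?_⟩
  refine ⟨fun j => ∑ l, (w l / MvPolynomial.eval x d) * MvPolynomial.eval x (c (l, j)), fun i => ?_⟩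
  have hdx := left_ne_zero_of_mul hx
  simp only [Finset.sum_mul]
  rw [Finset.sum_comm]
  have h6 : ∀ l, ∑ j, w l / MvPolynomial.eval x d * MvPolynomial.eval x (c (l, j)) *
      MvPolynomial.eval x (q * MvPolynomial.pderiv j (P i) - P i * MvPolynomial.pderiv j q) =
      if i = l then w l * MvPolynomial.eval x q ^ 2 else 0 := by
    intro l
    have := congrArg (MvPolynomial.eval x) (key i l)
    simp only [map_sum, map_mul] at this
    simp only [mul_assoc]
    rw [← Finset.mul_sum, this]
    by_cases h : i = l
    · subst h
      simp
      field_simp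
    · simp [h]
  rw [Finset.sum_congr rfl fun l _ => h6 l]
  simp

/-! ### Polynomial maps and the Zariski topology -/

section PolyMap

variable {T W W₁ W₂ W₃ : Type*} [AddCommGroup T] [Module ℂ T] [AddCommGroup W] [Module ℂ W]
  [AddCommGroup W₁] [Module ℂ W₁] [AddCommGroup W₂] [Module ℂ W₂] [AddCommGroup W₃] [Module ℂ W₃]

/-- A map between vector spaces is polynomial if its composition with every linear form is a
polynomial function. -/
def IsPolyMap (Φ : T → W) : Prop := ∀ φ : Module.Dual ℂ W, (fun x => φ (Φ x)) ∈ polyFun T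

theorem dual_mem_polyFun (φ : Module.Dual ℂ W) : (φ : W → ℂ) ∈ polyFun W :=
  Algebra.subset_adjoin ⟨φ, rfl⟩

theorem const_mem_polyFun (c : ℂ) : (fun _ => c : W → ℂ) ∈ polyFun W :=
  (polyFun W).algebraMap_mem c

theorem IsPolyMap.comp_mem {Φ : T → W} (hΦ : IsPolyMap Φ) {f : W → ℂ} (hf : f ∈ polyFun W) :
    (fun x => f (Φ x)) ∈ polyFun T := by
  induction hf using Algebra.adjoin_induction with
  | mem f hf =>
    obtain ⟨φ, rfl⟩ := hf
    exact hΦ φ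
  | algebraMap c => exact const_mem_polyFun c
  | add f g _ _ hf hg => exact add_mem hf hg
  | mul f g _ _ hf hg => exact mul_mem hf hg

theorem IsPolyMap.comp {Φ : W₁ → W₂} {Ψ : T → W₁} (hΦ : IsPolyMap Φ) (hΨ : IsPolyMap Ψ) :
    IsPolyMap fun x => Φ (Ψ x) := fun φ => hΨ.comp_mem (hΦ φ)

theorem LinearMap.isPolyMap (L : T →ₗ[ℂ] W) : IsPolyMap L := fun φ => dual_mem_polyFun (φ ∘ₗ L)

theorem isPolyMap_const (w : W) : IsPolyMap fun _ : T => w := fun φ => const_mem_polyFun (φ w)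

theorem IsPolyMap.add {Φ Ψ : T → W} (hΦ : IsPolyMap Φ) (hΨ : IsPolyMap Ψ) :
    IsPolyMap fun x => Φ x + Ψ x := fun φ => by
  simp only [map_add]
  exact add_mem (hΦ φ) (hΨ φ)

theorem IsPolyMap.prodMk {Φ : T → W₁} {Ψ : T → W₂} (hΦ : IsPolyMap Φ) (hΨ : IsPolyMap Ψ) :
    IsPolyMap fun x => (Φ x, Ψ x) := fun φ => by
  have h : ∀ x, φ (Φ x, Ψ x) = (φ ∘ₗ LinearMap.inl ℂ W₁ W₂) (Φ x) +
      (φ ∘ₗ LinearMap.inr ℂ W₁ W₂) (Ψ x) := fun x => by simp [← map_add]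
  simp only [h]
  exact add_mem (hΦ _) (hΨ _)

theorem IsPolyMap.bilin [FiniteDimensional ℂ W₁] (b : W₁ →ₗ[ℂ] W₂ →ₗ[ℂ] W₃) {Φ : T → W₁}
    {Ψ : T → W₂} (hΦ : IsPolyMap Φ) (hΨ : IsPolyMap Ψ) : IsPolyMap fun x => b (Φ x) (Ψ x) :=
  fun φ => by
  let e := Module.finBasis ℂ W₁
  have h : (fun x => φ (b (Φ x) (Ψ x))) =
      ∑ i, (fun x => e.coord i (Φ x)) * fun x => (φ ∘ₗ b (e i)) (Ψ x) := by
    ext x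
    conv_lhs => rw [← e.sum_repr (Φ x)]
    simp only [map_sum, map_smul, LinearMap.sum_apply, LinearMap.smul_apply, smul_eq_mul,
      Finset.sum_apply, Pi.mul_apply, Module.Basis.coord_apply, LinearMap.comp_apply]
  rw [h]
  exact sum_mem fun i _ => mul_mem (hΦ _) (hΨ _)

theorem IsPolyMap.mul {R : Type*} [Ring R] [Algebra ℂ R] [FiniteDimensional ℂ R] {Φ Ψ : T → R}
    (hΦ : IsPolyMap Φ) (hΨ : IsPolyMap Ψ) : IsPolyMap fun x => Φ x * Ψ x :=
  IsPolyMap.bilin (LinearMap.mul ℂ R) hΦ hΨ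

/-! ### Zariski closures -/

theorem subset_zariskiClosure (S : Set W) : S ⊆ zariskiClosure S := fun _ hx _ _ h => h _ hx

theorem zariskiClosure_subset_iff {S S' : Set W} :
    zariskiClosure S ⊆ zariskiClosure S' ↔ S ⊆ zariskiClosure S' :=
  ⟨(subset_zariskiClosure S).trans, fun h _ hx f hf h' => hx f hf fun _ hy => h hy f hf h'⟩

theorem zariskiClosure_mono {S S' : Set W} (h : S ⊆ S') : zariskiClosure S ⊆ zariskiClosure S' :=
  zariskiClosure_subset_iff.2 (h.trans (subset_zariskiClosure S'))

theorem IsPolyMap.map_mem_zariskiClosure {Φ : T → W} (hΦ : IsPolyMap Φ) {S : Set T} {S' : Set W}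
    (h : ∀ x ∈ S, Φ x ∈ zariskiClosure S') {x : T} (hx : x ∈ zariskiClosure S) :
    Φ x ∈ zariskiClosure S' :=
  fun f hf h' => hx _ (hΦ.comp_mem hf) fun y hy => h y hy f hf h'

/-- Polynomial equations that hold on a set hold on its closure. -/
theorem IsPolyMap.eq_zero_of_mem_zariskiClosure {Φ : T → W} (hΦ : IsPolyMap Φ) {S : Set T}
    (h : ∀ x ∈ S, Φ x = 0) {x : T} (hx : x ∈ zariskiClosure S) : Φ x = 0 := by
  refine (Module.forall_dual_apply_eq_zero_iff ℂ _).1 fun φ => hx _ (hΦ φ) fun y hy => ?_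
  rw [h y hy, map_zero]

/-- Membership in a linear subspace is preserved by the closure. -/
theorem Submodule.mem_of_mem_zariskiClosure (N : Submodule ℂ W) {S : Set W} (h : S ⊆ N) {x : W}
    (hx : x ∈ zariskiClosure S) : x ∈ N := by
  rw [← Submodule.Quotient.mk_eq_zero]
  exact (N.mkQ).isPolyMap.eq_zero_of_mem_zariskiClosure
    (fun y hy => (Submodule.Quotient.mk_eq_zero N).2 (h hy)) hx

/-! ### Polynomial functions in coordinates and on lines -/

theorem exists_mvPolynomial_of_mem_polyFun {ι : Type*} [Fintype ι] (b : Module.Basis ι ℂ W)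
    {f : W → ℂ} (hf : f ∈ polyFun W) :
    ∃ p : MvPolynomial ι ℂ, ∀ x, f x = MvPolynomial.eval (b.repr x) p := by
  induction hf using Algebra.adjoin_induction with
  | mem f hf =>
    obtain ⟨φ, rfl⟩ := hf
    refine ⟨∑ i, MvPolynomial.X i * MvPolynomial.C (φ (b i)), fun x => ?_⟩
    conv_lhs => rw [← b.sum_repr x]
    simp only [map_sum, map_smul, smul_eq_mul, map_mul, MvPolynomial.eval_X, MvPolynomial.eval_C]
  | algebraMap c => exact ⟨MvPolynomial.C c, fun x => by simp⟩
  | add f g _ _ hf hg =>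
    obtain ⟨p, hp⟩ := hf
    obtain ⟨q, hq⟩ := hg
    exact ⟨p + q, fun x => by simp [hp, hq]⟩
  | mul f g _ _ hf hg =>
    obtain ⟨p, hp⟩ := hf
    obtain ⟨q, hq⟩ := hg
    exact ⟨p * q, fun x => by simp [hp, hq]⟩

theorem eval_mem_polyFun {ι : Type*} [Finite ι] (p : MvPolynomial ι ℂ) :
    (fun x : ι → ℂ => MvPolynomial.eval x p) ∈ polyFun (ι → ℂ) := by
  induction p using MvPolynomial.induction_on with
  | C a => simpa using const_mem_polyFun a
  | add p q hp hq =>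
    simp only [map_add]
    exact add_mem hp hq
  | mul_X p i hp =>
    simp only [map_mul, MvPolynomial.eval_X]
    exact mul_mem hp (dual_mem_polyFun (LinearMap.proj (φ := fun _ : ι => ℂ) i))

theorem exists_polynomial_on_line {f : W → ℂ} (hf : f ∈ polyFun W) (x v : W) :
    ∃ p : Polynomial ℂ, ∀ t : ℂ, f (x + t • v) = p.eval t := by
  induction hf using Algebra.adjoin_induction with
  | mem f hf =>
    obtain ⟨φ, rfl⟩ := hf
    exact ⟨Polynomial.C (φ x) + Polynomial.C (φ v) * Polynomial.X, fun t => by simp [mul_comm t]⟩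
  | algebraMap c => exact ⟨Polynomial.C c, fun x => by simp⟩
  | add f g _ _ hf hg =>
    obtain ⟨p, hp⟩ := hf
    obtain ⟨q, hq⟩ := hg
    exact ⟨p + q, fun x => by simp [hp, hq]⟩
  | mul f g _ _ hf hg =>
    obtain ⟨p, hp⟩ := hf
    obtain ⟨q, hq⟩ := hg
    exact ⟨p * q, fun x => by simp [hp, hq]⟩

end PolyMap

section Normed

open Filter Topology

variable {T W : Type*} [NormedAddCommGroup T] [NormedSpace ℂ T] [FiniteDimensional ℂ T]
  [NormedAddCommGroup W] [NormedSpace ℂ W]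

theorem continuous_of_mem_polyFun [FiniteDimensional ℂ W] {f : W → ℂ} (hf : f ∈ polyFun W) :
    Continuous f := by
  induction hf using Algebra.adjoin_induction with
  | mem f hf =>
    obtain ⟨φ, rfl⟩ := hf
    exact φ.continuous_of_finiteDimensional
  | algebraMap c => exact continuous_const
  | add f g _ _ hf hg => exact hf.add hg
  | mul f g _ _ hf hg => exact hf.mul hg

/-- A polynomial function that vanishes near a point is zero. -/
theorem eq_zero_of_eventually_eq_zero {f : W → ℂ} (hf : f ∈ polyFun W) {x : W}
    (h : ∀ᶠ y in 𝓝 x, f y = 0) (y : W) : f y = 0 := by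
  obtain ⟨p, hp⟩ := exists_polynomial_on_line hf x (y - x)
  have hc : Tendsto (fun t : ℂ => x + t • (y - x)) (𝓝 0) (𝓝 x) := by
    have : Continuous fun t : ℂ => x + t • (y - x) := by fun_prop
    simpa using this.tendsto 0
  have h1 : ∀ᶠ t : ℂ in 𝓝[≠] 0, p.eval t = 0 := by
    filter_upwards [(hc.eventually h).filter_mono nhdsWithin_le_nhds] with t ht
    rw [← hp, ht]
  have h2 : p = 0 := by
    refine Polynomial.eq_zero_of_infinite_isRoot p fun hfin => ?_
    have h3 : ∀ᶠ t : ℂ in 𝓝[≠] 0, t ∉ {t | p.IsRoot t} \ {0} :=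
      mem_nhdsWithin_of_mem_nhds
        ((hfin.subset Set.sdiff_subset).isClosed.isOpen_compl.mem_nhds (by simp))
    obtain ⟨t, ht1, ht2, ht3⟩ := (h1.and (h3.and self_mem_nhdsWithin)).exists
    exact ht2 ⟨ht1, ht3⟩
  have := hp 1
  rw [h2] at this
  simpa using this

/-- The image of a map that is a submersion at a point is Zariski dense. -/
theorem eq_zero_of_hasStrictFDerivAt_surjective [FiniteDimensional ℂ W] {Φ : T → W} {x : T}
    {Φ' : T →L[ℂ] W}
    (hΦ : HasStrictFDerivAt Φ Φ' x) (hs : Function.Surjective Φ') {f : W → ℂ}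
    (hf : f ∈ polyFun W) (h : ∀ᶠ y in 𝓝 x, f (Φ y) = 0) (w : W) : f w = 0 := by
  have : CompleteSpace T := FiniteDimensional.complete ℂ T
  have : CompleteSpace W := FiniteDimensional.complete ℂ W
  refine eq_zero_of_eventually_eq_zero hf (x := Φ x) ?_ w
  rw [← hΦ.map_nhds_eq_of_surj (LinearMap.range_eq_top.2 hs)]
  exact h

end Normed

/-! ### Dominant rational maps -/

theorem hasDerivAt_eval_line {σ : Type*} [Fintype σ] (p : MvPolynomial σ ℂ) (x v : σ → ℂ) :
    HasDerivAt (fun t : ℂ => MvPolynomial.eval (x + t • v) p)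
      (∑ j, v j * MvPolynomial.eval x (MvPolynomial.pderiv j p)) 0 := by
  classical
  induction p using MvPolynomial.induction_on with
  | C a => simpa using hasDerivAt_const (0 : ℂ) a
  | add p q hp hq => simpa [mul_add, Finset.sum_add_distrib] using! hp.add hq
  | mul_X p i hp =>
    have h1 : HasDerivAt (fun t : ℂ => x i + t * v i) (v i) 0 := by
      simpa using ((hasDerivAt_id (0 : ℂ)).mul_const (v i)).const_add (x i)
    have h2 := hp.mul h1
    have h3 : ∀ t : ℂ, MvPolynomial.eval (x + t • v) (p * MvPolynomial.X i) =
        MvPolynomial.eval (x + t • v) p * (x i + t * v i) := fun t => by simp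
    simp only [h3]
    refine h2.congr_deriv ?_
    have h4 : ∀ j, v j * MvPolynomial.eval x (MvPolynomial.pderiv j (p * MvPolynomial.X i)) =
        v j * MvPolynomial.eval x (MvPolynomial.pderiv j p) * x i +
          (if j = i then MvPolynomial.eval x p * v j else 0) := fun j => by
      rw [Derivation.leibniz, MvPolynomial.pderiv_X]
      by_cases h : j = i
      · subst h
        simp
        ring
      · have h' : i ≠ j := fun h' => h h'.symm
        simp [h, h']
        ring
    rw [Finset.sum_congr rfl fun j _ => h4 j]
    simp [Finset.sum_add_distrib, Finset.sum_mul]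

/-- A rational map with Zariski dense image is a submersion at some point. This is where
characteristic zero enters. -/
theorem exists_hasDerivAt_surjective {T W : Type*} [AddCommGroup T] [Module ℂ T]
    [FiniteDimensional ℂ T] [NormedAddCommGroup W] [NormedSpace ℂ W] [FiniteDimensional ℂ W]
    {P : T → W} (hP : IsPolyMap P) {q : T → ℂ} (hq : q ∈ polyFun T)
    (hd : ∀ F ∈ polyFun W, (∀ x, q x ≠ 0 → F ((q x)⁻¹ • P x) = 0) → ∀ y, F y = 0) :
    ∃ x, q x ≠ 0 ∧ ∀ w, ∃ v,
      HasDerivAt (fun t : ℂ => (q (x + t • v))⁻¹ • P (x + t • v)) w 0 := by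
  let b := Module.finBasis ℂ T
  let c := Module.finBasis ℂ W
  choose p hp using fun i => exists_mvPolynomial_of_mem_polyFun b (hP (c.coord i))
  obtain ⟨r, hr⟩ := exists_mvPolynomial_of_mem_polyFun b hq
  have hb : ∀ y : Fin (Module.finrank ℂ T) → ℂ, (b.repr (b.equivFun.symm y) : _ → ℂ) = y :=
    fun y => b.equivFun.apply_symm_apply y
  have hpv : ∀ y i, MvPolynomial.eval y (p i) = c.repr (P (b.equivFun.symm y)) i := fun y i => by
    rw [← c.coord_apply, hp, hb]
  have hrv : ∀ y, MvPolynomial.eval y r = q (b.equivFun.symm y) := fun y => by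
    rw [hr, hb]
  obtain ⟨x, hx, hs⟩ := exists_surjective_jacobian p r (fun F hF => by
    refine MvPolynomial.funext fun y => ?_
    rw [map_zero]
    have := hd _ (c.equivFun.toLinearMap.isPolyMap.comp_mem (eval_mem_polyFun F)) (fun x hx => ?_)
      (c.equivFun.symm y)
    · change MvPolynomial.eval (c.equivFun (c.equivFun.symm y)) F = 0 at this
      rwa [c.equivFun.apply_symm_apply] at this
    · have h1 := hF (b.repr x) (by rwa [← hr])
      refine Eq.trans ?_ h1
      change MvPolynomial.eval (c.equivFun ((q x)⁻¹ • P x)) F = _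
      congr 2
      ext i
      rw [← hr, ← hp, map_smul, Pi.smul_apply, smul_eq_mul, div_eq_inv_mul]
      rfl)
  refine ⟨b.equivFun.symm x, by rwa [← hrv], fun w => ?_⟩
  obtain ⟨v, hv⟩ := hs (c.repr w)
  refine ⟨b.equivFun.symm v, ?_⟩
  have h0 : ∀ t : ℂ, b.equivFun.symm x + t • b.equivFun.symm v = b.equivFun.symm (x + t • v) :=
    fun t => by rw [map_add, map_smul]
  let e := c.equivFun.toContinuousLinearEquiv
  have h1 : HasDerivAt (fun t : ℂ => e ((q (b.equivFun.symm x + t • b.equivFun.symm v))⁻¹ •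
      P (b.equivFun.symm x + t • b.equivFun.symm v))) (e w) 0 := by
    rw [hasDerivAt_pi]
    intro i
    have h2 : ∀ t : ℂ, e ((q (b.equivFun.symm x + t • b.equivFun.symm v))⁻¹ •
        P (b.equivFun.symm x + t • b.equivFun.symm v)) i =
        MvPolynomial.eval (x + t • v) (p i) / MvPolynomial.eval (x + t • v) r := fun t => by
      rw [hpv, hrv, ← h0, map_smul, Pi.smul_apply, smul_eq_mul, div_eq_inv_mul]
      rfl
    simp only [h2]
    have h3 := (hasDerivAt_eval_line (p i) x v).div (hasDerivAt_eval_line r x v) (by simpa using hx)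
    refine h3.congr_deriv ?_
    simp only [zero_smul, add_zero]
    rw [div_eq_iff (pow_ne_zero 2 hx)]
    refine Eq.trans ?_ (hv i)
    simp only [map_sub, map_mul, Finset.sum_mul, Finset.mul_sum, ← Finset.sum_sub_distrib]
    exact Finset.sum_congr rfl fun j _ => by ring
  have h2 := (e.symm : (_ → ℂ) →L[ℂ] W).hasFDerivAt.comp_hasDerivAt (0 : ℂ) h1
  simpa [Function.comp_def] using h2

/-! ### Density of conjugates of a linear slice -/

section Slice

/-- A unit of a finite-dimensional subalgebra has its inverse in the subalgebra, because
multiplication by the unit is injective, hence surjective. -/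
theorem Subalgebra.inv_mem_of_finiteDimensional {R : Type*} [Ring R] [Algebra ℂ R]
    [FiniteDimensional ℂ R] (𝔨 : Subalgebra ℂ R) (g : Rˣ) (hg : (g : R) ∈ 𝔨) :
    ((g⁻¹ : Rˣ) : R) ∈ 𝔨 := by
  let L : 𝔨 →ₗ[ℂ] 𝔨 := LinearMap.mulLeft ℂ (⟨g, hg⟩ : 𝔨)
  have hL : Function.Injective L := fun x y h => Subtype.ext (by
    have : (g : R) * x = g * y := congrArg Subtype.val h
    exact g.isUnit.mul_right_injective this)
  obtain ⟨x, hx⟩ := LinearMap.injective_iff_surjective.1 hL 1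
  have hx' : (g : R) * x = 1 := congrArg Subtype.val hx
  have : ((g⁻¹ : Rˣ) : R) = x := by
    rw [Units.inv_eq_of_mul_eq_one_right hx']
  rw [this]
  exact x.2

/-- The conjugates of the pairs in `S` by the units of a subalgebra. -/
def unitConjugates {R : Type*} [Ring R] [Algebra ℂ R] (𝔨 : Subalgebra ℂ R) (S : Set (R × R)) :
    Set (R × R) :=
  {y | ∃ g : Rˣ, (g : R) ∈ 𝔨 ∧ ∃ x ∈ S, y = (g * x.1 * (g⁻¹ : Rˣ), g * x.2 * (g⁻¹ : Rˣ))}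

/-- Inversion of units is a rational map: `p g / q g` is the inverse of `g`. For endomorphisms,
these are the adjugate and the determinant. -/
def HasRationalInverse (R : Type*) [Ring R] [Algebra ℂ R] : Prop :=
  ∃ (q : R → ℂ) (p : R → R), q ∈ polyFun R ∧ IsPolyMap p ∧ (∀ g, IsUnit g → q g ≠ 0) ∧
    ∀ g, g * p g = q g • 1 ∧ p g * g = q g • 1

/-- Conjugation of a pair by a unit, as a linear map. -/
def conjPair {R : Type*} [Ring R] [Algebra ℂ R] (g : Rˣ) : R × R →ₗ[ℂ] R × R :=
  (LinearMap.mulLeftRight ℂ ((g : R), ((g⁻¹ : Rˣ) : R))).prodMap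
    (LinearMap.mulLeftRight ℂ ((g : R), ((g⁻¹ : Rˣ) : R)))

theorem conjPair_apply {R : Type*} [Ring R] [Algebra ℂ R] (g : Rˣ) (x : R × R) :
    conjPair g x = (g * x.1 * (g⁻¹ : Rˣ), g * x.2 * (g⁻¹ : Rˣ)) := rfl

theorem conjPair_mul {R : Type*} [Ring R] [Algebra ℂ R] (g h : Rˣ) (x : R × R) :
    conjPair (g * h) x = conjPair g (conjPair h x) := by
  simp [conjPair_apply, mul_assoc]

theorem conjPair_mem_zariskiClosure {R : Type*} [Ring R] [Algebra ℂ R] {𝔨 : Subalgebra ℂ R}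
    {S : Set (R × R)} {g : Rˣ} (hg : (g : R) ∈ 𝔨) {x : R × R}
    (hx : x ∈ zariskiClosure (unitConjugates 𝔨 S)) :
    conjPair g x ∈ zariskiClosure (unitConjugates 𝔨 S) := by
  refine (conjPair g).isPolyMap.map_mem_zariskiClosure (fun y hy => ?_) hx
  obtain ⟨h, hh, z, hz, rfl⟩ := hy
  refine subset_zariskiClosure _ ⟨g * h, 𝔨.mul_mem hg hh, z, hz, ?_⟩
  rw [← conjPair_apply, ← conjPair_apply, conjPair_mul]

variable {R : Type*} [NormedRing R] [NormedAlgebra ℂ R] [FiniteDimensional ℂ R]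

/-- The differential of `(X, C) ↦ (1 + X) C (1 + X)⁻¹` at `(0, B)` is `(X, C) ↦ [X, B] + C`. -/
theorem exists_hasStrictFDerivAt_conj (B : R) : ∃ L : R × R →L[ℂ] R,
    HasStrictFDerivAt (fun z : R × R => (1 + z.1) * z.2 * Ring.inverse (1 + z.1)) L (0, B) ∧
    ∀ z, L z = z.1 * B + z.2 - B * z.1 := by
  have : CompleteSpace R := FiniteDimensional.complete ℂ R
  have h0 : HasStrictFDerivAt (fun z : R × R => 1 + z.1) (ContinuousLinearMap.fst ℂ R R) (0, B) :=
    hasStrictFDerivAt_fst.const_add 1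
  have h1 : HasStrictFDerivAt (fun z : R × R => z.2) (ContinuousLinearMap.snd ℂ R R) (0, B) :=
    hasStrictFDerivAt_snd
  have h2 := hasStrictFDerivAt_ringInverse (𝕜 := ℂ) (1 : Rˣ)
  have h3 : HasStrictFDerivAt (fun z : R × R => Ring.inverse (1 + z.1)) _ (0, B) :=
    HasStrictFDerivAt.comp (g := Ring.inverse) (0, B) (by simpa using h2) h0
  have h4 := (h0.mul' h1).mul' h3
  refine ⟨_, h4, fun z => ?_⟩
  simp
  abel

theorem eventually_isUnit_one_add {T : Type*} [TopologicalSpace T] {φ : T → R}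
    (hφ : Continuous φ) {t : T} (ht : φ t = 0) :
    ∀ᶠ y in nhds t, IsUnit (1 + φ y) := by
  have : CompleteSpace R := FiniteDimensional.complete ℂ R
  have h1 : Continuous fun y => 1 + φ y := by fun_prop
  refine h1.continuousAt.eventually (IsOpen.mem_nhds Units.isOpen ?_)
  simp [ht]

theorem exists_linearProjection {W : Type*} [AddCommGroup W] [Module ℂ W] (E : Submodule ℂ W) :
    ∃ π : W →ₗ[ℂ] E, ∀ e : E, π e = e := by
  obtain ⟨π, hπ⟩ := LinearMap.exists_leftInverse_of_injective E.subtype E.ker_subtype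
  exact ⟨π, fun e => LinearMap.congr_fun hπ e⟩

/-- The map `(X, f) ↦ (1 + X) (b + f) (1 + X)⁻¹` from `𝔨^A × F` to `E` is a submersion at `0`, so
its image is dense in `E`; and `1 + X` fixes `A`. -/
theorem mem_zariskiClosure_of_slice (𝔨 : Subalgebra ℂ R) (A : R)
    (E F : Submodule ℂ R) (hFE : F ≤ E)
    (hE' : ∀ g : Rˣ, (g : R) ∈ 𝔨 → g * A = A * g → ∀ B ∈ E, g * B * (g⁻¹ : Rˣ) ∈ E) {b : R}
    (hb : b ∈ F) (h : ∀ e ∈ E, ∃ X ∈ 𝔨, X * A = A * X ∧ X * b - b * X - e ∈ F) {B : R}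
    (hB : B ∈ E) : (A, B) ∈ zariskiClosure (unitConjugates 𝔨 ({A} ×ˢ (F : Set R))) := by
  intro f hf hf0
  obtain ⟨π, hπ⟩ := exists_linearProjection E
  let 𝔷 : Submodule ℂ R := Subalgebra.toSubmodule (𝔨 ⊓ Subalgebra.centralizer ℂ {A})
  have h𝔷 : ∀ {X}, X ∈ 𝔷 ↔ X ∈ 𝔨 ∧ X * A = A * X := fun {X} => by
    simp [𝔷, Subalgebra.mem_centralizer_iff, eq_comm]
  obtain ⟨L, hL, hL'⟩ := exists_hasStrictFDerivAt_conj b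
  let j : 𝔷 × F →L[ℂ] R × R := 𝔷.subtypeL.prodMap F.subtypeL
  have hj : HasStrictFDerivAt (fun z : 𝔷 × F => j z + (0, b)) j 0 :=
    j.hasStrictFDerivAt.add_const _
  have hc := (LinearMap.toContinuousLinearMap π).hasStrictFDerivAt.comp (0 : 𝔷 × F)
    (HasStrictFDerivAt.comp (0 : 𝔷 × F) (by rwa [map_zero, zero_add]) hj)
  have hfE : (fun B : E => f (A, B)) ∈ polyFun E :=
    ((isPolyMap_const A).prodMk E.subtype.isPolyMap).comp_mem hf
  refine eq_zero_of_hasStrictFDerivAt_surjective hc (fun e => ?_) hfE ?_ ⟨B, hB⟩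
  · obtain ⟨X, hX, hXA, hr⟩ := h e e.2
    refine ⟨(⟨X, h𝔷.2 ⟨hX, hXA⟩⟩, -⟨_, hr⟩), ?_⟩
    have : L (j (⟨X, h𝔷.2 ⟨hX, hXA⟩⟩, -⟨_, hr⟩)) = e := by
      rw [hL']
      simp [j]
      abel
    change π (L (j _)) = e
    rw [this, hπ]
  · have hu : Continuous fun z : 𝔷 × F => (z.1 : R) := by fun_prop
    filter_upwards [eventually_isUnit_one_add hu (t := 0) rfl] with z hz
    obtain ⟨g, hg⟩ := hz
    have hzm := h𝔷.1 z.1.2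
    have hg𝔨 : (g : R) ∈ 𝔨 := hg ▸ 𝔨.add_mem 𝔨.one_mem hzm.1
    have hgA : (g : R) * A = A * g := by
      rw [hg, add_mul, mul_add, hzm.2, one_mul, mul_one]
    have hbz : (z.2 : R) + b ∈ F := F.add_mem z.2.2 hb
    have h1 := hE' g hg𝔨 hgA _ (hFE hbz)
    have h2 : (π ((1 + (z.1 : R)) * ((z.2 : R) + b) * Ring.inverse (1 + (z.1 : R))) : R) =
        g * ((z.2 : R) + b) * (g⁻¹ : Rˣ) := by
      rw [← hg, Ring.inverse_unit]
      exact congrArg Subtype.val (hπ ⟨_, h1⟩)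
    refine hf0 _ ⟨g, hg𝔨, (A, (z.2 : R) + b), ⟨rfl, hbz⟩, Prod.ext ?_ ?_⟩
    · change A = g * A * (g⁻¹ : Rˣ)
      rw [hgA, mul_assoc, Units.mul_inv, mul_one]
    · simpa [j] using h2

/-- The rational map `(g, b) ↦ (g A g⁻¹, g b g⁻¹)` on `𝔨 × F`, projected to the space `[𝔨, A] ×
E`, is dominant, so it is a submersion at some `(g, b)`. Hence the image of its differential at
`(1, b)`, `(X, f) ↦ ([X, A], [X, b] + f)`, has dimension at least `dim [𝔨, A] + dim E`, and the
`X` that commute with `A` must contribute all of `E`. -/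
theorem exists_slice_of_mem_zariskiClosure (hR : HasRationalInverse R) (𝔨 : Subalgebra ℂ R) (A : R)
    (E F : Submodule ℂ R) (hFE : F ≤ E)
    (hE : ∀ X ∈ 𝔨, X * A = A * X → ∀ B ∈ E, X * B - B * X ∈ E)
    (h : ∀ B ∈ E, (A, B) ∈ zariskiClosure (unitConjugates 𝔨 ({A} ×ˢ (F : Set R)))) :
    ∃ b ∈ F, ∀ e ∈ E, ∃ X ∈ 𝔨, X * A = A * X ∧ X * b - b * X - e ∈ F := by
  obtain ⟨q, p, hq, hp, hqu, hqp⟩ := hR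
  let 𝔨' : Submodule ℂ R := Subalgebra.toSubmodule 𝔨
  let adA : R →ₗ[ℂ] R := LinearMap.mulRight ℂ A - LinearMap.mulLeft ℂ A
  have hadA : ∀ X, adA X = X * A - A * X := fun X => rfl
  let 𝔱 : Submodule ℂ R := 𝔨'.map adA
  obtain ⟨π₁, hπ₁⟩ := exists_linearProjection 𝔱
  obtain ⟨π₂, hπ₂⟩ := exists_linearProjection E
  let π : R × R →ₗ[ℂ] 𝔱 × E := π₁.prodMap π₂
  have hqinv : ∀ g : R, q g ≠ 0 → ∃ u : Rˣ, (u : R) = g ∧ ((u⁻¹ : Rˣ) : R) = (q g)⁻¹ • p g := by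
    intro g hg
    refine ⟨⟨g, (q g)⁻¹ • p g, ?_, ?_⟩, rfl, rfl⟩
    · rw [mul_smul_comm, (hqp g).1, smul_smul, inv_mul_cancel₀ hg, one_smul]
    · rw [smul_mul_assoc, (hqp g).2, smul_smul, inv_mul_cancel₀ hg, one_smul]
  let P : 𝔨' × F → 𝔱 × E := fun z => π ((z.1 : R) * A * p z.1, (z.1 : R) * z.2 * p z.1)
  have hPu : ∀ z : 𝔨' × F, q z.1 ≠ 0 → ∃ u : Rˣ, (u : R) = z.1 ∧
      (q z.1)⁻¹ • P z = π (conjPair u (A, z.2)) := by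
    intro z hz
    obtain ⟨u, hu, hu'⟩ := hqinv z.1 hz
    refine ⟨u, hu, ?_⟩
    rw [conjPair_apply, hu, hu']
    simp only [P, ← map_smul, Prod.smul_mk, mul_smul_comm]
  have hval : IsPolyMap fun z : 𝔨' × F => (z.1 : R) :=
    (𝔨'.subtype ∘ₗ LinearMap.fst ℂ 𝔨' F).isPolyMap
  have hval' : IsPolyMap fun z : 𝔨' × F => (z.2 : R) :=
    (F.subtype ∘ₗ LinearMap.snd ℂ 𝔨' F).isPolyMap
  have hP : IsPolyMap P := π.isPolyMap.comp
    (((hval.mul (isPolyMap_const A)).mul (hp.comp hval)).prodMk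
      ((hval.mul hval').mul (hp.comp hval)))
  -- Dominance: by hypothesis the closure of the image contains the projections of the translates
  -- of `(A, E)`, and `(X, e) ↦ ((1 + X) A (1 + X)⁻¹, (1 + X) e (1 + X)⁻¹)` is a submersion at `0`
  -- after projection.
  obtain ⟨z, hz, hs⟩ := exists_hasDerivAt_surjective hP (hval.comp_mem hq) (by
    intro f hf hf0
    have hf1 : ∀ x ∈ zariskiClosure (unitConjugates 𝔨 ({A} ×ˢ (F : Set R))), f (π x) = 0 := by
      intro x hx
      refine hx _ (π.isPolyMap.comp_mem hf) ?_
      rintro _ ⟨g, hg, ⟨_, b⟩, ⟨rfl, hb⟩, rfl⟩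
      have h1 := hqu g g.isUnit
      have h2 := hf0 (⟨g, hg⟩, ⟨b, hb⟩) h1
      obtain ⟨u, hu, hu'⟩ := hPu (⟨g, hg⟩, ⟨b, hb⟩) h1
      rw [hu', Units.ext hu] at h2
      exact h2
    obtain ⟨L₁, hL₁, hL₁'⟩ := exists_hasStrictFDerivAt_conj A
    obtain ⟨L₂, hL₂, hL₂'⟩ := exists_hasStrictFDerivAt_conj (0 : R)
    let j₁ : 𝔨' × E →L[ℂ] R × R := (𝔨'.subtypeL ∘L ContinuousLinearMap.fst ℂ 𝔨' E).prod 0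
    let j₂ : 𝔨' × E →L[ℂ] R × R := 𝔨'.subtypeL.prodMap E.subtypeL
    have hj₁ : HasStrictFDerivAt (fun z : 𝔨' × E => j₁ z + (0, A)) j₁ 0 :=
      j₁.hasStrictFDerivAt.add_const _
    have hc := (LinearMap.toContinuousLinearMap π).hasStrictFDerivAt.comp (0 : 𝔨' × E)
      ((HasStrictFDerivAt.comp (0 : 𝔨' × E) (by rwa [map_zero, zero_add]) hj₁).prodMk
        (HasStrictFDerivAt.comp (0 : 𝔨' × E) (by rwa [map_zero]) j₂.hasStrictFDerivAt))
    refine fun y => eq_zero_of_hasStrictFDerivAt_surjective hc (fun y => ?_) hf ?_ y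
    · obtain ⟨⟨_, X, hX, rfl⟩, e⟩ := y
      refine ⟨(⟨X, hX⟩, e), ?_⟩
      change π (L₁ (j₁ (⟨X, hX⟩, e)), L₂ (j₂ (⟨X, hX⟩, e))) = _
      rw [hL₁', hL₂']
      refine Prod.ext ?_ ?_
      · have : (j₁ (⟨X, hX⟩, e)).1 * A + (j₁ (⟨X, hX⟩, e)).2 - A * (j₁ (⟨X, hX⟩, e)).1 = adA X := by
          simp [j₁, hadA]
        change π₁ _ = _
        rw [this]
        exact hπ₁ ⟨adA X, X, hX, rfl⟩
      · change π₂ _ = _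
        simp only [mul_zero, zero_mul, zero_add, sub_zero]
        exact hπ₂ e
    · have hu : Continuous fun z : 𝔨' × E => (z.1 : R) := by fun_prop
      filter_upwards [eventually_isUnit_one_add hu (t := 0) rfl] with z hz
      obtain ⟨g, hg⟩ := hz
      have hg𝔨 : (g : R) ∈ 𝔨 := hg ▸ 𝔨.add_mem 𝔨.one_mem z.1.2
      have := hf1 _ (conjPair_mem_zariskiClosure hg𝔨 (h z.2 z.2.2))
      rw [conjPair_apply] at this
      simpa [j₁, j₂, ← hg] using this)
  obtain ⟨g, hg, -⟩ := hPu z hz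
  have hg𝔨 : (g : R) ∈ 𝔨 := hg ▸ z.1.2
  have hginv := 𝔨.inv_mem_of_finiteDimensional g hg𝔨
  let b : R := z.2
  let δ : 𝔨' × F →ₗ[ℂ] R × R := LinearMap.prod (adA ∘ₗ 𝔨'.subtype ∘ₗ LinearMap.fst ℂ 𝔨' F)
    ((LinearMap.mulRight ℂ b - LinearMap.mulLeft ℂ b) ∘ₗ 𝔨'.subtype ∘ₗ LinearMap.fst ℂ 𝔨' F +
      F.subtype ∘ₗ LinearMap.snd ℂ 𝔨' F)
  have hδ : ∀ y : 𝔨' × F, δ y = ((y.1 : R) * A - A * y.1, (y.1 : R) * b - b * y.1 + y.2) :=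
    fun y => rfl
  -- The differential at `(g, b)` is the conjugate by `g` of the differential `δ` at `(1, b)`.
  have hsurj : ∀ w : 𝔱 × E, ∃ y, π (conjPair g (δ y)) = w := by
    intro w
    obtain ⟨v, hv⟩ := hs w
    refine ⟨(⟨((g⁻¹ : Rˣ) : R) * v.1, 𝔨.mul_mem hginv v.1.2⟩, v.2), ?_⟩
    refine HasDerivAt.unique ?_ hv
    obtain ⟨L₁, hL₁, hL₁'⟩ := exists_hasStrictFDerivAt_conj A
    obtain ⟨L₂, hL₂, hL₂'⟩ := exists_hasStrictFDerivAt_conj b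
    let Y : R := ((g⁻¹ : Rˣ) : R) * v.1
    have hline : ∀ C f : R, HasDerivAt (fun t : ℂ => (t • Y, C + t • f)) (Y, f) 0 := by
      intro C f
      have h1 : HasDerivAt (fun t : ℂ => t • Y) Y 0 := by
        simpa using (hasDerivAt_id (0 : ℂ)).smul_const Y
      have h2 : HasDerivAt (fun t : ℂ => C + t • f) f 0 := by
        simpa using ((hasDerivAt_id (0 : ℂ)).smul_const f).const_add C
      exact h1.prodMk h2
    have hd₁ := hL₁.hasFDerivAt.comp_hasDerivAt_of_eq (0 : ℂ) (hline A 0) (by simp)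
    have hd₂ := hL₂.hasFDerivAt.comp_hasDerivAt_of_eq (0 : ℂ) (hline b v.2) (by simp)
    have hd := (LinearMap.toContinuousLinearMap (π ∘ₗ conjPair g)).hasFDerivAt.comp_hasDerivAt
      (0 : ℂ) (hd₁.prodMk hd₂)
    rw [hL₁', hL₂'] at hd
    refine (hd.congr_of_eventuallyEq ?_).congr_deriv ?_
    · have hu : Continuous fun t : ℂ => t • Y := by fun_prop
      have : CompleteSpace R := FiniteDimensional.complete ℂ R
      filter_upwards [eventually_isUnit_one_add hu (t := 0) (by simp)] with t ht
      obtain ⟨k, hk⟩ := ht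
      have hgk : ((g * k : Rˣ) : R) = (z + t • v).1 := by
        rw [Units.val_mul, hk, mul_add, mul_smul_comm]
        simp [Y, ← hg]
      obtain ⟨u, hu, hu'⟩ := hPu (z + t • v) (by rw [← hgk]; exact hqu _ (g * k).isUnit)
      have hug : u = g * k := Units.ext (hu.trans hgk.symm)
      rw [hu', hug, conjPair_mul]
      change _ = π (conjPair g _)
      simp only [Function.comp, ← hk, Ring.inverse_unit, smul_zero, add_zero]
      rfl
    · change π (conjPair g _) = π (conjPair g _)
      congr 2
      rw [hδ]
      simp only [add_zero]
      refine Prod.ext rfl ?_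
      simp only [Y]
      abel
  let D := LinearMap.range δ
  have hD : Module.finrank ℂ 𝔱 + Module.finrank ℂ E ≤ Module.finrank ℂ D := by
    rw [← Module.finrank_prod]
    refine LinearMap.finrank_le_finrank_of_surjective (f := (π ∘ₗ conjPair g).domRestrict D) ?_
    intro w
    obtain ⟨y, hy⟩ := hsurj w
    exact ⟨⟨δ y, y, rfl⟩, hy⟩
  -- `N = [𝔨^A, b] + F`
  let N : Submodule ℂ R := D.comap (LinearMap.inr ℂ R R)
  have hN : ∀ {e}, e ∈ N → ∃ X ∈ 𝔨, X * A = A * X ∧ ∃ f ∈ F, X * b - b * X + f = e := by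
    rintro e ⟨⟨⟨X, hX⟩, ⟨f, hf⟩⟩, hy⟩
    rw [hδ] at hy
    exact ⟨X, hX, sub_eq_zero.1 (congrArg Prod.fst hy), f, hf, congrArg Prod.snd hy⟩
  have hNE : N ≤ E := by
    intro e he
    obtain ⟨X, hX, hXA, f, hf, rfl⟩ := hN he
    exact E.add_mem (hE X hX hXA b (hFE z.2.2)) (hFE hf)
  have hDN : Module.finrank ℂ D ≤ Module.finrank ℂ 𝔱 + Module.finrank ℂ N := by
    let ψ := (LinearMap.fst ℂ R R).domRestrict D
    rw [← LinearMap.finrank_range_add_finrank_ker ψ]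
    refine add_le_add (Submodule.finrank_mono ?_) ?_
    · rintro _ ⟨⟨_, y, rfl⟩, rfl⟩
      exact ⟨y.1, y.1.2, rfl⟩
    · have hmem : ∀ y : LinearMap.ker ψ, (y : D).1.2 ∈ N := by
        rintro ⟨⟨⟨y₁, y₂⟩, hy⟩, hy'⟩
        have hy1 : y₁ = 0 := hy'
        subst hy1
        exact hy
      refine LinearMap.finrank_le_finrank_of_injective
        (f := ((LinearMap.snd ℂ R R ∘ₗ D.subtype ∘ₗ (LinearMap.ker ψ).subtype).codRestrict N hmem))
        ?_
      intro y y' hyy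
      have h1 : (y : D).1.1 = 0 := y.2
      have h2 : (y' : D).1.1 = 0 := y'.2
      exact Subtype.ext (Subtype.ext (Prod.ext (h1.trans h2.symm) (congrArg Subtype.val hyy)))
  have hNeq : N = E := Submodule.eq_of_le_of_finrank_le hNE (by omega)
  refine ⟨b, z.2.2, fun e he => ?_⟩
  obtain ⟨X, hX, hXA, f, hf, rfl⟩ := hN (hNeq ▸ he)
  exact ⟨X, hX, hXA, by simpa using F.neg_mem hf⟩

/-- Suppose that the units `K` of `𝔨` which commute with `A` preserve the space `E`. Then the
`K`-conjugates of `{A} × F` are dense in those of `{A} × E` if and only if some `b ∈ F` satisfies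
`[𝔨^A, b] + F = E`, where `𝔨^A` is the centralizer of `A` in `𝔨`. Both directions compare the
differentials of the maps `(g, b) ↦ (g A g⁻¹, g b g⁻¹)`. -/
theorem slice_dense_iff (hR : HasRationalInverse R) (𝔨 : Subalgebra ℂ R) (A : R)
    (E F : Submodule ℂ R) (hFE : F ≤ E)
    (hE : ∀ X ∈ 𝔨, X * A = A * X → ∀ B ∈ E, X * B - B * X ∈ E)
    (hE' : ∀ g : Rˣ, (g : R) ∈ 𝔨 → g * A = A * g → ∀ B ∈ E, g * B * (g⁻¹ : Rˣ) ∈ E) :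
    (∀ B ∈ E, (A, B) ∈ zariskiClosure (unitConjugates 𝔨 ({A} ×ˢ (F : Set R)))) ↔
      ∃ b ∈ F, ∀ e ∈ E, ∃ X ∈ 𝔨, X * A = A * X ∧ X * b - b * X - e ∈ F := by
  constructor
  · exact exists_slice_of_mem_zariskiClosure hR 𝔨 A E F hFE hE
  · rintro ⟨b, hb, h⟩ B hB
    exact mem_zariskiClosure_of_slice 𝔨 A E F hFE hE' hb h hB

end Slice

/-! ### Semicontinuity of the dimension of a kernel -/

section Determinants

variable {T W : Type*} [AddCommGroup T] [Module ℂ T] [AddCommGroup W] [Module ℂ W]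

theorem det_mem_polyFun {n : Type*} [Fintype n] [DecidableEq n] {M : T → Matrix n n ℂ}
    (hM : ∀ i j, (fun x => M x i j) ∈ polyFun T) : (fun x => (M x).det) ∈ polyFun T := by
  have : (fun x => (M x).det) = ∑ σ : Equiv.Perm n,
      (Equiv.Perm.sign σ : ℤ) • ∏ i, fun x => M x (σ i) i := by
    ext x
    simp [Matrix.det_apply, Units.smul_def]
  rw [this]
  exact sum_mem fun σ _ => zsmul_mem (prod_mem fun i _ => hM _ _) _

/-- The dimension of the kernel is upper semicontinuous: the rank is bounded by `r` if and only if
all minors of size `r + 1` vanish. -/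
theorem le_finrank_ker_of_mem_zariskiClosure {P Q : Type*} [AddCommGroup P] [Module ℂ P]
    [FiniteDimensional ℂ P] [AddCommGroup Q] [Module ℂ Q]
    {L : W → P →ₗ[ℂ] Q} (hL : IsPolyMap L) {S : Set W} {k : ℕ}
    (h : ∀ x ∈ S, k ≤ Module.finrank ℂ (LinearMap.ker (L x))) {x : W} (hx : x ∈ zariskiClosure S) :
    k ≤ Module.finrank ℂ (LinearMap.ker (L x)) := by
  by_contra! hk
  let b := Module.finBasis ℂ (LinearMap.range (L x))
  choose p hp using fun i => (b i).2
  obtain ⟨π, hπ⟩ := exists_linearProjection (LinearMap.range (L x))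
  -- a maximal minor of `L` that is nonzero at `x`
  let M : W → Matrix _ _ ℂ := fun y => Matrix.of fun i j => b.coord i (π (L y (p j)))
  have hM : (fun y => (M y).det) ∈ polyFun W := det_mem_polyFun fun i j =>
    hL (b.coord i ∘ₗ π ∘ₗ LinearMap.applyₗ (p j))
  have hMx : (M x).det = 1 := by
    have : M x = 1 := by
      ext i j
      simp only [M, Matrix.of_apply, hp, hπ, Module.Basis.coord_apply, Module.Basis.repr_self,
        Matrix.one_apply, Finsupp.single_apply]
      simp [eq_comm]
    rw [this, Matrix.det_one]
  refine one_ne_zero (hMx.symm.trans (hx _ hM fun y hy => ?_))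
  by_contra hdet
  have hli : LinearIndependent ℂ fun j => L y (p j) := by
    rw [Fintype.linearIndependent_iff]
    intro c hc
    refine congrFun (Matrix.eq_zero_of_mulVec_eq_zero hdet ?_)
    ext i
    have := congrArg (b.coord i ∘ₗ π) hc
    simp only [map_sum, map_smul, map_zero] at this
    rw [Matrix.mulVec_eq_sum]
    simpa [M, mul_comm] using this
  have hli' : LinearIndependent ℂ fun j => (⟨L y (p j), p j, rfl⟩ : LinearMap.range (L y)) :=
    LinearIndependent.of_comp (LinearMap.range (L y)).subtype hli
  have h1 := hli'.fintype_card_le_finrank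
  rw [Fintype.card_fin] at h1
  have h2 := LinearMap.finrank_range_add_finrank_ker (L x)
  have h3 := LinearMap.finrank_range_add_finrank_ker (L y)
  have h4 := h y hy
  omega

end Determinants

/-! ### Limits of translates -/

section Limit

variable {R : Type*} [NormedRing R] [NormedAlgebra ℂ R] [FiniteDimensional ℂ R]

/-- If the translates of `x` by `g + t` lie in a Zariski closed set for all but finitely
many scalars `t`, then so does the translate by `g`. -/
theorem conjPair_mem_zariskiClosure_of_add_smul_of_normed {S : Set (R × R)}
    {x : R × R} (g : Rˣ) (Z : Set ℂ) (hZ : Z.Finite)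
    (h : ∀ t ∉ Z, ∀ k : Rˣ, (k : R) = g + t • 1 →
      conjPair k x ∈ zariskiClosure S) : conjPair g x ∈ zariskiClosure S := by
  have hcomp : CompleteSpace R := FiniteDimensional.complete ℂ _
  intro f hf hf0
  let c : ℂ → R × R := fun t =>
    ((g + t • (1 : R)) * x.1 * Ring.inverse (g + t • (1 : R)),
      (g + t • (1 : R)) * x.2 * Ring.inverse (g + t • (1 : R)))
  have h1 : Continuous fun t : ℂ => (g : R) + t • (1 : R) := by fun_prop
  have h2 : ContinuousAt (fun t : ℂ => Ring.inverse ((g : R) + t • 1)) 0 := by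
    have h3 := NormedRing.inverse_continuousAt g
    exact ContinuousAt.comp_of_eq h3 h1.continuousAt (by simp)
  have hc : ContinuousAt c 0 := by
    refine ContinuousAt.prodMk ?_ ?_ <;>
    exact (h1.continuousAt.mul continuousAt_const).mul h2
  have h0 : c 0 = conjPair g x := by
    simp [c, conjPair_apply]
  have hu : ∀ᶠ t in nhds (0 : ℂ), IsUnit ((g : R) + t • 1) :=
    h1.continuousAt.eventually (IsOpen.mem_nhds Units.isOpen (by simp))
  have hZ' : ∀ᶠ t in nhdsWithin (0 : ℂ) {0}ᶜ, t ∉ Z := by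
    have : ∀ᶠ t in nhds (0 : ℂ), t ∉ Z \ {0} :=
      (hZ.subset Set.sdiff_subset).isClosed.isOpen_compl.mem_nhds (by simp)
    filter_upwards [this.filter_mono nhdsWithin_le_nhds, self_mem_nhdsWithin] with t h h' ht
    exact h ⟨ht, h'⟩
  have hfc : Filter.Tendsto (fun t => f (c t)) (nhdsWithin 0 {0}ᶜ) (nhds (f (conjPair g x))) := by
    rw [← h0]
    exact ((continuous_of_mem_polyFun hf).continuousAt.comp hc).tendsto.mono_left
      nhdsWithin_le_nhds
  have hev : ∀ᶠ t in nhdsWithin (0 : ℂ) {0}ᶜ, f (c t) = 0 := by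
    filter_upwards [hu.filter_mono nhdsWithin_le_nhds, hZ'] with t ht htZ
    obtain ⟨k, hk⟩ := ht
    have := h t htZ k hk f hf hf0
    rw [conjPair_apply, hk] at this
    simp only [c, ← hk, Ring.inverse_unit]
    rw [hk]
    exact this
  exact tendsto_nhds_unique (hfc.congr' hev) tendsto_const_nhds

end Limit

/-! ### The algebra of endomorphisms -/

section MatrixNorm

variable {R : Type*} [Ring R] [Algebra ℂ R] [FiniteDimensional ℂ R]

-- The statements about an abstract algebra need a norm; any isomorphism with a matrix algebra
-- provides one.
attribute [local instance] Matrix.linftyOpNormedRing Matrix.linftyOpNormedAlgebra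

theorem slice_dense_iff_of_algEquiv {n : Type*} [Fintype n] [DecidableEq n]
    (e : R ≃ₐ[ℂ] Matrix n n ℂ) (hR : HasRationalInverse R) (𝔨 : Subalgebra ℂ R) (A : R)
    (E F : Submodule ℂ R) (hFE : F ≤ E)
    (hE : ∀ X ∈ 𝔨, X * A = A * X → ∀ B ∈ E, X * B - B * X ∈ E)
    (hE' : ∀ g : Rˣ, (g : R) ∈ 𝔨 → g * A = A * g → ∀ B ∈ E, g * B * (g⁻¹ : Rˣ) ∈ E) :
    (∀ B ∈ E, (A, B) ∈ zariskiClosure (unitConjugates 𝔨 ({A} ×ˢ (F : Set R)))) ↔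
      ∃ b ∈ F, ∀ e ∈ E, ∃ X ∈ 𝔨, X * A = A * X ∧ X * b - b * X - e ∈ F := by
  let N : NormedRing R := NormedRing.induced _ _ e e.injective
  let N' : NormedAlgebra ℂ R := NormedAlgebra.induced ℂ _ _ e
  exact slice_dense_iff hR 𝔨 A E F hFE hE hE'

theorem conjPair_mem_zariskiClosure_of_add_smul_of_algEquiv {n : Type*} [Fintype n] [DecidableEq n]
    (e : R ≃ₐ[ℂ] Matrix n n ℂ) {S : Set (R × R)} {x : R × R} (g : Rˣ) (Z : Set ℂ) (hZ : Z.Finite)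
    (h : ∀ t ∉ Z, ∀ k : Rˣ, (k : R) = g + t • 1 → conjPair k x ∈ zariskiClosure S) :
    conjPair g x ∈ zariskiClosure S := by
  let N : NormedRing R := NormedRing.induced _ _ e e.injective
  let N' : NormedAlgebra ℂ R := NormedAlgebra.induced ℂ _ _ e
  exact conjPair_mem_zariskiClosure_of_add_smul_of_normed g Z hZ h

end MatrixNorm

section End

variable {U : Type*} [AddCommGroup U] [Module ℂ U] [FiniteDimensional ℂ U]

theorem hasRationalInverse_end : HasRationalInverse (Module.End ℂ U) := by
  let e := LinearMap.toMatrixAlgEquiv (Module.finBasis ℂ U)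
  have hent : ∀ i j, (fun g : Module.End ℂ U => e g i j) ∈ polyFun (Module.End ℂ U) := fun i j =>
    dual_mem_polyFun (Matrix.entryLinearMap ℂ ℂ i j ∘ₗ e.toLinearMap)
  refine ⟨fun g => (e g).det, fun g => e.symm (e g).adjugate, det_mem_polyFun hent, ?_, ?_, ?_⟩
  · refine e.symm.toLinearMap.isPolyMap.comp fun φ => ?_
    have h1 : ∀ g, φ ((e g).adjugate) = ∑ i, ∑ j, (e g).adjugate i j *
        φ (Matrix.single i j 1) := by
      intro g
      conv_lhs => rw [Matrix.matrix_eq_sum_single ((e g).adjugate)]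
      simp only [map_sum]
      refine Finset.sum_congr rfl fun i _ => Finset.sum_congr rfl fun j _ => ?_
      rw [← smul_eq_mul, ← map_smul, Matrix.smul_single, smul_eq_mul, mul_one]
    have h2 : (fun g => φ ((e g).adjugate)) = ∑ i, ∑ j, (fun g => (e g).adjugate i j) *
        fun _ => φ (Matrix.single i j 1) := by
      ext g
      rw [h1]
      simp
    rw [h2]
    refine sum_mem fun i _ => sum_mem fun j _ => mul_mem ?_ (const_mem_polyFun _)
    simp only [Matrix.adjugate_apply]
    refine det_mem_polyFun fun k l => ?_
    simp only [Matrix.updateRow_apply]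
    by_cases hk : k = j
    · simpa [hk] using const_mem_polyFun _
    · simpa [hk] using hent k l
  · intro g hg
    exact ((Matrix.isUnit_iff_isUnit_det _).1 (hg.map e)).ne_zero
  · intro g
    constructor
    · apply e.injective
      rw [map_mul, e.apply_symm_apply, Matrix.mul_adjugate, map_smul, map_one]
    · apply e.injective
      rw [map_mul, e.apply_symm_apply, Matrix.adjugate_mul, map_smul, map_one]

theorem slice_dense_iff_end (𝔨 : Subalgebra ℂ (Module.End ℂ U)) (A : Module.End ℂ U)
    (E F : Submodule ℂ (Module.End ℂ U)) (hFE : F ≤ E)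
    (hE : ∀ X ∈ 𝔨, X * A = A * X → ∀ B ∈ E, X * B - B * X ∈ E)
    (hE' : ∀ g : (Module.End ℂ U)ˣ, (g : Module.End ℂ U) ∈ 𝔨 → g * A = A * g →
      ∀ B ∈ E, g * B * (g⁻¹ : (Module.End ℂ U)ˣ) ∈ E) :
    (∀ B ∈ E, (A, B) ∈ zariskiClosure (unitConjugates 𝔨 ({A} ×ˢ (F : Set (Module.End ℂ U))))) ↔
      ∃ b ∈ F, ∀ e ∈ E, ∃ X ∈ 𝔨, X * A = A * X ∧ X * b - b * X - e ∈ F :=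
  slice_dense_iff_of_algEquiv (LinearMap.toMatrixAlgEquiv (Module.finBasis ℂ U))
    hasRationalInverse_end 𝔨 A E F hFE hE hE'

theorem conjPair_mem_zariskiClosure_of_add_smul {S : Set (Module.End ℂ U × Module.End ℂ U)}
    {x : Module.End ℂ U × Module.End ℂ U} (g : (Module.End ℂ U)ˣ) (Z : Set ℂ) (hZ : Z.Finite)
    (h : ∀ t ∉ Z, ∀ k : (Module.End ℂ U)ˣ, (k : Module.End ℂ U) = g + t • 1 →
      conjPair k x ∈ zariskiClosure S) : conjPair g x ∈ zariskiClosure S :=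
  conjPair_mem_zariskiClosure_of_add_smul_of_algEquiv
    (LinearMap.toMatrixAlgEquiv (Module.finBasis ℂ U)) g Z hZ h

end End

/-! ### The orbits of multisegments -/

section Orbit

variable {R : Type*} {s : Equiv.Perm R} {V : Type*} [AddCommGroup V] [Module ℂ V]
  {𝒱 : R → Submodule ℂ V}

/-- In a basis of homogeneous vectors, each graded piece is spanned by the basis vectors in it. -/
theorem le_span_of_homogeneous_basis (h𝒱 : iSupIndep 𝒱) {κ : Type*} [Fintype κ]
    (x : Module.Basis κ ℂ V) (d : κ → R) (hx : ∀ k, x k ∈ 𝒱 (d k)) (ρ : R) :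
    𝒱 ρ ≤ Submodule.span ℂ (x '' {k | d k = ρ}) := by
  classical
  intro v hv
  obtain ⟨c, hsum⟩ : ∃ c : κ → ℂ, ∑ k, c k • x k = v := ⟨_, x.sum_repr v⟩
  rw [← Finset.sum_filter_add_sum_filter_not Finset.univ (fun k => d k = ρ)] at hsum
  have h1 : ∑ k with d k = ρ, c k • x k ∈ Submodule.span ℂ (x '' {k | d k = ρ}) :=
    Submodule.sum_mem _ fun k hk => Submodule.smul_mem _ _
      (Submodule.subset_span ⟨k, (Finset.mem_filter.1 hk).2, rfl⟩)
  have h2 : ∑ k with d k = ρ, c k • x k ∈ 𝒱 ρ :=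
    Submodule.sum_mem _ fun k hk => Submodule.smul_mem _ _
      ((Finset.mem_filter.1 hk).2 ▸ hx k)
  have h3 : ∑ k with ¬ d k = ρ, c k • x k ∈ ⨆ σ, ⨆ (_ : σ ≠ ρ), 𝒱 σ :=
    Submodule.sum_mem _ fun k hk => Submodule.smul_mem _ _
      (Submodule.mem_iSup_of_mem (d k)
        (Submodule.mem_iSup_of_mem (Finset.mem_filter.1 hk).2 (hx k)))
  have h4 : ∑ k with ¬ d k = ρ, c k • x k ∈ 𝒱 ρ := by
    have := Submodule.sub_mem _ hv h2
    rwa [← hsum, add_sub_cancel_left] at this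
  have h5 := (Submodule.disjoint_def.1 (h𝒱 ρ)) _ h4 h3
  rw [h5, add_zero] at hsum
  rwa [← hsum]

theorem map_mem_of_homogeneous_basis (h𝒱 : iSupIndep 𝒱) {κ : Type*} [Fintype κ]
    (x : Module.Basis κ ℂ V) (d : κ → R) (hx : ∀ k, x k ∈ 𝒱 (d k)) {W : Type*} [AddCommGroup W]
    [Module ℂ W] (L : V →ₗ[ℂ] W) (ρ : R) (N : Submodule ℂ W) (h : ∀ k, d k = ρ → L (x k) ∈ N)
    {v : V} (hv : v ∈ 𝒱 ρ) : L v ∈ N := by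
  have : Submodule.span ℂ (x '' {k | d k = ρ}) ≤ N.comap L :=
    Submodule.span_le.2 (by rintro _ ⟨k, hk, rfl⟩; exact h k hk)
  exact this (le_span_of_homogeneous_basis h𝒱 x d hx ρ hv)

theorem conj_mem_endRight {g : V ≃ₗ[ℂ] V} (hg : g ∈ gradedAut 𝒱) {A : Module.End ℂ V}
    (hA : A ∈ endRight s 𝒱) : g.conj A ∈ endRight s 𝒱 := fun ρ v hv => by
  rw [LinearEquiv.conj_apply_apply]
  exact (hg _ _).2 (hA ρ _ ((hg ρ _).1 (by rwa [g.apply_symm_apply])))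

theorem conj_mem_endLeft {g : V ≃ₗ[ℂ] V} (hg : g ∈ gradedAut 𝒱) {A : Module.End ℂ V}
    (hA : A ∈ endLeft s 𝒱) : g.conj A ∈ endLeft s 𝒱 := fun ρ v hv => by
  rw [LinearEquiv.conj_apply_apply]
  exact (hg _ _).2 (hA ρ _ ((hg ρ _).1 (by rwa [g.apply_symm_apply])))

theorem conj_mem_gradedOrbit {g : V ≃ₗ[ℂ] V} (hg : g ∈ gradedAut 𝒱) {m : Multisegment s}
    {A : Module.End ℂ V} (hA : A ∈ gradedOrbit 𝒱 m) : g.conj A ∈ gradedOrbit 𝒱 m := by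
  obtain ⟨hA, I, hI, Δ, x, hm, hx, hAx⟩ := hA
  refine ⟨conj_mem_endRight hg hA, I, hI, Δ, x.map g, hm, fun i ρ => ?_, fun i ρ => ?_⟩
  · exact (hg _ _).2 (hx i ρ)
  · rw [LinearEquiv.conj_apply_apply, Module.Basis.map_apply, g.symm_apply_apply, hAx]
    split_ifs
    · rfl
    · exact map_zero g

theorem conj_mem_commutingVariety {g : V ≃ₗ[ℂ] V} (hg : g ∈ gradedAut 𝒱)
    {x : Module.End ℂ V × Module.End ℂ V} (hx : x ∈ commutingVariety s 𝒱) :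
    (g.conj x.1, g.conj x.2) ∈ commutingVariety s 𝒱 :=
  ⟨conj_mem_endRight hg hx.1, conj_mem_endLeft hg hx.2.1, by
    change g.conj x.1 * g.conj x.2 = g.conj x.2 * g.conj x.1
    rw [Module.End.mul_eq_comp, Module.End.mul_eq_comp, ← LinearEquiv.conj_comp,
      ← LinearEquiv.conj_comp]
    exact congrArg _ hx.2.2⟩

theorem conj_mem_openComponent {g : V ≃ₗ[ℂ] V} (hg : g ∈ gradedAut 𝒱) {m : Multisegment s}
    {x : Module.End ℂ V × Module.End ℂ V} (hx : x ∈ openComponent 𝒱 m) :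
    (g.conj x.1, g.conj x.2) ∈ openComponent 𝒱 m :=
  ⟨conj_mem_commutingVariety hg hx.1, conj_mem_gradedOrbit hg hx.2⟩

theorem exists_equiv_of_map_univ_eq {I J D : Type*} [Fintype I] [Fintype J] {Δ : I → D}
    {Δ' : J → D} (h : Finset.univ.val.map Δ = Finset.univ.val.map Δ') :
    ∃ σ : I ≃ J, ∀ i, Δ' (σ i) = Δ i := by
  classical
  have h1 : ∀ d, Nonempty ({i // Δ i = d} ≃ {j // Δ' j = d}) := by
    intro d
    have h2 := congrArg (Multiset.count d) h
    rw [Multiset.count_map, Multiset.count_map] at h2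
    refine ⟨Fintype.equivOfCardEq ?_⟩
    rw [Fintype.card_subtype, Fintype.card_subtype]
    simp only [eq_comm (a := d)] at h2
    exact h2
  let e := fun d => (h1 d).some
  exact ⟨Equiv.ofFiberEquiv e, fun i => Equiv.ofFiberEquiv_map e i⟩

/-- `𝒪_m` is a single orbit of the group of graded automorphisms. -/
theorem exists_conj_eq_of_mem_gradedOrbit (h𝒱 : iSupIndep 𝒱) {m : Multisegment s}
    {A A' : Module.End ℂ V} (hA : A ∈ gradedOrbit 𝒱 m) (hA' : A' ∈ gradedOrbit 𝒱 m) :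
    ∃ g ∈ gradedAut 𝒱, g.conj A = A' := by
  obtain ⟨-, I, hI, Δ, x, hm, hx, hAx⟩ := hA
  obtain ⟨-, J, hJ, Δ', x', hm', hx', hAx'⟩ := hA'
  obtain ⟨σ, hσ⟩ := exists_equiv_of_map_univ_eq (hm.trans hm'.symm)
  have he : ∀ i, ∃ e : {ρ // ρ ∈ (Δ i).val} ≃ {ρ // ρ ∈ (Δ' (σ i)).val},
      ∀ ρ, (e ρ).val = ρ.val := fun i =>
    ⟨Equiv.subtypeEquivRight fun ρ => by rw [hσ], fun ρ => rfl⟩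
  choose e he using he
  let τ : (Σ i, {ρ // ρ ∈ (Δ i).val}) ≃ (Σ j, {ρ // ρ ∈ (Δ' j).val}) := Equiv.sigmaCongr σ e
  let g : V ≃ₗ[ℂ] V := x.equiv x' τ
  have hgx : ∀ i ρ, g (x ⟨i, ρ⟩) = x' ⟨σ i, e i ρ⟩ := fun i ρ => x.equiv_apply ⟨i, ρ⟩ x' τ
  have hgx' : ∀ k, g.symm (x' k) = x (τ.symm k) := fun k => by
    rw [LinearEquiv.symm_apply_eq]
    exact ((x.equiv_apply (τ.symm k) x' τ).trans (by rw [τ.apply_symm_apply])).symm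
  have hdeg : ∀ k, ((τ.symm k).2 : R) = k.2 := fun k => by
    obtain ⟨k, rfl⟩ := τ.surjective k
    rw [τ.symm_apply_apply]
    exact (he _ _).symm
  refine ⟨g, fun ρ v => ⟨fun hv => ?_, fun hv => ?_⟩, ?_⟩
  · have := map_mem_of_homogeneous_basis h𝒱 x' (fun k => k.2) (fun k => hx' k.1 k.2)
      (g.symm : V →ₗ[ℂ] V) ρ (𝒱 ρ) (fun k hk => by
        change g.symm (x' k) ∈ _
        rw [hgx', ← hk, ← hdeg]
        exact hx _ _) hv
    simpa using this
  · exact map_mem_of_homogeneous_basis h𝒱 x (fun k => k.2) (fun k => hx k.1 k.2)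
      (g : V →ₗ[ℂ] V) ρ (𝒱 ρ) (fun k hk => by
        change g (x ⟨k.1, k.2⟩) ∈ _
        have := hx' (σ k.1) (e k.1 k.2)
        rwa [he, hk, ← hgx] at this) hv
  · refine x'.ext fun k => ?_
    obtain ⟨⟨i, ρ⟩, rfl⟩ := τ.surjective k
    rw [LinearEquiv.conj_apply_apply, hgx', τ.symm_apply_apply, hAx]
    change _ = A' (x' ⟨σ i, e i ρ⟩)
    rw [hAx']
    have hiff : s (e i ρ).val ∈ (Δ' (σ i)).val ↔ s ρ.val ∈ (Δ i).val := by rw [he, hσ]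
    split_ifs with h h' h'
    · rw [hgx]
      have : e i ⟨s ρ.val, h⟩ = ⟨s (e i ρ).val, h'⟩ :=
        Subtype.ext ((he i _).trans (congrArg s (he i ρ).symm))
      rw [this]
    · exact absurd (hiff.2 h) h'
    · exact absurd (hiff.1 h') h
    · exact map_zero g

/-- The required basis exists: choose bases of the graded pieces indexed by the segments that
contain the degree. -/
theorem gradedOrbit_nonempty {m : Multisegment s} (hm : IsGradingOfDim 𝒱 m.supp)
    [FiniteDimensional ℂ V] : ∃ A, A ∈ gradedOrbit 𝒱 m := by
  classical
  obtain ⟨hint, hdim⟩ := hm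
  let I := Fin m.toList.length
  let Δ : I → Segment s := fun i => m.toList.get i
  have hΔ : Finset.univ.val.map Δ = m := by
    rw [Fin.univ_val_map, List.ofFn_get, Multiset.coe_toList]
  have hcard : ∀ ρ, Module.finrank ℂ (𝒱 ρ) = Fintype.card {i // ρ ∈ (Δ i).val} := by
    intro ρ
    rw [hdim, Multisegment.supp, Multiset.count_bind]
    conv_lhs => rw [← hΔ]
    rw [Multiset.map_map, Fintype.card_subtype, Finset.card_filter]
    refine Finset.sum_congr rfl fun i _ => ?_
    rw [Function.comp, Multiset.count_eq_of_nodup (Δ i).val.nodup]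
    rfl
  let b : ∀ ρ, Module.Basis {i // ρ ∈ (Δ i).val} ℂ (𝒱 ρ) := fun ρ =>
    (Module.finBasisOfFinrankEq ℂ (𝒱 ρ) (hcard ρ)).reindex (Fintype.equivFin _).symm
  let e : (Σ ρ, {i // ρ ∈ (Δ i).val}) ≃ (Σ i, {ρ // ρ ∈ (Δ i).val}) :=
    { toFun := fun k => ⟨k.2.1, k.1, k.2.2⟩
      invFun := fun k => ⟨k.2.1, k.1, k.2.2⟩
      left_inv := fun _ => rfl
      right_inv := fun _ => rfl }
  let x := (hint.collectedBasis b).reindex e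
  have hx : ∀ i ρ, x ⟨i, ρ⟩ ∈ 𝒱 ρ.val := fun i ρ => by
    rw [Module.Basis.reindex_apply]
    exact hint.collectedBasis_mem b (e.symm ⟨i, ρ⟩)
  let A : Module.End ℂ V := x.constr ℂ fun k =>
    if h : s k.2.val ∈ (Δ k.1).val then x ⟨k.1, s k.2.val, h⟩ else 0
  have hAx : ∀ i (ρ : {ρ // ρ ∈ (Δ i).val}), A (x ⟨i, ρ⟩) =
      if h : s ρ.val ∈ (Δ i).val then x ⟨i, s ρ.val, h⟩ else 0 := fun i ρ => x.constr_basis ℂ _ _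
  refine ⟨A, fun ρ v hv => ?_, I, inferInstance, Δ, x, hΔ, hx, fun i ρ => ?_⟩
  · refine map_mem_of_homogeneous_basis hint.submodule_iSupIndep x (fun k => k.2)
      (fun k => hx k.1 k.2) A ρ _ (fun k hk => ?_) hv
    obtain ⟨i, σ⟩ := k
    dsimp only at hk
    subst hk
    rw [hAx]
    split_ifs with h
    · exact hx i ⟨_, h⟩
    · exact zero_mem _
  · rw [hAx]

end Orbit

/-! ### Split exact sequences of graded vector spaces -/

section Splitting

variable {R : Type*} {s : Equiv.Perm R}
  {V V' U : Type*} [AddCommGroup V] [Module ℂ V] [AddCommGroup V'] [Module ℂ V']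
  [AddCommGroup U] [Module ℂ U]

/-- A decomposition of the graded vector space `U` as the direct sum of `V` and `V'`, given by the
inclusions `i`, `i'` and the projections `j'`, `j`. The roles of `V` and `V'` may be exchanged. -/
structure IsGradedSplitting (𝒱 : R → Submodule ℂ V) (𝒱' : R → Submodule ℂ V')
    (𝒰 : R → Submodule ℂ U) (i : V →ₗ[ℂ] U) (j : U →ₗ[ℂ] V') (i' : V' →ₗ[ℂ] U)
    (j' : U →ₗ[ℂ] V) : Prop where
  ji : ∀ v, j (i v) = 0
  j'i' : ∀ v, j' (i' v) = 0
  j'i : ∀ v, j' (i v) = v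
  ji' : ∀ v, j (i' v) = v
  sum : ∀ u, i (j' u) + i' (j u) = u
  i_mem : ∀ {ρ v}, v ∈ 𝒱 ρ → i v ∈ 𝒰 ρ
  i'_mem : ∀ {ρ v}, v ∈ 𝒱' ρ → i' v ∈ 𝒰 ρ
  j_mem : ∀ {ρ u}, u ∈ 𝒰 ρ → j u ∈ 𝒱' ρ
  j'_mem : ∀ {ρ u}, u ∈ 𝒰 ρ → j' u ∈ 𝒱 ρ

variable {𝒱 : R → Submodule ℂ V} {𝒱' : R → Submodule ℂ V'} {𝒰 : R → Submodule ℂ U}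
  {i : V →ₗ[ℂ] U} {j : U →ₗ[ℂ] V'} {i' : V' →ₗ[ℂ] U} {j' : U →ₗ[ℂ] V}

theorem IsGradedSplitting.symm (h : IsGradedSplitting 𝒱 𝒱' 𝒰 i j i' j') :
    IsGradedSplitting 𝒱' 𝒱 𝒰 i' j' i j :=
  ⟨h.j'i', h.ji, h.ji', h.j'i, fun u => by rw [add_comm, h.sum], h.i'_mem, h.i_mem, h.j'_mem,
    h.j_mem⟩

/-- The block diagonal endomorphism of `U = V ⊕ V'` with the given blocks. -/
def blockDiag (i : V →ₗ[ℂ] U) (j : U →ₗ[ℂ] V') (i' : V' →ₗ[ℂ] U) (j' : U →ₗ[ℂ] V)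
    (A₁ : Module.End ℂ V) (A₂ : Module.End ℂ V') : Module.End ℂ U :=
  i ∘ₗ A₁ ∘ₗ j' + i' ∘ₗ A₂ ∘ₗ j

theorem blockDiag_apply (A₁ : Module.End ℂ V) (A₂ : Module.End ℂ V') (u : U) :
    blockDiag i j i' j' A₁ A₂ u = i (A₁ (j' u)) + i' (A₂ (j u)) := rfl

theorem blockDiag_swap (A₁ : Module.End ℂ V) (A₂ : Module.End ℂ V') :
    blockDiag i' j' i j A₂ A₁ = blockDiag i j i' j' A₁ A₂ := add_comm _ _

namespace IsGradedSplitting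

variable (h : IsGradedSplitting 𝒱 𝒱' 𝒰 i j i' j')

include h

theorem mem_iff {ρ : R} {u : U} : u ∈ 𝒰 ρ ↔ j' u ∈ 𝒱 ρ ∧ j u ∈ 𝒱' ρ :=
  ⟨fun hu => ⟨h.j'_mem hu, h.j_mem hu⟩, fun hu => by
    rw [← h.sum u]
    exact add_mem (h.i_mem hu.1) (h.i'_mem hu.2)⟩

theorem ext_iff {u w : U} : u = w ↔ j' u = j' w ∧ j u = j w :=
  ⟨fun hu => hu ▸ ⟨rfl, rfl⟩, fun hu => by rw [← h.sum u, ← h.sum w, hu.1, hu.2]⟩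

theorem iSupIndep (h𝒱 : iSupIndep 𝒱) (h𝒱' : iSupIndep 𝒱') : iSupIndep 𝒰 := by
  intro ρ
  rw [Submodule.disjoint_def]
  intro u hu hu'
  have h1 : ⨆ σ, ⨆ (_ : σ ≠ ρ), 𝒰 σ ≤ (⨆ σ, ⨆ (_ : σ ≠ ρ), 𝒱 σ).comap j' :=
    iSup₂_le fun σ hσ v hv =>
      Submodule.mem_iSup_of_mem σ (Submodule.mem_iSup_of_mem hσ (h.j'_mem hv))
  have h2 : ⨆ σ, ⨆ (_ : σ ≠ ρ), 𝒰 σ ≤ (⨆ σ, ⨆ (_ : σ ≠ ρ), 𝒱' σ).comap j :=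
    iSup₂_le fun σ hσ v hv =>
      Submodule.mem_iSup_of_mem σ (Submodule.mem_iSup_of_mem hσ (h.j_mem hv))
  have h3 := (Submodule.disjoint_def.1 (h𝒱 ρ)) _ (h.j'_mem hu) (h1 hu')
  have h4 := (Submodule.disjoint_def.1 (h𝒱' ρ)) _ (h.j_mem hu) (h2 hu')
  exact h.ext_iff.2 (by simp [h3, h4])

theorem blockDiag_mem_endRight {A₁ : Module.End ℂ V} {A₂ : Module.End ℂ V'}
    (h₁ : A₁ ∈ endRight s 𝒱) (h₂ : A₂ ∈ endRight s 𝒱') :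
    blockDiag i j i' j' A₁ A₂ ∈ endRight s 𝒰 := fun _ _ hu =>
  add_mem (h.i_mem (h₁ _ _ (h.j'_mem hu))) (h.i'_mem (h₂ _ _ (h.j_mem hu)))

theorem blockDiag_mem_endLeft {A₁ : Module.End ℂ V} {A₂ : Module.End ℂ V'}
    (h₁ : A₁ ∈ endLeft s 𝒱) (h₂ : A₂ ∈ endLeft s 𝒱') :
    blockDiag i j i' j' A₁ A₂ ∈ endLeft s 𝒰 := fun _ _ hu =>
  add_mem (h.i_mem (h₁ _ _ (h.j'_mem hu))) (h.i'_mem (h₂ _ _ (h.j_mem hu)))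

theorem blockDiag_mul (A₁ B₁ : Module.End ℂ V) (A₂ B₂ : Module.End ℂ V') :
    blockDiag i j i' j' A₁ A₂ * blockDiag i j i' j' B₁ B₂ =
      blockDiag i j i' j' (A₁ * B₁) (A₂ * B₂) := by
  ext u
  simp [blockDiag_apply, h.ji, h.ji', h.j'i, h.j'i']

/-- The direct sum of members of `𝒪_m` and `𝒪_{m'}` is in `𝒪_{m + m'}`. -/
theorem blockDiag_mem_gradedOrbit {m m' : Multisegment s} {A₁ : Module.End ℂ V}
    {A₂ : Module.End ℂ V'} (h₁ : A₁ ∈ gradedOrbit 𝒱 m) (h₂ : A₂ ∈ gradedOrbit 𝒱' m') :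
    blockDiag i j i' j' A₁ A₂ ∈ gradedOrbit 𝒰 (m + m') := by
  obtain ⟨hA₁, I, hI, Δ, x, hm, hx, hAx⟩ := h₁
  obtain ⟨hA₂, J, hJ, Δ', x', hm', hx', hAx'⟩ := h₂
  let Δ'' : I ⊕ J → Segment s := Sum.elim Δ Δ'
  let e : (V × V') ≃ₗ[ℂ] U := LinearEquiv.ofLinearMap (i.coprod i') (j'.prod j)
    (LinearMap.ext fun u => h.sum u)
    (LinearMap.ext fun v => by simp [h.ji, h.ji', h.j'i, h.j'i'])
  let y := ((x.prod x').map e).reindex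
    (Equiv.sumSigmaDistrib fun k : I ⊕ J => {ρ // ρ ∈ (Δ'' k).val}).symm
  have hy₁ : ∀ k (ρ : {ρ // ρ ∈ (Δ'' (Sum.inl k)).val}), y ⟨Sum.inl k, ρ⟩ = i (x ⟨k, ρ⟩) :=
      fun k ρ => by
    refine (Module.Basis.reindex_apply _ _ _).trans ?_
    change e ((x.prod x') (Sum.inl ⟨k, ρ⟩)) = _
    simp [e]
  have hy₂ : ∀ k (ρ : {ρ // ρ ∈ (Δ'' (Sum.inr k)).val}), y ⟨Sum.inr k, ρ⟩ = i' (x' ⟨k, ρ⟩) :=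
      fun k ρ => by
    refine (Module.Basis.reindex_apply _ _ _).trans ?_
    change e ((x.prod x') (Sum.inr ⟨k, ρ⟩)) = _
    simp [e]
  refine ⟨h.blockDiag_mem_endRight hA₁ hA₂, I ⊕ J, inferInstance, Δ'', y, ?_, ?_, ?_⟩
  · rw [← hm, ← hm', ← Finset.univ_disjSum_univ]
    change (Multiset.disjSum _ _).map _ = _
    simp [Multiset.disjSum, Δ'', Function.comp_def]
  · rintro (k | k) ρ
    · rw [hy₁]
      exact h.i_mem (hx k ρ)
    · rw [hy₂]
      exact h.i'_mem (hx' k ρ)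
  · rintro (k | k) ρ
    · rw [hy₁, blockDiag_apply, h.j'i, h.ji, map_zero, map_zero, add_zero]
      by_cases h' : s ρ.val ∈ (Δ'' (Sum.inl k)).val
      · refine Eq.trans ?_ (dif_pos h').symm
        exact (congrArg i ((hAx k ρ).trans
          (dif_pos (show s ρ.val ∈ (Δ k).val from h')))).trans (hy₁ k ⟨_, h'⟩).symm
      · refine Eq.trans ?_ (dif_neg h').symm
        exact (congrArg i ((hAx k ρ).trans
          (dif_neg (show s ρ.val ∉ (Δ k).val from h')))).trans (map_zero i)
    · rw [hy₂, blockDiag_apply, h.ji', h.j'i', map_zero, map_zero, zero_add]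
      by_cases h' : s ρ.val ∈ (Δ'' (Sum.inr k)).val
      · refine Eq.trans ?_ (dif_pos h').symm
        exact (congrArg i' ((hAx' k ρ).trans
          (dif_pos (show s ρ.val ∈ (Δ' k).val from h')))).trans (hy₂ k ⟨_, h'⟩).symm
      · refine Eq.trans ?_ (dif_neg h').symm
        exact (congrArg i' ((hAx' k ρ).trans
          (dif_neg (show s ρ.val ∉ (Δ' k).val from h')))).trans (map_zero i')

/-- The Levi element of `𝔾(U)` with the given blocks. -/
theorem exists_levi {g₁ : V ≃ₗ[ℂ] V} {g₂ : V' ≃ₗ[ℂ] V'} (h₁ : g₁ ∈ gradedAut 𝒱)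
    (h₂ : g₂ ∈ gradedAut 𝒱') : ∃ g ∈ gradedAut 𝒰,
      (∀ v, g (i v) = i (g₁ v)) ∧ (∀ v, g (i' v) = i' (g₂ v)) ∧
      (∀ u, j (g u) = g₂ (j u)) ∧ (∀ u, j' (g u) = g₁ (j' u)) ∧
      ∀ A₁ A₂, g.conj (blockDiag i j i' j' A₁ A₂) =
        blockDiag i j i' j' (g₁.conj A₁) (g₂.conj A₂) := by
  have hmul := h.blockDiag_mul
  have hone : blockDiag i j i' j' 1 1 = 1 := LinearMap.ext fun u => h.sum u
  let g : U ≃ₗ[ℂ] U := LinearEquiv.ofLinearMap (blockDiag i j i' j' g₁ g₂)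
    (blockDiag i j i' j' g₁.symm g₂.symm)
    ((hmul _ _ _ _).trans (by
      rw [Module.End.mul_eq_comp, Module.End.mul_eq_comp, g₁.comp_symm, g₂.comp_symm]; exact hone))
    ((hmul _ _ _ _).trans (by
      rw [Module.End.mul_eq_comp, Module.End.mul_eq_comp, g₁.symm_comp, g₂.symm_comp]; exact hone))
  have hg : ∀ u, g u = i (g₁ (j' u)) + i' (g₂ (j u)) := fun u => rfl
  have hj : ∀ u, j (g u) = g₂ (j u) := fun u => by
    rw [hg, map_add, h.ji, h.ji', zero_add]
  have hj' : ∀ u, j' (g u) = g₁ (j' u) := fun u => by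
    rw [hg, map_add, h.j'i, h.j'i', add_zero]
  refine ⟨g, fun ρ u => ?_, fun v => ?_, fun v => ?_, hj, hj', fun A₁ A₂ => ?_⟩
  · rw [h.mem_iff, h.mem_iff, hj, hj', h₁ ρ, h₂ ρ]
  · rw [hg, h.j'i, h.ji, map_zero, map_zero, add_zero]
  · rw [hg, h.j'i', h.ji', map_zero, map_zero, zero_add]
  · exact (congrArg (· * _) (hmul _ _ _ _)).trans (hmul _ _ _ _)

/-- The unipotent element of `𝔾(U)` attached to a graded linear map `V' → V`. -/
theorem exists_unipotent {X : V' →ₗ[ℂ] V} (hX : ∀ ρ, ∀ v ∈ 𝒱' ρ, X v ∈ 𝒱 ρ) :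
    ∃ g ∈ unipotent 𝒰 i j, ∀ u, g u = u + i (X (j u)) := by
  let n : Module.End ℂ U := i ∘ₗ X ∘ₗ j
  have hn : n * n = 0 := by
    ext u
    simp [n, h.ji]
  let g : U ≃ₗ[ℂ] U := LinearEquiv.ofLinearMap (1 + n) (1 - n)
    (show (1 + n) * (1 - n) = 1 by
      rw [mul_sub, mul_one, add_mul, hn, one_mul, add_zero, add_sub_cancel_right])
    (show (1 - n) * (1 + n) = 1 by
      rw [mul_add, mul_one, sub_mul, hn, one_mul, sub_zero, sub_add_cancel])
  have hg : ∀ u, g u = u + i (X (j u)) := fun u => rfl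
  refine ⟨g, ⟨fun ρ u => ?_, ?_, ?_⟩, hg⟩
  · rw [h.mem_iff, h.mem_iff, hg, map_add, map_add, h.ji, h.j'i, add_zero]
    refine and_congr_left fun hu => ?_
    rw [Submodule.add_mem_iff_left _ (hX _ _ hu)]
  · ext v
    simp [hg, h.ji]
  · ext u
    simp [hg, h.ji]

end IsGradedSplitting

end Splitting

/-! ### Translates by groups of automorphisms and closures -/

section Translates

variable {U : Type*} [AddCommGroup U] [Module ℂ U]

theorem conj_mem_zariskiClosure {g : U ≃ₗ[ℂ] U} {S S' : Set (Module.End ℂ U × Module.End ℂ U)}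
    (h : ∀ x ∈ S, (g.conj x.1, g.conj x.2) ∈ zariskiClosure S')
    {x : Module.End ℂ U × Module.End ℂ U} (hx : x ∈ zariskiClosure S) :
    (g.conj x.1, g.conj x.2) ∈ zariskiClosure S' :=
  ((g.conj : Module.End ℂ U →ₗ[ℂ] Module.End ℂ U).prodMap
    (g.conj : Module.End ℂ U →ₗ[ℂ] Module.End ℂ U)).isPolyMap.map_mem_zariskiClosure h hx

variable (H : Subgroup (U ≃ₗ[ℂ] U)) {S S' : Set (Module.End ℂ U × Module.End ℂ U)}

theorem subset_conjTranslates : S ⊆ conjTranslates H S := fun x hx => ⟨1, H.one_mem, x, hx, rfl⟩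

theorem conj_mem_conjTranslates {g : U ≃ₗ[ℂ] U} (hg : g ∈ H)
    {x : Module.End ℂ U × Module.End ℂ U} (hx : x ∈ conjTranslates H S) :
    (g.conj x.1, g.conj x.2) ∈ conjTranslates H S := by
  obtain ⟨k, hk, y, hy, rfl⟩ := hx
  exact ⟨g * k, H.mul_mem hg hk, y, hy, rfl⟩

theorem zariskiClosure_conjTranslates_subset_iff :
    zariskiClosure (conjTranslates H S) ⊆ zariskiClosure (conjTranslates H S') ↔
      S ⊆ zariskiClosure (conjTranslates H S') := by
  refine ⟨fun h => (subset_conjTranslates H).trans ((subset_zariskiClosure _).trans h), fun h => ?_⟩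
  rw [zariskiClosure_subset_iff]
  rintro _ ⟨g, hg, x, hx, rfl⟩
  exact conj_mem_zariskiClosure
    (fun y hy => subset_zariskiClosure _ (conj_mem_conjTranslates H hg hy)) (h hx)

theorem conjTranslates_mono_left {H₁ H₂ : Set (U ≃ₗ[ℂ] U)} (h : H₁ ⊆ H₂) :
    conjTranslates H₁ S ⊆ conjTranslates H₂ S := by
  rintro _ ⟨g, hg, x, hx, rfl⟩
  exact ⟨g, h hg, x, hx, rfl⟩

theorem conj_symm_conj (g : U ≃ₗ[ℂ] U) (A : Module.End ℂ U) : g.conj (g.symm.conj A) = A := by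
  ext u
  simp

theorem conj_mul_eq (g : U ≃ₗ[ℂ] U) (A B : Module.End ℂ U) :
    g.conj (A * B) = g.conj A * g.conj B := LinearEquiv.conj_comp g B A

theorem conj_eq_of_intertwining {g : U ≃ₗ[ℂ] U} {A A' : Module.End ℂ U}
    (h : ∀ u, g (A u) = A' (g u)) : g.conj A = A' := by
  ext u
  rw [LinearEquiv.conj_apply_apply, h, g.apply_symm_apply]

end Translates

section Component

variable {R : Type*} (s : Equiv.Perm R) {U : Type*} [AddCommGroup U] [Module ℂ U]
  (𝒰 : R → Submodule ℂ U)

/-- The space of endomorphisms of degree `-1` that commute with `A`. -/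
def commLeft (A : Module.End ℂ U) : Submodule ℂ (Module.End ℂ U) where
  carrier := {B | B ∈ endLeft s 𝒰 ∧ A * B = B * A}
  add_mem' {B B'} hB hB' := ⟨fun ρ v hv => add_mem (hB.1 ρ v hv) (hB'.1 ρ v hv), by
    rw [mul_add, add_mul, hB.2, hB'.2]⟩
  zero_mem' := ⟨fun _ _ _ => zero_mem _, by rw [mul_zero, zero_mul]⟩
  smul_mem' c B hB := ⟨fun ρ v hv => Submodule.smul_mem _ c (hB.1 ρ v hv), by
    rw [mul_smul_comm, smul_mul_assoc, hB.2]⟩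

variable {s 𝒰}

/-- `ℭ°_m` consists of the translates of the slice over any member of `𝒪_m`. -/
theorem openComponent_eq_conjTranslates (h𝒰 : iSupIndep 𝒰) {m : Multisegment s}
    {A : Module.End ℂ U} (hA : A ∈ gradedOrbit 𝒰 m) :
    openComponent 𝒰 m =
      conjTranslates (gradedAut 𝒰) ({A} ×ˢ (commLeft s 𝒰 A : Set (Module.End ℂ U))) := by
  ext x
  constructor
  · intro hx
    obtain ⟨g, hg, hgA⟩ := exists_conj_eq_of_mem_gradedOrbit h𝒰 hA hx.2
    refine ⟨g, hg, (A, g.symm.conj x.2), ⟨rfl, ?_⟩, ?_⟩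
    · have := conj_mem_commutingVariety ((gradedAut 𝒰).inv_mem hg) hx.1
      refine ⟨this.2.1, ?_⟩
      have h2 := this.2.2
      rw [← hgA] at h2
      change g.symm.conj (g.conj A) * g.symm.conj x.2 =
        g.symm.conj x.2 * g.symm.conj (g.conj A) at h2
      rwa [show g.symm.conj (g.conj A) = A from conj_symm_conj g.symm A] at h2
    · rw [conj_symm_conj, hgA]
  · rintro ⟨g, hg, y, ⟨hy, hy'⟩, rfl⟩
    obtain rfl : y.1 = A := hy
    exact conj_mem_openComponent hg ⟨⟨hA.1, hy'.1, hy'.2⟩, hA⟩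

theorem conj_mem_irredComponent {g : U ≃ₗ[ℂ] U} (hg : g ∈ gradedAut 𝒰) {m : Multisegment s}
    {x : Module.End ℂ U × Module.End ℂ U} (hx : x ∈ irredComponent 𝒰 m) :
    (g.conj x.1, g.conj x.2) ∈ irredComponent 𝒰 m :=
  conj_mem_zariskiClosure (fun _ hy => subset_zariskiClosure _ (conj_mem_openComponent hg hy)) hx

end Component

/-! ### The parabolic subgroup -/

section Parabolic

variable {R : Type*} {s : Equiv.Perm R}
  {V V' U : Type*} [AddCommGroup V] [Module ℂ V] [AddCommGroup V'] [Module ℂ V']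
  [AddCommGroup U] [Module ℂ U]

/-- `ℙ^i` as a subgroup. -/
def parabolicSubgroup (𝒰 : R → Submodule ℂ U) (i : V →ₗ[ℂ] U) : Subgroup (U ≃ₗ[ℂ] U) where
  carrier := parabolic 𝒰 i
  one_mem' := ⟨one_mem _, Submodule.map_id _⟩
  mul_mem' {g k} hg hk := ⟨mul_mem hg.1 hk.1, by
    have := Submodule.map_comp (k : U →ₗ[ℂ] U) (g : U →ₗ[ℂ] U) (LinearMap.range i)
    rw [hk.2, hg.2] at this
    exact this⟩
  inv_mem' {g} hg := ⟨inv_mem hg.1, by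
    have := Submodule.map_comp (g : U →ₗ[ℂ] U) (g.symm : U →ₗ[ℂ] U) (LinearMap.range i)
    rw [hg.2, g.symm_comp, Submodule.map_id] at this
    exact this.symm⟩

theorem parabolicSubgroup_le (𝒰 : R → Submodule ℂ U) (i : V →ₗ[ℂ] U) :
    parabolicSubgroup 𝒰 i ≤ gradedAut 𝒰 := fun _ hg => hg.1

variable {𝒱 : R → Submodule ℂ V} {𝒱' : R → Submodule ℂ V'} {𝒰 : R → Submodule ℂ U}
  {i : V →ₗ[ℂ] U} {j : U →ₗ[ℂ] V'} {i' : V' →ₗ[ℂ] U} {j' : U →ₗ[ℂ] V}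

namespace IsGradedSplitting

variable (h : IsGradedSplitting 𝒱 𝒱' 𝒰 i j i' j')

include h

theorem eq_of_j_eq_zero {u : U} (hu : j u = 0) : i (j' u) = u := by
  have := h.sum u
  rwa [hu, map_zero, add_zero] at this

theorem mem_parabolic_iff [FiniteDimensional ℂ V] [FiniteDimensional ℂ U] {g : U ≃ₗ[ℂ] U} :
    g ∈ parabolicSubgroup 𝒰 i ↔ g ∈ gradedAut 𝒰 ∧ ∀ v, j (g (i v)) = 0 := by
  refine and_congr_right fun _ => ⟨fun hg v => ?_, fun hg => ?_⟩
  · obtain ⟨w, hw⟩ := hg.le (Submodule.mem_map_of_mem ⟨v, rfl⟩)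
    exact (congrArg j hw.symm).trans (h.ji w)
  · refine Submodule.eq_of_le_of_finrank_eq ?_ (LinearEquiv.finrank_map_eq g _)
    rintro _ ⟨_, ⟨v, rfl⟩, rfl⟩
    exact ⟨j' (g (i v)), h.eq_of_j_eq_zero (hg v)⟩

/-- An element of the parabolic subgroup induces automorphisms of `V` and `V'`. -/
theorem exists_induced [FiniteDimensional ℂ V] [FiniteDimensional ℂ U] {g : U ≃ₗ[ℂ] U}
    (hg : g ∈ parabolicSubgroup 𝒰 i) : ∃ g₁ ∈ gradedAut 𝒱, ∃ g₂ ∈ gradedAut 𝒱',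
      (∀ v, g (i v) = i (g₁ v)) ∧ ∀ u, j (g u) = g₂ (j u) := by
  have hs : g.symm ∈ parabolicSubgroup 𝒰 i := (parabolicSubgroup 𝒰 i).inv_mem hg
  have key : ∀ k : U ≃ₗ[ℂ] U, k ∈ parabolicSubgroup 𝒰 i →
      (∀ v, k (i v) = i (j' (k (i v)))) ∧ ∀ u, j (k u) = j (k (i' (j u))) := fun k hk => by
    have hk' := (h.mem_parabolic_iff.1 hk).2
    refine ⟨fun v => (h.eq_of_j_eq_zero (hk' v)).symm, fun u => ?_⟩
    conv_lhs => rw [← h.sum u, map_add, map_add, hk', zero_add]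
  obtain ⟨k1, k2⟩ := key _ hg
  obtain ⟨l1, l2⟩ := key _ hs
  let g₁ : V ≃ₗ[ℂ] V := LinearEquiv.ofLinearMap (j' ∘ₗ g ∘ₗ i) (j' ∘ₗ g.symm ∘ₗ i)
    (LinearMap.ext fun v => by
      change j' (g (i (j' (g.symm (i v))))) = v
      rw [← l1, g.apply_symm_apply, h.j'i])
    (LinearMap.ext fun v => by
      change j' (g.symm (i (j' (g (i v))))) = v
      rw [← k1, g.symm_apply_apply, h.j'i])
  let g₂ : V' ≃ₗ[ℂ] V' := LinearEquiv.ofLinearMap (j ∘ₗ g ∘ₗ i') (j ∘ₗ g.symm ∘ₗ i')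
    (LinearMap.ext fun v => by
      change j (g (i' (j (g.symm (i' v))))) = v
      rw [← k2, g.apply_symm_apply, h.ji'])
    (LinearMap.ext fun v => by
      change j (g.symm (i' (j (g (i' v))))) = v
      rw [← l2, g.symm_apply_apply, h.ji'])
  have hgr := hg.1
  have hsr := hs.1
  refine ⟨g₁, fun ρ v => ⟨fun hv => ?_, fun hv => ?_⟩, g₂, fun ρ v => ⟨fun hv => ?_, fun hv => ?_⟩,
    k1, k2⟩
  · have := h.j'_mem ((hsr ρ _).2 (h.i_mem hv))
    rwa [show j' (g.symm (i (g₁ v))) = v from g₁.symm_apply_apply v] at this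
  · exact h.j'_mem ((hgr ρ _).2 (h.i_mem hv))
  · have := h.j_mem ((hsr ρ _).2 (h.i'_mem hv))
    rwa [show j (g.symm (i' (g₂ v))) = v from g₂.symm_apply_apply v] at this
  · exact h.j_mem ((hgr ρ _).2 (h.i'_mem hv))

theorem unipotent_subset_parabolic [FiniteDimensional ℂ V] [FiniteDimensional ℂ U] :
    unipotent 𝒰 i j ⊆ parabolicSubgroup 𝒰 i := fun _ hg =>
  h.mem_parabolic_iff.2 ⟨hg.1, fun v => by
    have := LinearMap.congr_fun hg.2.1 v
    exact (congrArg j this).trans (h.ji v)⟩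

/-- The Levi decomposition of the parabolic subgroup. -/
theorem exists_unipotent_mul_levi [FiniteDimensional ℂ V] [FiniteDimensional ℂ V']
    [FiniteDimensional ℂ U] {g : U ≃ₗ[ℂ] U} (hg : g ∈ parabolicSubgroup 𝒰 i) :
    ∃ u ∈ unipotent 𝒰 i j, ∃ l ∈ parabolicSubgroup 𝒰 i, l ∈ parabolicSubgroup 𝒰 i' ∧
      g = u * l := by
  obtain ⟨g₁, h₁, g₂, h₂, hgi, hgj⟩ := h.exists_induced hg
  obtain ⟨l, hl, hli, hli', hlj, hlj', -⟩ := h.exists_levi h₁ h₂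
  refine ⟨g * l⁻¹, ⟨mul_mem hg.1 (inv_mem hl), ?_, ?_⟩, l, h.mem_parabolic_iff.2
    ⟨hl, fun v => by rw [hli, h.ji]⟩, h.symm.mem_parabolic_iff.2
    ⟨hl, fun v => by rw [hli', h.j'i']⟩, by rw [inv_mul_cancel_right]⟩
  · ext v
    change g (l.symm (i v)) = i v
    have : l.symm (i v) = i (g₁.symm v) := by
      rw [LinearEquiv.symm_apply_eq, hli, g₁.apply_symm_apply]
    rw [this, hgi, g₁.apply_symm_apply]
  · ext u
    change j (g (l.symm u)) = j u
    rw [hgj, ← hlj, l.apply_symm_apply]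

end IsGradedSplitting

end Parabolic

/-! ### The structure of `𝔜` -/

section VarY

/-- By rank and nullity, the bounds `h₁` on the kernel and `h₂` on the image must both be
attained. -/
theorem map_le_map_of_finrank_le {P Q : Type*} [AddCommGroup P] [Module ℂ P]
    [FiniteDimensional ℂ P] [AddCommGroup Q] [Module ℂ Q] (f : P →ₗ[ℂ] Q) {K K' : Submodule ℂ P}
    (h₁ : K' ⊓ LinearMap.ker f ≤ K) (h₂ : K'.map f ≤ K.map f)
    (h₃ : Module.finrank ℂ K ≤ Module.finrank ℂ K') : K.map f ≤ K'.map f := by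
  have rank : ∀ N : Submodule ℂ P, Module.finrank ℂ (N.map f) +
      Module.finrank ℂ (N ⊓ LinearMap.ker f : Submodule ℂ P) = Module.finrank ℂ N := fun N => by
    rw [← LinearMap.finrank_range_add_finrank_ker (f.domRestrict N), LinearMap.range_domRestrict,
      LinearMap.ker_domRestrict, ← Submodule.map_comap_subtype, Submodule.finrank_map_subtype_eq]
  have h4 := Submodule.finrank_mono (le_inf h₁ inf_le_right)
  refine (Submodule.eq_of_le_of_finrank_le h₂ ?_).ge
  have h5 := rank K
  have h6 := rank K'
  omega

variable {R : Type*} {s : Equiv.Perm R}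
  {V V' U : Type*} [AddCommGroup V] [Module ℂ V] [AddCommGroup V'] [Module ℂ V']
  [AddCommGroup U] [Module ℂ U]

/-- The map `X ↦ (N X - X A₂, X mod H)` on `Hom(V', U)`. If `H` consists of the graded maps, then
its kernel consists of the graded maps intertwining `A₂` and `N`. -/
def intertwiningDefect (A₂ : Module.End ℂ V') (H : Submodule ℂ (V' →ₗ[ℂ] U)) (N : Module.End ℂ U) :
    (V' →ₗ[ℂ] U) →ₗ[ℂ] (V' →ₗ[ℂ] U) × ((V' →ₗ[ℂ] U) ⧸ H) :=
  (LinearMap.llcomp ℂ V' U U N - LinearMap.lcomp ℂ U A₂).prod H.mkQ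

theorem mem_ker_intertwiningDefect {A₂ : Module.End ℂ V'} {H : Submodule ℂ (V' →ₗ[ℂ] U)}
    {N : Module.End ℂ U} {X : V' →ₗ[ℂ] U} :
    X ∈ LinearMap.ker (intertwiningDefect A₂ H N) ↔ (∀ v, N (X v) = X (A₂ v)) ∧ X ∈ H := by
  refine Prod.mk_eq_zero.trans (and_congr ?_ (Submodule.Quotient.mk_eq_zero H))
  refine sub_eq_zero.trans LinearMap.ext_iff

theorem isPolyMap_intertwiningDefect (A₂ : Module.End ℂ V') (H : Submodule ℂ (V' →ₗ[ℂ] U)) :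
    IsPolyMap fun x : Module.End ℂ U × Module.End ℂ U => intertwiningDefect A₂ H x.1 := by
  let T : Module.End ℂ U × Module.End ℂ U →ₗ[ℂ]
      (V' →ₗ[ℂ] U) →ₗ[ℂ] (V' →ₗ[ℂ] U) × ((V' →ₗ[ℂ] U) ⧸ H) :=
    LinearMap.llcomp ℂ _ _ _ (LinearMap.inl ℂ (V' →ₗ[ℂ] U) ((V' →ₗ[ℂ] U) ⧸ H)) ∘ₗ
      LinearMap.llcomp ℂ V' U U ∘ₗ LinearMap.fst ℂ _ _
  have : (fun x : Module.End ℂ U × Module.End ℂ U => intertwiningDefect A₂ H x.1) =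
      fun x => T x + intertwiningDefect A₂ H 0 := by
    funext x
    ext1 X
    simp [T, intertwiningDefect, sub_eq_add_neg]
  rw [this]
  exact T.isPolyMap.add (isPolyMap_const _)

/-- The space of endomorphisms `B` whose block from `V` to `V'` vanishes. -/
def blockZero (i : V →ₗ[ℂ] U) (j : U →ₗ[ℂ] V') : Submodule ℂ (Module.End ℂ U) where
  carrier := {B | ∀ v, j (B (i v)) = 0}
  add_mem' hB hB' v := by
    rw [LinearMap.add_apply, map_add, hB, hB', add_zero]
  zero_mem' _ := map_zero j
  smul_mem' c B hB v := by
    rw [LinearMap.smul_apply, map_smul, hB, smul_zero]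

variable {𝒱 : R → Submodule ℂ V} {𝒱' : R → Submodule ℂ V'} {𝒰 : R → Submodule ℂ U}
  {i : V →ₗ[ℂ] U} {j : U →ₗ[ℂ] V'} {i' : V' →ₗ[ℂ] U} {j' : U →ₗ[ℂ] V}

theorem RestrictsTo.conj {A : Module.End ℂ U} {A₁ : Module.End ℂ V} {A₂ : Module.End ℂ V'}
    (hA : RestrictsTo i j A A₁ A₂) {g : U ≃ₗ[ℂ] U} {g₁ : V ≃ₗ[ℂ] V} {g₂ : V' ≃ₗ[ℂ] V'}
    (h₁ : ∀ v, g (i v) = i (g₁ v)) (h₂ : ∀ u, j (g u) = g₂ (j u)) :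
    RestrictsTo i j (g.conj A) (g₁.conj A₁) (g₂.conj A₂) := by
  constructor
  · ext v
    change g.conj A (i v) = i (g₁.conj A₁ v)
    obtain ⟨v, rfl⟩ := g₁.surjective v
    rw [← h₁, LinearEquiv.conj_apply_apply, LinearEquiv.conj_apply_apply, g.symm_apply_apply,
      g₁.symm_apply_apply, ← h₁]
    exact congrArg g (LinearMap.congr_fun hA.1 v)
  · ext u
    change j (g.conj A u) = g₂.conj A₂ (j u)
    obtain ⟨u, rfl⟩ := g.surjective u
    rw [h₂, LinearEquiv.conj_apply_apply, LinearEquiv.conj_apply_apply, g.symm_apply_apply,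
      g₂.symm_apply_apply, h₂]
    exact congrArg g₂ (LinearMap.congr_fun hA.2 u)

namespace IsGradedSplitting

variable (h : IsGradedSplitting 𝒱 𝒱' 𝒰 i j i' j')

include h

theorem blockDiag_i (A₁ : Module.End ℂ V) (A₂ : Module.End ℂ V') (v : V) :
    blockDiag i j i' j' A₁ A₂ (i v) = i (A₁ v) := by
  rw [blockDiag_apply, h.j'i, h.ji, map_zero, map_zero, add_zero]

theorem j_blockDiag (A₁ : Module.End ℂ V) (A₂ : Module.End ℂ V') (u : U) :
    j (blockDiag i j i' j' A₁ A₂ u) = A₂ (j u) := by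
  rw [blockDiag_apply, map_add, h.ji, h.ji', zero_add]

theorem blockDiag_i' (A₁ : Module.End ℂ V) (A₂ : Module.End ℂ V') (v : V') :
    blockDiag i j i' j' A₁ A₂ (i' v) = i' (A₂ v) := by
  rw [blockDiag_apply, h.j'i', h.ji', map_zero, map_zero, zero_add]

theorem j'_blockDiag (A₁ : Module.End ℂ V) (A₂ : Module.End ℂ V') (u : U) :
    j' (blockDiag i j i' j' A₁ A₂ u) = A₁ (j' u) := by
  rw [blockDiag_apply, map_add, h.j'i, h.j'i', add_zero]

/-- If an extension `N = x.1` of `A₂` by `A₁` is a degeneration of the direct sum `A = A₁ ⊕ A₂`,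
then it splits. Indeed `dim Hom(A₂, N) ≥ dim Hom(A₂, A)` by semicontinuity, while the kernel and
the image of `Hom(A₂, N) → Hom(A₂, A₂)` are contained in those of the split surjection `Hom(A₂, A)
→ Hom(A₂, A₂)`. So the identity of `V'` lifts to `Hom(A₂, N)`. -/
theorem exists_splitting [FiniteDimensional ℂ V'] [FiniteDimensional ℂ U] (h𝒰 : _root_.iSupIndep 𝒰)
    {m m' : Multisegment s} {A₁ : Module.End ℂ V} {A₂ : Module.End ℂ V'}
    (hA₁ : A₁ ∈ gradedOrbit 𝒱 m) (hA₂ : A₂ ∈ gradedOrbit 𝒱' m')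
    {x : Module.End ℂ U × Module.End ℂ U} (hx : x ∈ irredComponent 𝒰 (m + m'))
    (hx' : RestrictsTo i j x.1 A₁ A₂) :
    ∃ X : V' →ₗ[ℂ] U, (∀ v, x.1 (X v) = X (A₂ v)) ∧ (∀ ρ, ∀ v ∈ 𝒱' ρ, X v ∈ 𝒰 ρ) ∧
      ∀ v, j (X v) = v := by
  let H : Submodule ℂ (V' →ₗ[ℂ] U) :=
    { carrier := {X | ∀ ρ, ∀ v ∈ 𝒱' ρ, X v ∈ 𝒰 ρ}
      add_mem' := fun hX hY ρ v hv => add_mem (hX ρ v hv) (hY ρ v hv)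
      zero_mem' := fun _ _ _ => zero_mem _
      smul_mem' := fun c X hX ρ v hv => Submodule.smul_mem _ c (hX ρ v hv) }
  let A := blockDiag i j i' j' A₁ A₂
  have hA : A ∈ gradedOrbit 𝒰 (m + m') := h.blockDiag_mem_gradedOrbit hA₁ hA₂
  have hfin : Module.finrank ℂ (LinearMap.ker (intertwiningDefect A₂ H A)) ≤
      Module.finrank ℂ (LinearMap.ker (intertwiningDefect A₂ H x.1)) := by
    refine le_finrank_ker_of_mem_zariskiClosure (isPolyMap_intertwiningDefect A₂ H) ?_ hx
    intro y hy
    obtain ⟨g, hg, hgA⟩ := exists_conj_eq_of_mem_gradedOrbit h𝒰 hA hy.2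
    let e : (V' →ₗ[ℂ] U) ≃ₗ[ℂ] (V' →ₗ[ℂ] U) := LinearEquiv.congrRight g
    rw [← LinearEquiv.finrank_map_eq e]
    refine Submodule.finrank_mono ?_
    rintro _ ⟨X, hX, rfl⟩
    obtain ⟨hX, hXH⟩ := mem_ker_intertwiningDefect.1 hX
    refine mem_ker_intertwiningDefect.2 ⟨fun v => ?_, fun ρ v hv => (hg ρ _).2 (hXH ρ v hv)⟩
    change y.1 (g (X v)) = g (X (A₂ v))
    rw [← hgA, LinearEquiv.conj_apply_apply, g.symm_apply_apply, hX]
  have hxi : ∀ v, x.1 (i v) = i (A₁ v) := LinearMap.congr_fun hx'.1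
  have hxj : ∀ u, j (x.1 u) = A₂ (j u) := LinearMap.congr_fun hx'.2
  have hker : ∀ X ∈ LinearMap.ker (intertwiningDefect A₂ H A), ∀ v, A (X v) = X (A₂ v) :=
    fun X hX => (mem_ker_intertwiningDefect.1 hX).1
  have key := map_le_map_of_finrank_le (LinearMap.llcomp ℂ V' U V' j)
    (K := LinearMap.ker (intertwiningDefect A₂ H A))
    (K' := LinearMap.ker (intertwiningDefect A₂ H x.1)) ?_ ?_ hfin
  · have hi' : i' ∈ LinearMap.ker (intertwiningDefect A₂ H A) :=
      mem_ker_intertwiningDefect.2 ⟨fun v => h.blockDiag_i' _ _ v, fun _ _ hv => h.i'_mem hv⟩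
    obtain ⟨X, hX, hX'⟩ := key (Submodule.mem_map_of_mem hi')
    obtain ⟨hX1, hX2⟩ := mem_ker_intertwiningDefect.1 hX
    exact ⟨X, hX1, hX2, fun v => (LinearMap.congr_fun hX' v).trans (h.ji' v)⟩
  · rintro X ⟨hX, hX0⟩
    obtain ⟨hX1, hX2⟩ := mem_ker_intertwiningDefect.1 hX
    refine mem_ker_intertwiningDefect.2 ⟨fun v => ?_, hX2⟩
    have h0 : j (X v) = 0 := LinearMap.congr_fun hX0 v
    rw [← hX1, ← h.eq_of_j_eq_zero h0, hxi]
    exact h.blockDiag_i _ _ _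
  · rintro _ ⟨X, hX, rfl⟩
    obtain ⟨hX1, hX2⟩ := mem_ker_intertwiningDefect.1 hX
    refine ⟨i' ∘ₗ j ∘ₗ X, mem_ker_intertwiningDefect.2 ⟨fun v => ?_, fun ρ v hv =>
      h.i'_mem (h.j_mem (hX2 ρ v hv))⟩, LinearMap.ext fun v => h.ji' _⟩
    refine (h.blockDiag_i' _ _ _).trans ?_
    change i' (A₂ (j (X v))) = i' (j (X (A₂ v)))
    rw [← hX1, hxj]

/-- The block on `V` of an endomorphism commuting with `A₁ ⊕ A₂` commutes with `A₁`. -/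
theorem compress_mem_commLeft {A₁ : Module.End ℂ V}
    {A₂ : Module.End ℂ V'} {B : Module.End ℂ U}
    (hB : B ∈ commLeft s 𝒰 (blockDiag i j i' j' A₁ A₂)) : j' ∘ₗ B ∘ₗ i ∈ commLeft s 𝒱 A₁ := by
  refine ⟨fun ρ v hv => h.j'_mem (hB.1 ρ _ (h.i_mem hv)), ?_⟩
  ext v
  change A₁ (j' (B (i v))) = j' (B (i (A₁ v)))
  rw [← h.blockDiag_i A₁ A₂ v, ← h.j'_blockDiag A₁ A₂]
  exact congrArg j' (LinearMap.congr_fun hB.2 (i v))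

/-- The set whose closure is `𝔜` is the orbit of a linear slice under the parabolic subgroup. -/
theorem irredComponent_inter_pPreimage [FiniteDimensional ℂ V] [FiniteDimensional ℂ V']
    [FiniteDimensional ℂ U] (h𝒱 : _root_.iSupIndep 𝒱) (h𝒱' : _root_.iSupIndep 𝒱')
    {m m' : Multisegment s} {A₁ : Module.End ℂ V} {A₂ : Module.End ℂ V'}
    (hA₁ : A₁ ∈ gradedOrbit 𝒱 m) (hA₂ : A₂ ∈ gradedOrbit 𝒱' m') :
    irredComponent 𝒰 (m + m') ∩ pPreimage s 𝒰 i j (openComponent 𝒱 m) (openComponent 𝒱' m') =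
      conjTranslates (parabolicSubgroup 𝒰 i) ({blockDiag i j i' j' A₁ A₂} ×ˢ
        (commLeft s 𝒰 (blockDiag i j i' j' A₁ A₂) ⊓ blockZero i j :
          Submodule ℂ (Module.End ℂ U))) := by
  have h𝒰 := h.iSupIndep h𝒱 h𝒱'
  ext x
  constructor
  · rintro ⟨hx, hxs, y, hy, y', hy', hr, hr'⟩
    obtain ⟨g₁, hg₁, hgA₁⟩ := exists_conj_eq_of_mem_gradedOrbit h𝒱 hA₁ hy.2
    obtain ⟨g₂, hg₂, hgA₂⟩ := exists_conj_eq_of_mem_gradedOrbit h𝒱' hA₂ hy'.2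
    obtain ⟨l, hl, hli, -, hlj, -⟩ := h.exists_levi hg₁ hg₂
    have hl' : l ∈ parabolicSubgroup 𝒰 i := h.mem_parabolic_iff.2 ⟨hl, fun v => by rw [hli, h.ji]⟩
    have hlsi : ∀ v, l.symm (i v) = i (g₁.symm v) := fun v => by
      rw [LinearEquiv.symm_apply_eq, hli, g₁.apply_symm_apply]
    have hlsj : ∀ u, j (l.symm u) = g₂.symm (j u) := fun u => by
      rw [LinearEquiv.eq_symm_apply, ← hlj, l.apply_symm_apply]
    -- After the translation by the Levi element `l⁻¹`, the first component is an extension of `A₂`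
    -- by `A₁`; a splitting of it provides the unipotent element `u`.
    have hls := (gradedAut 𝒰).inv_mem hl
    have hres := hr.conj hlsi hlsj
    rw [← hgA₁, ← hgA₂, show g₁.symm.conj (g₁.conj A₁) = A₁ from conj_symm_conj g₁.symm A₁,
      show g₂.symm.conj (g₂.conj A₂) = A₂ from conj_symm_conj g₂.symm A₂] at hres
    have hxl : (l.symm.conj x.1, l.symm.conj x.2) ∈ irredComponent 𝒰 (m + m') :=
      conj_mem_irredComponent hls hx
    obtain ⟨X, hX1, hX2, hX3⟩ := h.exists_splitting h𝒰 hA₁ hA₂ hxl hres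
    have hXg : ∀ ρ, ∀ v ∈ 𝒱' ρ, (j' ∘ₗ X) v ∈ 𝒱 ρ := fun ρ v hv => h.j'_mem (hX2 ρ v hv)
    obtain ⟨u, hu, hu'⟩ := h.exists_unipotent hXg
    have hup := h.unipotent_subset_parabolic hu
    have hui : ∀ v, u (i v) = i v := LinearMap.congr_fun hu.2.1
    have hui' : ∀ v, u (i' v) = X v := fun v => by
      rw [hu', h.ji', add_comm]
      conv_rhs => rw [← h.sum (X v), hX3]
      rfl
    have huA : u.conj (blockDiag i j i' j' A₁ A₂) = l.symm.conj x.1 := by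
      refine conj_eq_of_intertwining fun w => ?_
      rw [← h.sum w, map_add, map_add, map_add, map_add, h.blockDiag_i, h.blockDiag_i', hui, hui,
        hui', hui', ← hX1]
      exact congrArg (· + _) (LinearMap.congr_fun hres.1 (j' w)).symm
    have hfst : (l * u).conj (blockDiag i j i' j' A₁ A₂) = x.1 := by
      change l.conj (u.conj _) = _
      rw [huA, conj_symm_conj]
    have hsnd : (l * u).conj ((l * u).symm.conj x.2) = x.2 := conj_symm_conj _ _
    have hp : l * u ∈ parabolicSubgroup 𝒰 i := mul_mem hl' hup
    refine ⟨l * u, hp, (_, (l * u).symm.conj x.2), ⟨rfl, ⟨?_, ?_⟩, fun v => ?_⟩, ?_⟩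
    · exact (conj_mem_commutingVariety ((gradedAut 𝒰).inv_mem hp.1) hxs.1).2.1
    · apply (l * u).conj.injective
      rw [conj_mul_eq, conj_mul_eq, hfst, hsnd]
      exact hxs.1.2.2
    · obtain ⟨q₁, -, q₂, -, hq₁, hq₂⟩ := h.exists_induced ((parabolicSubgroup 𝒰 i).inv_mem hp)
      have := (hr'.conj hq₁ hq₂).1
      exact (congrArg j (LinearMap.congr_fun this v)).trans (h.ji _)
    · exact Prod.ext hfst.symm hsnd.symm
  · rintro ⟨g, hg, ⟨_, B⟩, ⟨rfl, hB, hB'⟩, rfl⟩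
    obtain ⟨g₁, hg₁, g₂, hg₂, hgi, hgj⟩ := h.exists_induced hg
    have hA := h.blockDiag_mem_gradedOrbit hA₁ hA₂
    have hAB : (blockDiag i j i' j' A₁ A₂, B) ∈ openComponent 𝒰 (m + m') :=
      ⟨⟨hA.1, hB.1, hB.2⟩, hA⟩
    have hgAB := conj_mem_openComponent hg.1 hAB
    have hr₁ : RestrictsTo i j (blockDiag i j i' j' A₁ A₂) A₁ A₂ :=
      ⟨LinearMap.ext (h.blockDiag_i A₁ A₂), LinearMap.ext (h.j_blockDiag A₁ A₂)⟩
    have hr₂ : RestrictsTo i j B (j' ∘ₗ B ∘ₗ i) (j ∘ₗ B ∘ₗ i') :=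
      ⟨LinearMap.ext fun v => (h.eq_of_j_eq_zero (hB' v)).symm, LinearMap.ext fun u => by
        change j (B u) = j (B (i' (j u)))
        conv_lhs => rw [← h.sum u, map_add, map_add, hB', zero_add]⟩
    have hz : ∀ {N N₁ N₂}, RestrictsTo i j N N₁ N₂ → j ∘ₗ N ∘ₗ i = 0 := fun hN => by
      rw [hN.1]
      exact LinearMap.ext fun v => h.ji _
    have h1 : (A₁, j' ∘ₗ B ∘ₗ i) ∈ openComponent 𝒱 m :=
      ⟨⟨hA₁.1, h.compress_mem_commLeft hB⟩, hA₁⟩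
    have h2 : (A₂, j ∘ₗ B ∘ₗ i') ∈ openComponent 𝒱' m' :=
      ⟨⟨hA₂.1, h.symm.compress_mem_commLeft (A₂ := A₁) (by rwa [blockDiag_swap])⟩, hA₂⟩
    have hq₁ := hr₁.conj hgi hgj
    have hq₂ := hr₂.conj hgi hgj
    exact ⟨subset_zariskiClosure _ hgAB, ⟨hgAB.1, hz hq₁, hz hq₂⟩, _,
      conj_mem_openComponent hg₁ h1, _, conj_mem_openComponent hg₂ h2, hq₁, hq₂⟩

end IsGradedSplitting

end VarY

/-! ### Density of the slices and surjectivity of a commutator map -/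

section Stabilizer

variable {U : Type*} [AddCommGroup U] [Module ℂ U] {κ : Type*}

/-- The algebra of endomorphisms that stabilize all members of a family of subspaces. -/
def stabEnd (𝒩 : κ → Submodule ℂ U) : Subalgebra ℂ (Module.End ℂ U) where
  carrier := {X | ∀ k, ∀ v ∈ 𝒩 k, X v ∈ 𝒩 k}
  mul_mem' hX hY k v hv := hX k _ (hY k v hv)
  add_mem' hX hY k v hv := add_mem (hX k v hv) (hY k v hv)
  algebraMap_mem' c _ _ hv := Submodule.smul_mem _ c hv

/-- Translation of the action of automorphisms into conjugation by units of an algebra. -/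
theorem conjTranslates_eq_unitConjugates {H : Set (U ≃ₗ[ℂ] U)}
    {𝔨 : Subalgebra ℂ (Module.End ℂ U)} (hH : ∀ g, g ∈ H ↔ (g : Module.End ℂ U) ∈ 𝔨)
    (S : Set (Module.End ℂ U × Module.End ℂ U)) : conjTranslates H S = unitConjugates 𝔨 S := by
  ext y
  constructor
  · rintro ⟨g, hg, x, hx, rfl⟩
    exact ⟨LinearMap.GeneralLinearGroup.ofLinearEquiv g, (hH g).1 hg, x, hx, rfl⟩
  · rintro ⟨g, hg, x, hx, rfl⟩
    exact ⟨LinearMap.GeneralLinearGroup.toLinearEquiv g, (hH _).2 hg, x, hx, rfl⟩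

theorem mem_gradedAut_iff [FiniteDimensional ℂ U] {𝒰 : κ → Submodule ℂ U} {g : U ≃ₗ[ℂ] U} :
    g ∈ gradedAut 𝒰 ↔ (g : Module.End ℂ U) ∈ stabEnd 𝒰 := by
  refine ⟨fun hg ρ v hv => (hg ρ v).2 hv, fun hg ρ v => ⟨fun hv => ?_, hg ρ v⟩⟩
  have := (stabEnd 𝒰).inv_mem_of_finiteDimensional
    (LinearMap.GeneralLinearGroup.ofLinearEquiv g) hg ρ _ hv
  rwa [show ((LinearMap.GeneralLinearGroup.ofLinearEquiv g)⁻¹ : (Module.End ℂ U)ˣ).val (g v) = v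
    from g.symm_apply_apply v] at this

end Stabilizer

section Slices

variable {R : Type*} {s : Equiv.Perm R}
  {V V' U : Type*} [AddCommGroup V] [Module ℂ V] [AddCommGroup V'] [Module ℂ V']
  [AddCommGroup U] [Module ℂ U]
  {𝒱 : R → Submodule ℂ V} {𝒱' : R → Submodule ℂ V'} {𝒰 : R → Submodule ℂ U}
  {i : V →ₗ[ℂ] U} {j : U →ₗ[ℂ] V'} {i' : V' →ₗ[ℂ] U} {j' : U →ₗ[ℂ] V}

theorem mul_mem_commLeft {A X B : Module.End ℂ U} (hX : X ∈ stabEnd 𝒰) (hXA : X * A = A * X)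
    (hB : B ∈ commLeft s 𝒰 A) : X * B ∈ commLeft s 𝒰 A :=
  ⟨fun ρ v hv => hX _ _ (hB.1 ρ v hv), by
    rw [← mul_assoc, ← hXA, mul_assoc, hB.2, mul_assoc]⟩

theorem commLeft_mul_mem {A X B : Module.End ℂ U} (hX : X ∈ stabEnd 𝒰) (hXA : X * A = A * X)
    (hB : B ∈ commLeft s 𝒰 A) : B * X ∈ commLeft s 𝒰 A :=
  ⟨fun ρ v hv => hB.1 ρ _ (hX _ _ hv), by
    rw [← mul_assoc, hB.2, mul_assoc, ← hXA, mul_assoc]⟩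

variable (s 𝒱 𝒱') in
/-- The condition to which all the density statements reduce: for some `b₁`, `b₂` of degree `-1`
that commute with `A₁`, `A₂`, the map `X ↦ X b₂ - b₁ X` is surjective from the maps `V' → V` of
degree `0` that intertwine `A₂` and `A₁` onto those of degree `-1`. -/
def CommutatorSurjective (A₁ : Module.End ℂ V) (A₂ : Module.End ℂ V') : Prop :=
  ∃ b₁ ∈ commLeft s 𝒱 A₁, ∃ b₂ ∈ commLeft s 𝒱' A₂, ∀ Y : V' →ₗ[ℂ] V,
    (∀ ρ, ∀ v ∈ 𝒱' ρ, Y v ∈ 𝒱 (s.symm ρ)) → A₁ ∘ₗ Y = Y ∘ₗ A₂ →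
    ∃ X : V' →ₗ[ℂ] V, (∀ ρ, ∀ v ∈ 𝒱' ρ, X v ∈ 𝒱 ρ) ∧ A₁ ∘ₗ X = X ∘ₗ A₂ ∧
      X ∘ₗ b₂ - b₁ ∘ₗ X = Y

namespace IsGradedSplitting

variable (h : IsGradedSplitting 𝒱 𝒱' 𝒰 i j i' j')

include h

theorem mem_parabolicSubgroup_iff_mem_stabEnd [FiniteDimensional ℂ V] [FiniteDimensional ℂ U]
    {g : U ≃ₗ[ℂ] U} :
    g ∈ parabolicSubgroup 𝒰 i ↔
      (g : Module.End ℂ U) ∈ stabEnd 𝒰 ⊓ stabEnd fun _ : Unit => LinearMap.range i := by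
  rw [h.mem_parabolic_iff, mem_gradedAut_iff, Algebra.mem_inf]
  refine and_congr_right fun _ => ⟨fun hg _ v hv => ?_, fun hg v => ?_⟩
  · obtain ⟨v, rfl⟩ := hv
    exact ⟨_, h.eq_of_j_eq_zero (hg v)⟩
  · obtain ⟨w, hw⟩ := hg () (i v) ⟨v, rfl⟩
    exact (congrArg j hw.symm).trans (h.ji w)

/-- A map `Y : V' → V` that intertwines `A₂` and `A₁`, viewed as an endomorphism of `U`, commutes
with `A₁ ⊕ A₂`. -/
theorem offDiag_commutes {A₁ : Module.End ℂ V} {A₂ : Module.End ℂ V'} {Y : V' →ₗ[ℂ] V}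
    (hY : A₁ ∘ₗ Y = Y ∘ₗ A₂) :
    blockDiag i j i' j' A₁ A₂ * (i ∘ₗ Y ∘ₗ j) = (i ∘ₗ Y ∘ₗ j) * blockDiag i j i' j' A₁ A₂ := by
  ext u
  refine (h.blockDiag_i _ _ _).trans ?_
  change i (A₁ (Y (j u))) = i (Y (j (blockDiag i j i' j' A₁ A₂ u)))
  rw [h.j_blockDiag]
  exact congrArg i (LinearMap.congr_fun hY (j u))

theorem blockDiag_mem_commLeft {A₁ b₁ : Module.End ℂ V} {A₂ b₂ : Module.End ℂ V'}
    (h₁ : b₁ ∈ commLeft s 𝒱 A₁) (h₂ : b₂ ∈ commLeft s 𝒱' A₂) :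
    blockDiag i j i' j' b₁ b₂ ∈ commLeft s 𝒰 (blockDiag i j i' j' A₁ A₂) :=
  ⟨h.blockDiag_mem_endLeft h₁.1 h₂.1, by rw [h.blockDiag_mul, h.blockDiag_mul, h₁.2, h₂.2]⟩

/-- The condition `[𝔨^A, b] + F = E`, for `F` the space of those members of `E` whose block from
`V'` to `V` vanishes. Modulo `F` only this block matters. For `b ∈ F` the corresponding block of
`[X, b]` is `X₁₂ b₂ - b₁ X₁₂`, where `X₁₂` is the block of `X` and `b₁`, `b₂` are the diagonal
blocks of `b`. -/
theorem slice_iff_commutatorSurjective {A₁ : Module.End ℂ V} {A₂ : Module.End ℂ V'}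
    {𝔨 : Subalgebra ℂ (Module.End ℂ U)} {E : Submodule ℂ (Module.End ℂ U)}
    (h𝔨 : 𝔨 ≤ stabEnd 𝒰) (hE : E ≤ commLeft s 𝒰 (blockDiag i j i' j' A₁ A₂))
    (hXE : ∀ X ∈ 𝔨, X * blockDiag i j i' j' A₁ A₂ = blockDiag i j i' j' A₁ A₂ * X →
      ∀ B ∈ E, X * B - B * X ∈ E)
    (hdiag : ∀ b₁ ∈ commLeft s 𝒱 A₁, ∀ b₂ ∈ commLeft s 𝒱' A₂, blockDiag i j i' j' b₁ b₂ ∈ E)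
    (hoff : ∀ Y : V' →ₗ[ℂ] V, i ∘ₗ Y ∘ₗ j ∈ commLeft s 𝒰 (blockDiag i j i' j' A₁ A₂) →
      i ∘ₗ Y ∘ₗ j ∈ E)
    (hoff' : ∀ X : V' →ₗ[ℂ] V, i ∘ₗ X ∘ₗ j ∈ stabEnd 𝒰 → i ∘ₗ X ∘ₗ j ∈ 𝔨) :
    (∃ b ∈ E ⊓ blockZero i' j', ∀ e ∈ E, ∃ X ∈ 𝔨,
      X * blockDiag i j i' j' A₁ A₂ = blockDiag i j i' j' A₁ A₂ * X ∧
        X * b - b * X - e ∈ E ⊓ blockZero i' j') ↔ CommutatorSurjective s 𝒱 𝒱' A₁ A₂ := by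
  constructor
  · rintro ⟨b, ⟨hbE, hb⟩, hsurj⟩
    have hbc := hE hbE
    refine ⟨j' ∘ₗ b ∘ₗ i, h.compress_mem_commLeft hbc, j ∘ₗ b ∘ₗ i',
      h.symm.compress_mem_commLeft (by rwa [blockDiag_swap]), fun Y hY hAY => ?_⟩
    obtain ⟨X, hX, hXA, hXb⟩ := hsurj (i ∘ₗ Y ∘ₗ j)
      (hoff Y ⟨fun ρ u hu => h.i_mem (hY ρ _ (h.j_mem hu)), h.offDiag_commutes hAY⟩)
    refine ⟨j' ∘ₗ X ∘ₗ i', fun ρ v hv => h.j'_mem (h𝔨 hX ρ _ (h.i'_mem hv)), ?_, ?_⟩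
    · ext v
      change A₁ (j' (X (i' v))) = j' (X (i' (A₂ v)))
      rw [← h.blockDiag_i' A₁ A₂, ← h.j'_blockDiag A₁ A₂]
      exact congrArg j' (LinearMap.congr_fun hXA (i' v)).symm
    · ext v
      change j' (X (i' (j (b (i' v))))) - j' (b (i (j' (X (i' v))))) = Y v
      have h1 : i' (j (b (i' v))) = b (i' v) := h.symm.eq_of_j_eq_zero (hb v)
      have h2 : j' (b (X (i' v))) = j' (b (i (j' (X (i' v))))) := by
        conv_lhs => rw [← h.sum (X (i' v)), map_add, map_add, hb, add_zero]
      have h3 : j' (X (b (i' v)) - b (X (i' v)) - i (Y (j (i' v)))) = 0 := hXb.2 v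
      rw [map_sub, map_sub, h.j'i, h.ji', sub_eq_zero] at h3
      rw [h1, ← h2, h3]
  · rintro ⟨b₁, hb₁, b₂, hb₂, hsurj⟩
    refine ⟨blockDiag i j i' j' b₁ b₂, ⟨hdiag b₁ hb₁ b₂ hb₂, fun v => ?_⟩, fun e he => ?_⟩
    · rw [h.blockDiag_i', h.j'i']
    have hec := hE he
    obtain ⟨X, hX, hAX, hXY⟩ := hsurj (j' ∘ₗ e ∘ₗ i')
      (fun ρ v hv => h.j'_mem (hec.1 ρ _ (h.i'_mem hv))) (by
        ext v
        change A₁ (j' (e (i' v))) = j' (e (i' (A₂ v)))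
        rw [← h.blockDiag_i' A₁ A₂, ← h.j'_blockDiag A₁ A₂]
        exact congrArg j' (LinearMap.congr_fun hec.2 (i' v)))
    have hX' : i ∘ₗ X ∘ₗ j ∈ 𝔨 := hoff' X fun ρ u hu => h.i_mem (hX ρ _ (h.j_mem hu))
    have hcomm := (h.offDiag_commutes hAX).symm
    refine ⟨i ∘ₗ X ∘ₗ j, hX', hcomm,
      sub_mem (hXE _ hX' hcomm _ (hdiag b₁ hb₁ b₂ hb₂)) he, fun v => ?_⟩
    change j' (i (X (j (blockDiag i j i' j' b₁ b₂ (i' v)))) -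
      blockDiag i j i' j' b₁ b₂ (i (X (j (i' v)))) - e (i' v)) = 0
    rw [map_sub, map_sub, h.j'_blockDiag, h.j'i, h.j'i, h.j_blockDiag, h.ji', sub_eq_zero]
    exact LinearMap.congr_fun hXY v

/-- Density of `𝔾 · (A, E_low)` in `𝔾 · (A, E)`. -/
theorem gradedAut_slice_iff [FiniteDimensional ℂ U] (A₁ : Module.End ℂ V) (A₂ : Module.End ℂ V') :
    (∀ B ∈ commLeft s 𝒰 (blockDiag i j i' j' A₁ A₂), (blockDiag i j i' j' A₁ A₂, B) ∈
      zariskiClosure (conjTranslates (gradedAut 𝒰) ({blockDiag i j i' j' A₁ A₂} ×ˢ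
        (commLeft s 𝒰 (blockDiag i j i' j' A₁ A₂) ⊓ blockZero i' j' :
          Submodule ℂ (Module.End ℂ U))))) ↔ CommutatorSurjective s 𝒱 𝒱' A₁ A₂ := by
  have hE : ∀ X ∈ stabEnd 𝒰, X * blockDiag i j i' j' A₁ A₂ = blockDiag i j i' j' A₁ A₂ * X →
      ∀ B ∈ commLeft s 𝒰 (blockDiag i j i' j' A₁ A₂),
        X * B - B * X ∈ commLeft s 𝒰 (blockDiag i j i' j' A₁ A₂) := fun X hX hXA B hB =>
    sub_mem (mul_mem_commLeft hX hXA hB) (commLeft_mul_mem hX hXA hB)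
  rw [← h.slice_iff_commutatorSurjective le_rfl le_rfl hE
    (fun b₁ hb₁ b₂ hb₂ => h.blockDiag_mem_commLeft hb₁ hb₂) (fun _ => id) (fun _ => id),
    conjTranslates_eq_unitConjugates fun _ => mem_gradedAut_iff]
  refine slice_dense_iff_end _ _ _ _ inf_le_left hE fun g hg hgA B hB => ?_
  exact commLeft_mul_mem ((stabEnd 𝒰).inv_mem_of_finiteDimensional g hg)
    ((Units.inv_mul_eq_iff_eq_mul g).2 (by rw [← mul_assoc, hgA, mul_assoc, g.mul_inv, mul_one]))
    (mul_mem_commLeft hg hgA hB)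

/-- Density of `ℙ^i · (A, E_up ∩ E_low)` in `ℙ^i · (A, E_up)`. -/
theorem parabolic_slice_iff [FiniteDimensional ℂ V] [FiniteDimensional ℂ U]
    (A₁ : Module.End ℂ V) (A₂ : Module.End ℂ V') :
    (∀ B ∈ commLeft s 𝒰 (blockDiag i j i' j' A₁ A₂) ⊓ blockZero i j,
      (blockDiag i j i' j' A₁ A₂, B) ∈
      zariskiClosure (conjTranslates (parabolicSubgroup 𝒰 i) ({blockDiag i j i' j' A₁ A₂} ×ˢ
        (commLeft s 𝒰 (blockDiag i j i' j' A₁ A₂) ⊓ blockZero i j ⊓ blockZero i' j' :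
          Submodule ℂ (Module.End ℂ U))))) ↔ CommutatorSurjective s 𝒱 𝒱' A₁ A₂ := by
  have hmul : ∀ X ∈ stabEnd 𝒰 ⊓ stabEnd fun _ : Unit => LinearMap.range i,
      X * blockDiag i j i' j' A₁ A₂ = blockDiag i j i' j' A₁ A₂ * X →
      ∀ B ∈ commLeft s 𝒰 (blockDiag i j i' j' A₁ A₂) ⊓ blockZero i j,
        X * B ∈ commLeft s 𝒰 (blockDiag i j i' j' A₁ A₂) ⊓ blockZero i j ∧
        B * X ∈ commLeft s 𝒰 (blockDiag i j i' j' A₁ A₂) ⊓ blockZero i j := by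
    intro X hX hXA B hB
    have hi : ∀ {w}, j w = 0 → j (X w) = 0 := fun {w} hw => by
      obtain ⟨v, hv⟩ := hX.2 () w ⟨_, h.eq_of_j_eq_zero hw⟩
      rw [← hv, h.ji]
    refine ⟨⟨mul_mem_commLeft hX.1 hXA hB.1, fun v => hi (hB.2 v)⟩,
      ⟨commLeft_mul_mem hX.1 hXA hB.1, fun v => ?_⟩⟩
    obtain ⟨w, hw⟩ := hX.2 () (i v) ⟨v, rfl⟩
    exact (congrArg (fun u => j (B u)) hw.symm).trans (hB.2 w)
  have hE := fun X hX hXA B hB => sub_mem (hmul X hX hXA B hB).1 (hmul X hX hXA B hB).2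
  rw [← h.slice_iff_commutatorSurjective inf_le_left inf_le_left hE
    (fun b₁ hb₁ b₂ hb₂ => ⟨h.blockDiag_mem_commLeft hb₁ hb₂, fun v => by
      rw [h.blockDiag_i, h.ji]⟩) (fun Y hY => ⟨hY, fun v => h.ji _⟩)
    (fun X hX => ⟨hX, fun _ _ _ => ⟨_, rfl⟩⟩),
    conjTranslates_eq_unitConjugates fun _ => h.mem_parabolicSubgroup_iff_mem_stabEnd]
  refine slice_dense_iff_end _ _ _ _ inf_le_left hE fun g hg hgA B hB => ?_
  exact (hmul _ (Subalgebra.inv_mem_of_finiteDimensional _ g hg)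
    ((Units.inv_mul_eq_iff_eq_mul g).2 (by rw [← mul_assoc, hgA, mul_assoc, g.mul_inv, mul_one])) _
    (hmul _ hg hgA B hB).1).2

end IsGradedSplitting

end Slices

/-! ### The density statements -/

section Density

variable {R : Type*} {s : Equiv.Perm R}
  {V V' U : Type*} [AddCommGroup V] [Module ℂ V] [AddCommGroup V'] [Module ℂ V']
  [AddCommGroup U] [Module ℂ U]
  {𝒱 : R → Submodule ℂ V} {𝒱' : R → Submodule ℂ V'} {𝒰 : R → Submodule ℂ U}
  {i : V →ₗ[ℂ] U} {j : U →ₗ[ℂ] V'} {i' : V' →ₗ[ℂ] U} {j' : U →ₗ[ℂ] V}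

theorem varY_subset_irredComponent (m m' : Multisegment s) :
    varY 𝒱 𝒱' 𝒰 i j m m' ⊆ irredComponent 𝒰 (m + m') :=
  zariskiClosure_subset_iff.2 Set.inter_subset_left

theorem mem_blockZero_of_mem_varY {m m' : Multisegment s} {x : Module.End ℂ U × Module.End ℂ U}
    (hx : x ∈ varY 𝒱 𝒱' 𝒰 i j m m') : x.1 ∈ blockZero i j ∧ x.2 ∈ blockZero i j :=
  ((blockZero i j).prod (blockZero i j)).mem_of_mem_zariskiClosure
    (fun _ hy => ⟨fun v => LinearMap.congr_fun hy.2.1.2.1 v,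
      fun v => LinearMap.congr_fun hy.2.1.2.2 v⟩) hx

namespace IsGradedSplitting

variable (h : IsGradedSplitting 𝒱 𝒱' 𝒰 i j i' j')

include h

/-- On `𝔜`, the pair of diagonal blocks with respect to `V` is in `ℭ_m`. -/
theorem compress_mem_irredComponent {m m' : Multisegment s}
    {x : Module.End ℂ U × Module.End ℂ U} (hx : x ∈ varY 𝒱 𝒱' 𝒰 i j m m') :
    (j' ∘ₗ x.1 ∘ₗ i, j' ∘ₗ x.2 ∘ₗ i) ∈ irredComponent 𝒱 m := by
  let T : Module.End ℂ U →ₗ[ℂ] Module.End ℂ V :=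
    LinearMap.llcomp ℂ V U V j' ∘ₗ LinearMap.lcomp ℂ U i
  refine (T.prodMap T).isPolyMap.map_mem_zariskiClosure (fun y hy => ?_) hx
  obtain ⟨-, -, z, hz, z', -, hr, hr'⟩ := hy
  have key : ∀ {N N₁ N₂}, RestrictsTo i j N N₁ N₂ → j' ∘ₗ N ∘ₗ i = N₁ := fun hN => by
    rw [hN.1]
    exact LinearMap.ext fun v => h.j'i _
  have : (T.prodMap T) y = z := Prod.ext (key hr) (key hr')
  rw [this]
  exact subset_zariskiClosure _ hz

theorem eq_blockDiag {N : Module.End ℂ U} (hN : N ∈ blockZero i j) (hN' : N ∈ blockZero i' j') :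
    blockDiag i j i' j' (j' ∘ₗ N ∘ₗ i) (j ∘ₗ N ∘ₗ i') = N := by
  ext u
  change i (j' (N (i (j' u)))) + i' (j (N (i' (j u)))) = N u
  rw [h.eq_of_j_eq_zero (hN _), h.symm.eq_of_j_eq_zero (hN' _), ← map_add, h.sum]

/-- The product of the unipotent group `𝕌^i` and the opposite parabolic subgroup contains every
graded automorphism whose block on `V'` is invertible. -/
theorem exists_unipotent_mul_opposite [FiniteDimensional ℂ V'] [FiniteDimensional ℂ U]
    {g : U ≃ₗ[ℂ] U} (hg : g ∈ gradedAut 𝒰)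
    (hg' : IsUnit (j ∘ₗ (g : Module.End ℂ U) ∘ₗ i' : Module.End ℂ V')) :
    ∃ u ∈ unipotent 𝒰 i j, ∃ p ∈ parabolicSubgroup 𝒰 i', g = u * p := by
  obtain ⟨d, hd⟩ := hg'
  have hdv : ∀ v, (d : Module.End ℂ V') v = j (g (i' v)) := fun v => by rw [hd]; rfl
  have hdg : (d : Module.End ℂ V') ∈ stabEnd 𝒱' := fun ρ v hv => by
    rw [hdv]
    exact h.j_mem ((hg ρ _).2 (h.i'_mem hv))
  have hdinv := (stabEnd 𝒱').inv_mem_of_finiteDimensional d hdg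
  obtain ⟨u, hu, huX⟩ := h.exists_unipotent
    (X := (j' ∘ₗ (g : Module.End ℂ U) ∘ₗ i') ∘ₗ (d⁻¹ : (Module.End ℂ V')ˣ).val)
    fun ρ v hv => h.j'_mem ((hg ρ _).2 (h.i'_mem (hdinv ρ v hv)))
  refine ⟨u, hu, u⁻¹ * g, h.symm.mem_parabolic_iff.2 ⟨mul_mem (inv_mem hu.1) hg, fun v => ?_⟩,
    by rw [mul_inv_cancel_left]⟩
  have hinv : (d⁻¹ : (Module.End ℂ V')ˣ).val (j (g (i' v))) = v := by
    rw [← hdv]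
    exact LinearMap.congr_fun d.inv_mul v
  have hu' : u (i' (j (g (i' v)))) = g (i' v) := by
    rw [huX, h.ji']
    change _ + i (j' (g (i' ((d⁻¹ : (Module.End ℂ V')ˣ).val (j (g (i' v))))))) = _
    rw [hinv, add_comm, h.sum]
  change j' (u.symm (g (i' v))) = 0
  rw [(LinearEquiv.symm_apply_eq u).2 hu'.symm, h.j'i']

variable [FiniteDimensional ℂ V] [FiniteDimensional ℂ V'] [FiniteDimensional ℂ U]
  (h𝒱 : _root_.iSupIndep 𝒱) (h𝒱' : _root_.iSupIndep 𝒱') {m m' : Multisegment s}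
  {A₁ : Module.End ℂ V} {A₂ : Module.End ℂ V'} (hA₁ : A₁ ∈ gradedOrbit 𝒱 m)
  (hA₂ : A₂ ∈ gradedOrbit 𝒱' m')

include h𝒱 h𝒱' hA₁ hA₂

theorem varY_eq : varY 𝒱 𝒱' 𝒰 i j m m' =
    zariskiClosure (conjTranslates (parabolicSubgroup 𝒰 i) ({blockDiag i j i' j' A₁ A₂} ×ˢ
      (commLeft s 𝒰 (blockDiag i j i' j' A₁ A₂) ⊓ blockZero i j :
        Submodule ℂ (Module.End ℂ U)))) :=
  congrArg zariskiClosure (h.irredComponent_inter_pPreimage h𝒱 h𝒱' hA₁ hA₂)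

theorem varY_swap_eq : varY 𝒱' 𝒱 𝒰 i' j' m' m =
    zariskiClosure (conjTranslates (parabolicSubgroup 𝒰 i') ({blockDiag i j i' j' A₁ A₂} ×ˢ
      (commLeft s 𝒰 (blockDiag i j i' j' A₁ A₂) ⊓ blockZero i' j' :
        Submodule ℂ (Module.End ℂ U)))) := by
  rw [h.symm.varY_eq h𝒱' h𝒱 hA₂ hA₁, blockDiag_swap]

theorem conj_mem_varY {g : U ≃ₗ[ℂ] U} (hg : g ∈ parabolicSubgroup 𝒰 i)
    {x : Module.End ℂ U × Module.End ℂ U} (hx : x ∈ varY 𝒱 𝒱' 𝒰 i j m m') :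
    (g.conj x.1, g.conj x.2) ∈ varY 𝒱 𝒱' 𝒰 i j m m' := by
  rw [h.varY_eq h𝒱 h𝒱' hA₁ hA₂] at hx ⊢
  exact conj_mem_zariskiClosure
    (fun y hy => subset_zariskiClosure _ (conj_mem_conjTranslates _ hg hy)) hx

/-- Density of the `𝔾`-translates of `𝔜^i'` in `ℭ_{m + m'}`. -/
theorem conjTranslates_varY_dense_iff :
    irredComponent 𝒰 (m + m') ⊆
      zariskiClosure (conjTranslates (gradedAut 𝒰) (varY 𝒱' 𝒱 𝒰 i' j' m' m)) ↔
      CommutatorSurjective s 𝒱 𝒱' A₁ A₂ := by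
  have hA := h.blockDiag_mem_gradedOrbit hA₁ hA₂
  rw [← h.gradedAut_slice_iff]
  have hcl : zariskiClosure (conjTranslates (gradedAut 𝒰) (varY 𝒱' 𝒱 𝒰 i' j' m' m)) =
      zariskiClosure (conjTranslates (gradedAut 𝒰) ({blockDiag i j i' j' A₁ A₂} ×ˢ
        (commLeft s 𝒰 (blockDiag i j i' j' A₁ A₂) ⊓ blockZero i' j' :
          Submodule ℂ (Module.End ℂ U)))) := by
    rw [h.varY_swap_eq h𝒱 h𝒱' hA₁ hA₂]
    refine Set.Subset.antisymm ((zariskiClosure_conjTranslates_subset_iff _).2 ?_)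
      ((zariskiClosure_conjTranslates_subset_iff _).2 ?_)
    · exact zariskiClosure_mono (conjTranslates_mono_left (parabolicSubgroup_le 𝒰 i'))
    · exact (subset_conjTranslates (parabolicSubgroup 𝒰 i')).trans
        ((subset_zariskiClosure _).trans ((subset_conjTranslates (gradedAut 𝒰)).trans
          (subset_zariskiClosure _)))
  rw [hcl, irredComponent, openComponent_eq_conjTranslates (h.iSupIndep h𝒱 h𝒱') hA,
    zariskiClosure_conjTranslates_subset_iff]
  exact ⟨fun hs B hB => hs ⟨rfl, hB⟩, fun hs => by
    rintro ⟨_, B⟩ ⟨rfl, hB⟩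
    exact hs B hB⟩

omit [FiniteDimensional ℂ V'] in
/-- The intersection `𝔜^i ∩ 𝔜^i'` consists of block diagonal pairs with blocks in `ℭ_m` and
`ℭ_{m'}`, so it is contained in the closure of the translates of the block diagonal slice. -/
theorem varY_inter_varY_subset :
    varY 𝒱 𝒱' 𝒰 i j m m' ∩ varY 𝒱' 𝒱 𝒰 i' j' m' m ⊆
      zariskiClosure (conjTranslates (parabolicSubgroup 𝒰 i) ({blockDiag i j i' j' A₁ A₂} ×ˢ
        (commLeft s 𝒰 (blockDiag i j i' j' A₁ A₂) ⊓ blockZero i j ⊓ blockZero i' j' :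
          Submodule ℂ (Module.End ℂ U)))) := by
  rintro x ⟨hx, hx'⟩
  set T := conjTranslates (parabolicSubgroup 𝒰 i) ({blockDiag i j i' j' A₁ A₂} ×ˢ
        ((commLeft s 𝒰 (blockDiag i j i' j' A₁ A₂) ⊓ blockZero i j ⊓ blockZero i' j' :
          Submodule ℂ (Module.End ℂ U)) : Set (Module.End ℂ U)))
  have h₁ := h.compress_mem_irredComponent hx
  have h₂ := h.symm.compress_mem_irredComponent hx'
  have hz := mem_blockZero_of_mem_varY hx
  have hz' := mem_blockZero_of_mem_varY hx'
  let Ψ : (Module.End ℂ V × Module.End ℂ V) → (Module.End ℂ V' × Module.End ℂ V') →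
    Module.End ℂ U × Module.End ℂ U := fun y y' =>
      (blockDiag i j i' j' y.1 y'.1, blockDiag i j i' j' y.2 y'.2)
  let P₁ : Module.End ℂ V →ₗ[ℂ] Module.End ℂ U :=
    LinearMap.llcomp ℂ U V U i ∘ₗ LinearMap.lcomp ℂ V j'
  let P₂ : Module.End ℂ V' →ₗ[ℂ] Module.End ℂ U :=
    LinearMap.llcomp ℂ U V' U i' ∘ₗ LinearMap.lcomp ℂ V' j
  have hΨ : ∀ y y', Ψ y y' = P₁.prodMap P₁ y + P₂.prodMap P₂ y' := fun y y' => rfl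
  have base : ∀ y ∈ openComponent 𝒱 m, ∀ y' ∈ openComponent 𝒱' m', Ψ y y' ∈ T := by
    intro y hy y' hy'
    rw [openComponent_eq_conjTranslates h𝒱 hA₁] at hy
    rw [openComponent_eq_conjTranslates h𝒱' hA₂] at hy'
    obtain ⟨g₁, hg₁, ⟨_, b₁⟩, ⟨rfl, hb₁⟩, rfl⟩ := hy
    obtain ⟨g₂, hg₂, ⟨_, b₂⟩, ⟨rfl, hb₂⟩, rfl⟩ := hy'
    obtain ⟨l, hl, hli, -, -, -, hconj⟩ := h.exists_levi hg₁ hg₂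
    exact ⟨l, h.mem_parabolic_iff.2 ⟨hl, fun v => by rw [hli, h.ji]⟩,
      (_, blockDiag i j i' j' b₁ b₂), ⟨rfl, ⟨h.blockDiag_mem_commLeft hb₁ hb₂, fun v => by
        rw [h.blockDiag_i, h.ji]⟩, fun v => by rw [h.blockDiag_i', h.j'i']⟩,
      Prod.ext (hconj _ _).symm (hconj _ _).symm⟩
  -- A product of closures is contained in the closure: vary one factor at a time.
  have step : ∀ y ∈ irredComponent 𝒱 m, ∀ y' ∈ openComponent 𝒱' m', Ψ y y' ∈ zariskiClosure T := by
    intro y hy y' hy'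
    refine IsPolyMap.map_mem_zariskiClosure (Φ := fun y => Ψ y y') ?_
      (fun z hz => subset_zariskiClosure _ (base z hz y' hy')) hy
    simp only [hΨ]
    exact (P₁.prodMap P₁).isPolyMap.add (isPolyMap_const _)
  have step' : ∀ y ∈ irredComponent 𝒱 m, ∀ y' ∈ irredComponent 𝒱' m',
      Ψ y y' ∈ zariskiClosure T := by
    intro y hy y' hy'
    refine IsPolyMap.map_mem_zariskiClosure (Φ := fun y' => Ψ y y') ?_
      (fun z hz => step y hy z hz) hy'
    simp only [hΨ]
    exact (isPolyMap_const _).add (P₂.prodMap P₂).isPolyMap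
  have := step' _ h₁ _ h₂
  rwa [show Ψ _ _ = x from Prod.ext (h.eq_blockDiag hz.1 hz'.1) (h.eq_blockDiag hz.2 hz'.2)] at this

/-- Density of the `ℙ^i`-translates of `𝔜^i ∩ 𝔜^i'` in `𝔜^i`. -/
theorem conjTranslates_inter_dense_iff :
    varY 𝒱 𝒱' 𝒰 i j m m' ⊆ zariskiClosure (conjTranslates (parabolicSubgroup 𝒰 i)
        (varY 𝒱 𝒱' 𝒰 i j m m' ∩ varY 𝒱' 𝒱 𝒰 i' j' m' m)) ↔
      CommutatorSurjective s 𝒱 𝒱' A₁ A₂ := by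
  rw [← h.parabolic_slice_iff]
  have hcl : zariskiClosure (conjTranslates (parabolicSubgroup 𝒰 i)
        (varY 𝒱 𝒱' 𝒰 i j m m' ∩ varY 𝒱' 𝒱 𝒰 i' j' m' m)) =
      zariskiClosure (conjTranslates (parabolicSubgroup 𝒰 i) ({blockDiag i j i' j' A₁ A₂} ×ˢ
        (commLeft s 𝒰 (blockDiag i j i' j' A₁ A₂) ⊓ blockZero i j ⊓ blockZero i' j' :
          Submodule ℂ (Module.End ℂ U)))) := by
    refine Set.Subset.antisymm ((zariskiClosure_conjTranslates_subset_iff _).2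
      (h.varY_inter_varY_subset h𝒱 h𝒱' hA₁ hA₂))
      (zariskiClosure_mono ?_)
    rintro _ ⟨g, hg, ⟨_, B⟩, ⟨rfl, hB⟩, rfl⟩
    refine ⟨g, hg, _, ⟨?_, ?_⟩, rfl⟩
    · rw [h.varY_eq h𝒱 h𝒱' hA₁ hA₂]
      exact subset_zariskiClosure _ (subset_conjTranslates (parabolicSubgroup 𝒰 i) ⟨rfl, hB.1⟩)
    · rw [h.varY_swap_eq h𝒱 h𝒱' hA₁ hA₂]
      exact subset_zariskiClosure _
        (subset_conjTranslates (parabolicSubgroup 𝒰 i') ⟨rfl, hB.1.1, hB.2⟩)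
  rw [hcl]
  conv_lhs => rw [h.varY_eq h𝒱 h𝒱' hA₁ hA₂]
  rw [zariskiClosure_conjTranslates_subset_iff]
  exact ⟨fun hs B hB => hs ⟨rfl, hB⟩, fun hs => by
    rintro ⟨_, B⟩ ⟨rfl, hB⟩
    exact hs B hB⟩

/-- As `ℨ` is stable under the Levi subgroup, its parabolic and unipotent translates agree. -/
theorem conjTranslates_parabolic_inter :
    conjTranslates (parabolic 𝒰 i) (varY 𝒱 𝒱' 𝒰 i j m m' ∩ varY 𝒱' 𝒱 𝒰 i' j' m' m) =
      conjTranslates (unipotent 𝒰 i j) (varY 𝒱 𝒱' 𝒰 i j m m' ∩ varY 𝒱' 𝒱 𝒰 i' j' m' m) := by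
  refine Set.Subset.antisymm ?_ (conjTranslates_mono_left h.unipotent_subset_parabolic)
  rintro _ ⟨g, hg, x, hx, rfl⟩
  obtain ⟨u, hu, l, hl, hl', rfl⟩ := h.exists_unipotent_mul_levi hg
  exact ⟨u, hu, _, ⟨h.conj_mem_varY h𝒱 h𝒱' hA₁ hA₂ hl hx.1,
    h.symm.conj_mem_varY h𝒱' h𝒱 hA₂ hA₁ hl' hx.2⟩, rfl⟩

/-- The `𝔾`-translates of `𝔜^i'` lie in the closure of the `𝕌^i`-translates. -/
theorem conj_mem_closure_unipotent {g : U ≃ₗ[ℂ] U} (hg : g ∈ gradedAut 𝒰)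
    {x : Module.End ℂ U × Module.End ℂ U} (hx : x ∈ varY 𝒱' 𝒱 𝒰 i' j' m' m) :
    (g.conj x.1, g.conj x.2) ∈
      zariskiClosure (conjTranslates (unipotent 𝒰 i j) (varY 𝒱' 𝒱 𝒰 i' j' m' m)) := by
  -- The block of `g + t` on `V'` is invertible unless `-t` is an eigenvalue of the block of `g`.
  let D : Module.End ℂ V' := j ∘ₗ (g : Module.End ℂ U) ∘ₗ i'
  refine conjPair_mem_zariskiClosure_of_add_smul (LinearMap.GeneralLinearGroup.ofLinearEquiv g)
    (Neg.neg ⁻¹' spectrum ℂ D) ((Module.End.finite_spectrum D).preimage neg_injective.injOn)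
    fun t ht k hk => ?_
  have hkv : ∀ w, (k : Module.End ℂ U) w = g w + t • w := LinearMap.congr_fun hk
  let k' : U ≃ₗ[ℂ] U := LinearMap.GeneralLinearGroup.toLinearEquiv k
  have hk' : k' ∈ gradedAut 𝒰 := mem_gradedAut_iff.2 fun ρ v hv => by
    change (k : Module.End ℂ U) v ∈ _
    rw [hkv]
    exact add_mem ((hg ρ v).2 hv) (Submodule.smul_mem _ t hv)
  have hunit : IsUnit (j ∘ₗ (k' : Module.End ℂ U) ∘ₗ i' : Module.End ℂ V') := by
    have h1 : IsUnit (algebraMap ℂ (Module.End ℂ V') (-t) - D) := spectrum.notMem_iff.1 ht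
    rw [← IsUnit.neg_iff, neg_sub] at h1
    convert h1 using 1
    ext v
    change j ((k : Module.End ℂ U) (i' v)) = j (g (i' v)) - (-t) • v
    rw [hkv, map_add, map_smul, h.ji', neg_smul, sub_neg_eq_add]
  obtain ⟨u, hu, p, hp, hup⟩ := h.exists_unipotent_mul_opposite hk' hunit
  refine subset_zariskiClosure _ ⟨u, hu, _, h.symm.conj_mem_varY h𝒱' h𝒱 hA₂ hA₁ hp hx, ?_⟩
  change (k'.conj x.1, k'.conj x.2) = _
  rw [hup]
  rfl

end IsGradedSplitting

end Density

theorem IsGradingOfDim.iSupIndep {R V : Type*} [AddCommGroup V] [Module ℂ V]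
    {𝒱 : R → Submodule ℂ V} {d : Multiset R} (h : IsGradingOfDim 𝒱 d) : iSupIndep 𝒱 := by
  classical
  exact h.1.submodule_iSupIndep

theorem isGradedSplitting_prod {R V V' : Type*} [AddCommGroup V] [Module ℂ V] [AddCommGroup V']
    [Module ℂ V'] (𝒱 : R → Submodule ℂ V) (𝒱' : R → Submodule ℂ V') :
    IsGradedSplitting 𝒱 𝒱' (sumGrading 𝒱 𝒱') (LinearMap.inl ℂ V V') (LinearMap.snd ℂ V V')
      (LinearMap.inr ℂ V V') (LinearMap.fst ℂ V V') where
  ji _ := rfl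
  j'i' _ := rfl
  j'i _ := rfl
  ji' _ := rfl
  sum u := by simp
  i_mem hv := ⟨hv, zero_mem _⟩
  i'_mem hv := ⟨zero_mem _, hv⟩
  j_mem hu := hu.2
  j'_mem hu := hu.1

theorem proposition5p1 {F : Type*} [Field F] [ValuativeRel F] [TopologicalSpace F]
    [IsNonarchimedeanLocalField F]
    {V V' : Type*} [AddCommGroup V] [Module ℂ V] [FiniteDimensional ℂ V]
    [AddCommGroup V'] [Module ℂ V'] [FiniteDimensional ℂ V']
    (𝒱 : Irrc F → Submodule ℂ V) (𝒱' : Irrc F → Submodule ℂ V')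
    (m m' : Multisegment (Irrc.shift F))
    (hm : IsGradingOfDim 𝒱 m.supp) (hm' : IsGradingOfDim 𝒱' m'.supp) :
    List.TFAE [
      IsZariskiDenseIn
        (conjTranslates (gradedAut (sumGrading 𝒱 𝒱')) (varYι' 𝒱 𝒱' m' m))
        (irredComponent (sumGrading 𝒱 𝒱') (m + m')),
      IsZariskiDenseIn
        (conjTranslates (unipotentι 𝒱 𝒱') (varYι' 𝒱 𝒱' m' m))
        (irredComponent (sumGrading 𝒱 𝒱') (m + m')),
      IsZariskiDenseIn (conjTranslates (parabolicι 𝒱 𝒱') (varZ 𝒱 𝒱' m m')) (varYι 𝒱 𝒱' m m'),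
      IsZariskiDenseIn (conjTranslates (unipotentι 𝒱 𝒱') (varZ 𝒱 𝒱' m m'))
        (varYι 𝒱 𝒱' m m')] := by
  have h := isGradedSplitting_prod 𝒱 𝒱'
  have h𝒱 := hm.iSupIndep
  have h𝒱' := hm'.iSupIndep
  obtain ⟨A₁, hA₁⟩ := gradedOrbit_nonempty hm
  obtain ⟨A₂, hA₂⟩ := gradedOrbit_nonempty hm'
  have hsub : conjTranslates (gradedAut (sumGrading 𝒱 𝒱')) (varYι' 𝒱 𝒱' m' m) ⊆
      irredComponent (sumGrading 𝒱 𝒱') (m + m') := by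
    rintro _ ⟨g, hg, x, hx, rfl⟩
    have := varY_subset_irredComponent m' m hx
    rw [add_comm] at this
    exact conj_mem_irredComponent hg this
  have hU : unipotentι 𝒱 𝒱' ⊆ gradedAut (sumGrading 𝒱 𝒱') := fun _ hg => hg.1
  have hsub' : conjTranslates (parabolicι 𝒱 𝒱') (varZ 𝒱 𝒱' m m') ⊆ varYι 𝒱 𝒱' m m' := by
    rintro _ ⟨g, hg, x, hx, rfl⟩
    exact h.conj_mem_varY h𝒱 h𝒱' hA₁ hA₂ hg hx.1
  tfae_have 1 → 2 := fun h1 =>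
    ⟨(conjTranslates_mono_left hU).trans hsub, h1.2.trans (zariskiClosure_subset_iff.2 (by
      rintro _ ⟨g, hg, x, hx, rfl⟩
      exact h.conj_mem_closure_unipotent h𝒱 h𝒱' hA₁ hA₂ hg hx))⟩
  tfae_have 2 → 1 := fun h2 =>
    ⟨hsub, h2.2.trans (zariskiClosure_mono (conjTranslates_mono_left hU))⟩
  tfae_have 1 ↔ 3 := by
    refine Iff.trans ⟨fun h1 => h1.2, fun h1 => ⟨hsub, h1⟩⟩
      (((h.conjTranslates_varY_dense_iff h𝒱 h𝒱' hA₁ hA₂).trans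
        (h.conjTranslates_inter_dense_iff h𝒱 h𝒱' hA₁ hA₂).symm).trans
        ⟨fun h3 => ⟨hsub', h3⟩, fun h3 => h3.2⟩)
  tfae_have 3 ↔ 4 := by
    have := h.conjTranslates_parabolic_inter h𝒱 h𝒱' hA₁ hA₂
    change conjTranslates (parabolicι 𝒱 𝒱') (varZ 𝒱 𝒱' m m') =
      conjTranslates (unipotentι 𝒱 𝒱') (varZ 𝒱 𝒱' m m') at this
    rw [this]
  tfae_finish
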